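/- **Setting.** Let $\kappa\ge 0$, $\lambda\in\mathbb C$, $L\ge 7$, $\Lambda=[1,L]$, and let $\mathcal H_\Lambda$ be the bosonic Fock space with orthonormal basis $\{|\mu\rangle:\mu\in\mathbb N_0^\Lambda\}$. For an interval $[c,d]\subseteq\Lambda$ let $$H_{[c,d]}=\sum_{x=c}^{d-1}n_xn_{x+1}+\kappa\sum_{x=c+1}^{d-1}q_x^*q_x,\qquad q_x=a_x^2-\lambda a_{x-1}a_{x+1},$$ be the self-adjoint operator on $\mathcal H_\Lambda$ defined by the corresponding energy form (open boundary conditions). *Tilings.* The tiles, written as the occupation numbers of the consecutive sites they cover, are the bulk tiles $V=(0)$, $M=(10)$, $D=(0200)$, the left boundary tiles $B^l_n=(n00)$, $n\ge2$, and the right boundary tiles $M^{(1)}=(1)$, $D^{(1)}=(020)$, $B^r_n=(0n)$, $n\ge2$. A tiling $T$ of an interval is an ordered covering in which only the first (last) tile may be a left (right) boundary tile; $\sigma(T)$ is its configuration. Two tilings are connected if one is obtained from the other by finitely many replacements $D\leftrightarrow MM$ and $D^{(1)}\leftrightarrow MM^{(1)}$, and $d(T)$ is the number of tiles $D$, $D^{(1)}$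 in $T$. A root tiling is a tiling without $D$ and $D^{(1)}$; $\mathcal R^\infty_\Lambda$ is the set of root tilings of $\Lambda$ with first tile in $\{V,M,B^l_2\}$ and last tile in $\{V,M,M^{(1)},B^r_2\}$. The bulk tiling space is $$\mathcal C^\infty_\Lambda=\bigoplus_{R\in\mathcal R^\infty_\Lambda}\operatorname{span}\{|\sigma(T)\rangle: T \text{ connected to } R\}.$$ *The function $f$.* Let $\varphi_n=\sum_{T}(\lambda/\sqrt2)^{d(T)}|\sigma(T)\rangle$, the sum being over the tilings $T$ of $[1,2n]$ connected to $(M,\dots,M)$ ($n$ monomers), with $\|\varphi_0\|=1$, and put $\beta_n=\|\varphi_{n-1}\|^2/\|\varphi_n\|^2$. These ratios depend on $\lambda$ only through $r=|\lambda|^2/2$, and $$f(r)=\sup_{n\ge4}f_n(r),\qquad f_n(r)=r\beta_n\beta_{n-2}\left(\frac{[1-\beta_{n-1}(1+r)]^2}{1+2r}+\frac{r\,\beta_{n-3}(1-\beta_{n-1})^2}{1+r}\right)$$ is a finite number, which depends only on $r$. *Martingale sequences.* Write $L=2N+k$ with $k\in\{1,2\}$. Let $\Lambda_2=[1,4+k]$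 and $\Lambda_n=[2n+k-5,2n+k]$ for $3\le n\le N$, $h_n=H_{\Lambda_n}$, and $H_n=\sum_{m=2}^nh_m$. Let $g_n$ and $G_n$ be the orthogonal projections onto $\ker h_n$ and $\ker H_n$, and let $E_1=1-G_2$, $E_n=G_n-G_{n+1}$ for $2\le n\le N-1$, $E_N=G_N$. **Theorem 3.2 (Application of the Martingale Method).** The space $\mathcal C^\infty_\Lambda$ lies in the domains of $H_\Lambda$, $h_n$, $H_n$ and is invariant under these operators and under $g_n,G_n,E_n$. Their restrictions to $\mathcal C^\infty_\Lambda$, marked by $\infty$, satisfy: 1. $h_n^\infty\ge 2\kappa(1-g_n^\infty)$ for all $2\le n\le N$. 2. For all $2\le n\le N$ and $1\le m\le N$: $[g_n^\infty,E_m^\infty]\ne0$ only if $m\in[n-3,n-1]$. 3. If $\lambda\neq0$, then $\|g_{n+1}^\infty E_n^\infty\|\le\sqrt{f(|\lambda|^2/2)}$ for all $2\le n\le N-1$. If $\lambda\ne0$ and $f(|\lambda|^2/2)<1/3$, then $$E_1(\mathcal C^\infty_{[1,L]}):=\inf_{0\ne\psi\in\mathcal C^\infty_\Lambda\cap(\ker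 H_\Lambda)^\perp}\frac{\langle\psi|H_\Lambda\psi\rangle}{\|\psi\|^2}\ \ge\ \frac{2\kappa}{3}\left(1-\sqrt{3f(|\lambda|^2/2)}\right)^2 .$$ Moreover, $f(|\lambda|^2/2)<1/3$ for $|\lambda|\le7.4$. -/

import Mathlib

open scoped InnerProductSpace

noncomputable section

namespace TruncatedHaldane

/-! ## Fock space of the sites `1, …, L` -/

/-- Particle configurations `μ ∈ ℕ₀^Λ` on the interval `Λ = [1, L]`. -/
abbrev Config (L : ℕ) : Type := ↥(Finset.Icc 1 L) → ℕ

/-- The bosonic Fock space `ℋ_Λ` of `Λ = [1, L]`: square summable families of coefficients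
`ψ(μ)` indexed by the configurations. -/
abbrev Fock (L : ℕ) : Type := lp (fun _ : Config L => ℂ) 2

/-- The configuration state `|μ⟩`. -/
def ket {L : ℕ} (μ : Config L) : Fock L := lp.single 2 μ (1 : ℂ)

/-- The occupation number `μ_x` of the site `x` (and `0` if `x` is not a site of `[1, L]`). -/
def occ {L : ℕ} (μ : Config L) (x : ℕ) : ℕ :=
  if h : x ∈ Finset.Icc 1 L then μ ⟨x, h⟩ else 0

/-- `α*_x ν`: add one particle at the site `x`. -/
def addParticle {L : ℕ} (x : ℕ) (ν : Config L) : Config L :=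
  fun y => if (y : ℕ) = x then ν y + 1 else ν y

/-- The hopping operator `q_x = a_x² - λ a_{x-1} a_{x+1}`, acting on coefficients. -/
def hop {L : ℕ} (lam : ℂ) (x : ℕ) (ψ : Config L → ℂ) (ν : Config L) : ℂ :=
  (√(((occ ν x : ℝ) + 1) * ((occ ν x : ℝ) + 2)) : ℝ) * ψ (addParticle x (addParticle x ν))
    - lam * (√(((occ ν (x - 1) : ℝ) + 1) * ((occ ν (x + 1) : ℝ) + 1)) : ℝ)
      * ψ (addParticle (x + 1) (addParticle (x - 1) ν))

/-- The electrostatic energy `∑_{x=c}^{d-1} μ_x μ_{x+1}` inside the interval `[c, d]`. -/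
def electro {L : ℕ} (c d : ℕ) (μ : Config L) : ℕ :=
  ∑ x ∈ Finset.Ico c d, occ μ x * occ μ (x + 1)

/-! ## The Hamiltonian with open boundary conditions -/

theorem summable_weight_add {ι : Type*} (w : ι → ℕ) (u v : ι → ℂ)
    (hu : Summable fun i => (w i : ℝ) * ‖u i‖ ^ 2) (hv : Summable fun i => (w i : ℝ) * ‖v i‖ ^ 2) :
    Summable fun i => (w i : ℝ) * ‖u i + v i‖ ^ 2 := by
  refine Summable.of_nonneg_of_le (fun i => by positivity) (fun i => ?_)
    ((hu.mul_left 2).add (hv.mul_left 2))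
  have h1 : ‖u i + v i‖ ^ 2 ≤ (‖u i‖ + ‖v i‖) ^ 2 := by
    gcongr
    exact norm_add_le _ _
  have h2 : (‖u i‖ + ‖v i‖) ^ 2 ≤ 2 * ‖u i‖ ^ 2 + 2 * ‖v i‖ ^ 2 := by
    nlinarith [sq_nonneg (‖u i‖ - ‖v i‖)]
  have h3 := mul_le_mul_of_nonneg_left (h1.trans h2) (Nat.cast_nonneg (α := ℝ) (w i))
  linarith

theorem summable_weight_smul {ι : Type*} (w : ι → ℕ) (z : ℂ) (u : ι → ℂ)
    (hu : Summable fun i => (w i : ℝ) * ‖u i‖ ^ 2) :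
    Summable fun i => (w i : ℝ) * ‖z * u i‖ ^ 2 := by
  refine (hu.mul_left (‖z‖ ^ 2)).congr (fun i => ?_)
  rw [norm_mul]
  ring

theorem summable_weight_mul {ι : Type*} (w : ι → ℕ) (u v : ι → ℂ)
    (hu : Summable fun i => (w i : ℝ) * ‖u i‖ ^ 2) (hv : Summable fun i => (w i : ℝ) * ‖v i‖ ^ 2) :
    Summable fun i => (w i : ℂ) * (starRingEnd ℂ (u i) * v i) := by
  refine Summable.of_norm_bounded (hu.add hv) (fun i => ?_)
  rw [norm_mul, norm_mul, RCLike.norm_conj, Complex.norm_natCast]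
  have h : ‖u i‖ * ‖v i‖ ≤ ‖u i‖ ^ 2 + ‖v i‖ ^ 2 := by
    nlinarith [sq_nonneg (‖u i‖ - ‖v i‖), sq_nonneg ‖u i‖, sq_nonneg ‖v i‖]
  have h3 := mul_le_mul_of_nonneg_left h (Nat.cast_nonneg (α := ℝ) (w i))
  linarith

theorem hop_add {L : ℕ} (lam : ℂ) (x : ℕ) (φ ψ : Config L → ℂ) (ν : Config L) :
    hop lam x (φ + ψ) ν = hop lam x φ ν + hop lam x ψ ν := by
  simp only [hop, Pi.add_apply]
  ring

theorem hop_smul {L : ℕ} (lam : ℂ) (x : ℕ) (z : ℂ) (ψ : Config L → ℂ) (ν : Config L) :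
    hop lam x (z • ψ) ν = z * hop lam x ψ ν := by
  simp only [hop, Pi.smul_apply, smul_eq_mul]
  ring

/-- The vectors of finite energy for the interaction terms inside `[c, d]`: the domain of the
(closed) energy form. -/
def formDomain (L : ℕ) (κ : ℝ) (lam : ℂ) (c d : ℕ) : Submodule ℂ (Fock L) where
  carrier := {ψ | (Summable fun μ : Config L => (electro c d μ : ℝ) * ‖ψ μ‖ ^ 2) ∧
    ∀ x ∈ Finset.Ioo c d, κ ≠ 0 → Summable fun ν : Config L => ‖hop lam x ψ ν‖ ^ 2}
  zero_mem' := by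
    refine ⟨by simp, fun x _ _ => ?_⟩
    have : (fun ν : Config L => ‖hop lam x ((0 : Fock L) : Config L → ℂ) ν‖ ^ 2) = 0 := by
      ext ν
      simp [hop]
    rw [this]
    exact summable_zero
  add_mem' := by
    rintro φ ψ ⟨h1, h2⟩ ⟨h3, h4⟩
    refine ⟨summable_weight_add _ _ _ h1 h3, fun x hx hκ => ?_⟩
    have := summable_weight_add (fun _ => 1) _ _ (by simpa using h2 x hx hκ)
      (by simpa using h4 x hx hκ)
    simp only [Nat.cast_one, one_mul] at this
    simpa only [lp.coeFn_add, hop_add] using this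
  smul_mem' := by
    rintro z ψ ⟨h1, h2⟩
    refine ⟨summable_weight_smul _ z _ h1, fun x hx hκ => ?_⟩
    have := summable_weight_smul (fun _ => 1) z _ (by simpa using h2 x hx hκ)
    simp only [Nat.cast_one, one_mul] at this
    simpa only [lp.coeFn_smul, hop_smul] using this

/-- The sesquilinear energy form of the interaction terms inside `[c, d]`,
`∑_μ e(μ) conj(φ(μ)) ψ(μ) + κ ∑_{x=c+1}^{d-1} ∑_ν conj((q_x φ)(ν)) (q_x ψ)(ν)`. -/
def energyForm (L : ℕ) (κ : ℝ) (lam : ℂ) (c d : ℕ) (φ ψ : Fock L) : ℂ :=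
  (∑' μ : Config L, (electro c d μ : ℂ) * (starRingEnd ℂ (φ μ) * ψ μ))
    + κ * ∑ x ∈ Finset.Ioo c d,
        ∑' ν : Config L, starRingEnd ℂ (hop lam x φ ν) * hop lam x ψ ν

theorem energyForm_add {L : ℕ} {κ : ℝ} {lam : ℂ} {c d : ℕ} {χ φ ψ : Fock L}
    (hχ : χ ∈ formDomain L κ lam c d) (hφ : φ ∈ formDomain L κ lam c d)
    (hψ : ψ ∈ formDomain L κ lam c d) :
    energyForm L κ lam c d χ (φ + ψ)
      = energyForm L κ lam c d χ φ + energyForm L κ lam c d χ ψ := by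
  have h1 : (∑' μ : Config L, (electro c d μ : ℂ) * (starRingEnd ℂ (χ μ) * (φ + ψ) μ))
      = (∑' μ : Config L, (electro c d μ : ℂ) * (starRingEnd ℂ (χ μ) * φ μ))
        + ∑' μ : Config L, (electro c d μ : ℂ) * (starRingEnd ℂ (χ μ) * ψ μ) := by
    rw [← (summable_weight_mul _ _ _ hχ.1 hφ.1).tsum_add (summable_weight_mul _ _ _ hχ.1 hψ.1)]
    refine tsum_congr fun μ => ?_
    rw [lp.coeFn_add, Pi.add_apply]
    ring
  unfold energyForm
  rw [h1]
  by_cases hκ : κ = 0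
  · simp [hκ]
  have h2 : (∑ x ∈ Finset.Ioo c d,
        ∑' ν : Config L, starRingEnd ℂ (hop lam x χ ν) * hop lam x (φ + ψ : Fock L) ν)
      = (∑ x ∈ Finset.Ioo c d, ∑' ν : Config L, starRingEnd ℂ (hop lam x χ ν) * hop lam x φ ν)
        + ∑ x ∈ Finset.Ioo c d,
          ∑' ν : Config L, starRingEnd ℂ (hop lam x χ ν) * hop lam x ψ ν := by
    rw [← Finset.sum_add_distrib]
    refine Finset.sum_congr rfl fun x hx => ?_
    have a := summable_weight_mul (fun _ => 1) _ _ (by simpa using hχ.2 x hx hκ)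
      (by simpa using hφ.2 x hx hκ)
    have b := summable_weight_mul (fun _ => 1) _ _ (by simpa using hχ.2 x hx hκ)
      (by simpa using hψ.2 x hx hκ)
    simp only [Nat.cast_one, one_mul] at a b
    rw [← a.tsum_add b]
    refine tsum_congr fun ν => ?_
    rw [lp.coeFn_add, hop_add]
    ring
  rw [h2]
  ring

theorem energyForm_smul {L : ℕ} {κ : ℝ} {lam : ℂ} {c d : ℕ} (z : ℂ) (χ ψ : Fock L) :
    energyForm L κ lam c d χ (z • ψ) = z * energyForm L κ lam c d χ ψ := by
  unfold energyForm
  have h1 : (∑' μ : Config L, (electro c d μ : ℂ) * (starRingEnd ℂ (χ μ) * (z • ψ) μ))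
      = z * ∑' μ : Config L, (electro c d μ : ℂ) * (starRingEnd ℂ (χ μ) * ψ μ) := by
    rw [← tsum_mul_left]
    refine tsum_congr fun μ => ?_
    rw [lp.coeFn_smul, Pi.smul_apply, smul_eq_mul]
    ring
  have h2 : ∀ x, (∑' ν : Config L, starRingEnd ℂ (hop lam x χ ν) * hop lam x (z • ψ : Fock L) ν)
      = z * ∑' ν : Config L, starRingEnd ℂ (hop lam x χ ν) * hop lam x ψ ν := by
    intro x
    rw [← tsum_mul_left]
    refine tsum_congr fun ν => ?_
    rw [lp.coeFn_smul, hop_smul]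
    ring
  rw [h1, Finset.sum_congr rfl fun x _ => h2 x, ← Finset.mul_sum]
  ring

/-- The graph of the operator associated with the energy form: `(ψ, φ)` belongs to it if `ψ` has
finite energy and `⟨χ, φ⟩` is the value of the form at `(χ, ψ)` for every `χ` of finite energy. -/
def hamGraph (L : ℕ) (κ : ℝ) (lam : ℂ) (c d : ℕ) : Submodule ℂ (Fock L × Fock L) where
  carrier := {p | p.1 ∈ formDomain L κ lam c d ∧
    ∀ χ ∈ formDomain L κ lam c d, energyForm L κ lam c d χ p.1 = ⟪χ, p.2⟫_ℂ}
  zero_mem' := by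
    refine ⟨Submodule.zero_mem _, fun χ _ => ?_⟩
    have := energyForm_smul (κ := κ) (lam := lam) (c := c) (d := d) 0 χ 0
    simpa using this
  add_mem' := by
    rintro p p' ⟨h1, h2⟩ ⟨h3, h4⟩
    refine ⟨Submodule.add_mem _ h1 h3, fun χ hχ => ?_⟩
    rw [Prod.fst_add, Prod.snd_add, energyForm_add hχ h1 h3, h2 χ hχ, h4 χ hχ, inner_add_right]
  smul_mem' := by
    rintro z p ⟨h1, h2⟩
    refine ⟨Submodule.smul_mem _ z h1, fun χ hχ => ?_⟩
    rw [Prod.smul_fst, Prod.smul_snd, energyForm_smul, h2 χ hχ, inner_smul_right]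

/-- The Hamiltonian `H_{[c,d]} ⊗ 1` with open boundary conditions on the subinterval
`[c, d] ⊆ [1, L]`, as a self-adjoint operator on the Fock space of `[1, L]`: the operator
associated with the energy form of all interaction terms `n_x n_{x+1}` and `κ q_x* q_x` supported
in `[c, d]`. For `[c, d] = [1, L]` it is the Hamiltonian `H_{[1,L]}`. -/
def ham (L : ℕ) (κ : ℝ) (lam : ℂ) (c d : ℕ) : Fock L →ₗ.[ℂ] Fock L :=
  (hamGraph L κ lam c d).toLinearPMap

theorem addParticle_injective {L : ℕ} (x : ℕ) :
    Function.Injective (addParticle x : Config L → Config L) := by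
  intro μ ν h
  ext y
  have := congrFun h y
  simp only [addParticle] at this
  split_ifs at this <;> omega

theorem ket_mem_formDomain {L : ℕ} (κ : ℝ) (lam : ℂ) (c d : ℕ) (μ : Config L) :
    ket μ ∈ formDomain L κ lam c d := by
  have hz : ∀ η, η ≠ μ → (ket μ : Config L → ℂ) η = 0 := by
    intro η hη
    simp [ket, hη]
  refine ⟨summable_of_ne_finset_zero (s := {μ}) fun η hη => ?_, fun x _ _ => ?_⟩
  · rw [hz η (by simpa using hη)]
    simp
  · have hfin : ({ν : Config L | addParticle x (addParticle x ν) = μ} ∪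
        {ν : Config L | addParticle (x + 1) (addParticle (x - 1) ν) = μ}).Finite := by
      refine Set.Finite.union (Set.Subsingleton.finite ?_) (Set.Subsingleton.finite ?_)
      · intro ν hν ν' hν'
        exact addParticle_injective x (addParticle_injective x (Eq.trans hν (Eq.symm hν')))
      · intro ν hν ν' hν'
        exact addParticle_injective _ (addParticle_injective _ (Eq.trans hν (Eq.symm hν')))
    refine summable_of_ne_finset_zero (s := hfin.toFinset) fun ν hν => ?_
    simp only [Set.Finite.mem_toFinset, Set.mem_union, Set.mem_ofPred_eq, not_or] at hν
    simp [hop, hz _ hν.1, hz _ hν.2]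

/-- The form determines the operator: `hamGraph` is the graph of `ham`. -/
theorem ham_graph (L : ℕ) (κ : ℝ) (lam : ℂ) (c d : ℕ) :
    (ham L κ lam c d).graph = hamGraph L κ lam c d := by
  refine Submodule.toLinearPMap_graph_eq _ ?_
  rintro ⟨ψ, φ⟩ ⟨_, h⟩ (hψ : ψ = 0)
  subst hψ
  change φ = 0
  ext μ
  have h1 := h _ (ket_mem_formDomain κ lam c d μ)
  have h0 := energyForm_smul (κ := κ) (lam := lam) (c := c) (d := d) 0 (ket μ) 0
  simp only [smul_zero, zero_mul] at h0
  change energyForm L κ lam c d (ket μ) 0 = ⟪ket μ, φ⟫_ℂ at h1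
  rw [h0, ket, lp.inner_single_left] at h1
  simpa using h1.symm

/-! ## Kernels, ground-state projections and spectral gaps -/

/-- The kernel of an unbounded operator. -/
def kernel {E : Type*} [AddCommGroup E] [Module ℂ E] (A : E →ₗ.[ℂ] E) : Submodule ℂ E :=
  A.toFun.ker.map A.domain.subtype

/-- The orthogonal projection onto the kernel of an operator. (The kernel of a closed operator, and
of each operator to which this is applied below, is closed, so that taking the closure changes
nothing; it is written only so that the projection is defined for every operator.) -/
def kerProj {E : Type*} [NormedAddCommGroup E] [InnerProductSpace ℂ E] [CompleteSpace E]
    (A : E →ₗ.[ℂ] E) : E →L[ℂ] E :=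
  (kernel A).topologicalClosure.starProjection

/-- The space `C` lies in the domain of `A` and is mapped into itself by `A`. -/
def RestrictsTo {E : Type*} [AddCommGroup E] [Module ℂ E] (A : E →ₗ.[ℂ] E)
    (C : Submodule ℂ E) : Prop :=
  ∃ hC : C ≤ A.domain, ∀ ψ (hψ : ψ ∈ C), A ⟨ψ, hC hψ⟩ ∈ C

/-- The spectral gap above the ground state energy `0` of a nonnegative operator `A` in `C`: the
infimum of `⟨ψ, A ψ⟩ / ‖ψ‖²` over the nonzero `ψ ∈ C ∩ dom A` orthogonal to `ker A`. It is `⊤` if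
there is no such `ψ`. -/
def spectralGap {E : Type*} [NormedAddCommGroup E] [InnerProductSpace ℂ E]
    (A : E →ₗ.[ℂ] E) (C : Submodule ℂ E) : EReal :=
  ⨅ ψ : {ψ : A.domain // (ψ : E) ∈ C ∧ (ψ : E) ∈ (kernel A)ᗮ ∧ (ψ : E) ≠ 0},
    (((⟪((ψ : A.domain) : E), A (ψ : A.domain)⟫_ℂ).re / ‖((ψ : A.domain) : E)‖ ^ 2 : ℝ) : EReal)

/-! ## Tilings -/

/-- Void, monomer, dimer; the left boundary tiles `(n00)`; the right boundary tiles `(1)`,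
`(020)` and `(0n)`. The boundary tiles `(n00)` and `(0n)` are used for `n ≥ 2` only. -/
inductive Tile : Type
  | void : Tile
  | mono : Tile
  | dimer : Tile
  | leftB : ℕ → Tile
  | monoR : Tile
  | dimerR : Tile
  | rightB : ℕ → Tile

/-- The occupation numbers of the sites covered by a tile. -/
def Tile.sites : Tile → List ℕ
  | .void => [0]
  | .mono => [1, 0]
  | .dimer => [0, 2, 0, 0]
  | .leftB n => [n, 0, 0]
  | .monoR => [1]
  | .dimerR => [0, 2, 0]
  | .rightB n => [0, n]

/-- The left boundary tiles `(n00)`, `n ≥ 2`. -/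
def leftTiles : Set Tile := {t | ∃ n, 2 ≤ n ∧ t = .leftB n}

/-- The right boundary tiles `(1)`, `(020)` and `(0n)`, `n ≥ 2`. -/
def rightTiles : Set Tile := {.monoR, .dimerR} ∪ {t | ∃ n, 2 ≤ n ∧ t = .rightB n}

/-- The bulk tiles. -/
def bulkTiles : Set Tile := {.void, .mono, .dimer}

/-- `T ∈ 𝒯_{[1,L]}`: an ordered covering of `L` sites by tiles in which only the first tile may be a
left boundary tile and only the last one a right boundary tile. -/
def IsTiling (L : ℕ) (T : List Tile) : Prop :=
  (T.flatMap Tile.sites).length = L ∧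
    ∀ i (hi : i < T.length), T[i] ∈ bulkTiles ∨ (i = 0 ∧ T[i] ∈ leftTiles) ∨
      (i + 1 = T.length ∧ T[i] ∈ rightTiles)

/-- The substitution rules `(0200) ↔ (10)(10)` and, at the right end, `(020) ↔ (10)(1)`. -/
inductive Replace : List Tile → List Tile → Prop
  | bulk (l r : List Tile) : Replace (l ++ [.dimer] ++ r) (l ++ [.mono, .mono] ++ r)
  | right (l : List Tile) : Replace (l ++ [.dimerR]) (l ++ [.mono, .monoR])

/-- `𝒯_{[1,L]}(R)`: the tilings connected to `R` by finitely many replacements. -/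
def tilingClass (L : ℕ) (R : List Tile) : Set (List Tile) :=
  {T | IsTiling L T ∧ Relation.EqvGen Replace R T}

/-- The configuration `σ_{[1,L]}(T)` of a tiling. -/
def tilingConfig (L : ℕ) (T : List Tile) : Config L :=
  fun y => (T.flatMap Tile.sites).getD ((y : ℕ) - 1) 0

/-- Root tilings: the tilings without the dimers `(0200)` and `(020)`. -/
def IsRoot (L : ℕ) (R : List Tile) : Prop :=
  IsTiling L R ∧ Tile.dimer ∉ R ∧ Tile.dimerR ∉ R

/-- `ℛ^∞_{[1,L]}`: the root tilings whose first tile is a void, a monomer or `(200)` and whose last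
tile is a void, a monomer, `(1)` or `(02)`. -/
def bulkRoots (L : ℕ) : Set (List Tile) :=
  {R | IsRoot L R ∧
    (∀ t ∈ R.head?, t = .void ∨ t = .mono ∨ t = .leftB 2) ∧
    (∀ t ∈ R.getLast?, t = .void ∨ t = .mono ∨ t = .monoR ∨ t = .rightB 2)}

/-- `𝒞_{[1,L]}(R)`, the span of the configuration states of the tilings connected to `R`. -/
def tilingSpace (L : ℕ) (R : List Tile) : Submodule ℂ (Fock L) :=
  Submodule.span ℂ ((fun T => ket (tilingConfig L T)) '' tilingClass L R)

/-- The bulk tiling space `𝒞^∞_{[1,L]}`, the sum of the spaces `𝒞_{[1,L]}(R)`, `R ∈ ℛ^∞`. -/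
def bulkSpace (L : ℕ) : Submodule ℂ (Fock L) :=
  ⨆ R ∈ bulkRoots L, tilingSpace L R

/-- `d(T)`: the number of dimers `(0200)` and `(020)` in a tiling. -/
def dimerCount (T : List Tile) : ℕ :=
  T.countP fun t => match t with
    | .dimer => true
    | .dimerR => true
    | _ => false

/-- The state `ψ_{[1,L]}(R) = ∑_{T ∈ 𝒯(R)} (λ/√2)^{d(T)} |σ(T)⟩` (a sum over a finite set). -/
def tilingState (lam : ℂ) (L : ℕ) (R : List Tile) : Fock L :=
  ∑ᶠ T ∈ tilingClass L R, (lam / (√2 : ℝ)) ^ dimerCount T • ket (tilingConfig L T)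

/-- The squeezed Tao-Thouless state `φ_n` on `[1, 2n]`, whose root tiling consists of `n`
monomers. -/
def taoThouless (lam : ℂ) (n : ℕ) : Fock (2 * n) :=
  tilingState lam (2 * n) (List.replicate n .mono)

/-- `β_n = ‖φ_{n-1}‖² / ‖φ_n‖²`, for `n ≥ 1`. -/
def beta (lam : ℂ) (n : ℕ) : ℝ :=
  ‖taoThouless lam (n - 1)‖ ^ 2 / ‖taoThouless lam n‖ ^ 2

/-- `f_n(r)` at `r = |λ|²/2`, for `n ≥ 4`. -/
def overlapTerm (lam : ℂ) (n : ℕ) : ℝ :=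
  let r : ℝ := ‖lam‖ ^ 2 / 2
  r * beta lam n * beta lam (n - 2) *
    ((1 - beta lam (n - 1) * (1 + r)) ^ 2 / (1 + 2 * r)
      + r * beta lam (n - 3) * (1 - beta lam (n - 1)) ^ 2 / (1 + r))

/-! ## The sequences of the martingale method, for `L = 2N + k` with `k ∈ {1, 2}` -/

/-- `h_n = H_{Λ_n}`, with `Λ_2 = [1, 4+k]` and `Λ_n = [2n+k-5, 2n+k]` for `n ≥ 3`. -/
def hSeq (L : ℕ) (κ : ℝ) (lam : ℂ) (k n : ℕ) : Fock L →ₗ.[ℂ] Fock L :=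
  if n = 2 then ham L κ lam 1 (4 + k) else ham L κ lam (2 * n + k - 5) (2 * n + k)

/-- `H_n = ∑_{m=2}^n h_m`. -/
def HSeq (L : ℕ) (κ : ℝ) (lam : ℂ) (k n : ℕ) : Fock L →ₗ.[ℂ] Fock L :=
  ∑ m ∈ Finset.Icc 2 n, hSeq L κ lam k m

/-- `g_n`, the orthogonal projection onto `ker h_n`. -/
def gProj (L : ℕ) (κ : ℝ) (lam : ℂ) (k n : ℕ) : Fock L →L[ℂ] Fock L :=
  kerProj (hSeq L κ lam k n)

/-- `G_n`, the orthogonal projection onto `ker H_n`. -/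
def GProj (L : ℕ) (κ : ℝ) (lam : ℂ) (k n : ℕ) : Fock L →L[ℂ] Fock L :=
  kerProj (HSeq L κ lam k n)

/-- `E_1 = 1 - G_2`, `E_n = G_n - G_{n+1}` for `2 ≤ n ≤ N - 1`, and `E_N = G_N`. -/
def EProj (L : ℕ) (κ : ℝ) (lam : ℂ) (k N n : ℕ) : Fock L →L[ℂ] Fock L :=
  if n = 1 then 1 - GProj L κ lam k 2
  else if n = N then GProj L κ lam k N
  else GProj L κ lam k n - GProj L κ lam k (n + 1)

end TruncatedHaldane

end

open TruncatedHaldane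

/-!
The bulk tiling space is spanned by the finitely many *separated* configurations, those in which two
occupied sites are at least as far apart as the number of particles on them (`bulkSpace_eq`). On such
configurations the electrostatic energy vanishes, and `q_x^* q_x` only mixes a dimer at `x` with the
two monomers around `x` that can replace it. Hence every Hamiltonian restricts to a sum of positive
bond operators `κ q_x^* q_x` on a finite-dimensional space (`implements_ham`), its
kernel projection restricts to the projection onto the kernel of the restriction
(`Implements.kerProj_eq`), and a vector is a ground state if at each bond the amplitude of a dimer is
`λ / √2` times the amplitude of the two monomers (`bondMap_eq_zero_iff`).

The first criterion holds since a window `Λ_n` contains at most four bonds: a configuration with a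
dimer at one of them allows no other move, which gives `h_n ^ 2 ≥ 2 κ h_n` (`sq_ge_window`,
`bondSum_gap`). The second one holds since kernels of Hamiltonians on nested windows are nested, and
bonds at distance at least three commute (`windowProj_initialProj`).

For the third criterion the replacements of monomer pairs by dimers are read as a monomer-dimer
system: a separated configuration is a root together with a set of bonds, no two of which share a
monomer (`sum_separated`). A vector in the range of `E_n` is a ground state of all bonds of `H_n` and
orthogonal to the ground states of `H_{n+1}`. For fixed root and fixed dimers to the right of the
bonds of `H_{n+1}`, this determines it on the last chain of monomers up to one constant, while a
ground state of `h_{n+1}` is determined by its values on the configurations without a dimer at the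
last bonds. Cauchy-Schwarz on the groups of configurations which these bonds connect then gives the
factor `f_s(|λ|²/2)`, where `s` is the length of the chain (`chain_estimate`). The numbers `β_n` enter
as ratios of monomer-dimer partition functions, both here (`partFun_ratio`) and in the norms of the
states `φ_n` (`beta_eq`). Projections are handled through the variational expression
`2 Re ⟨χ, ψ⟩ - ‖χ‖²`, so that no basis of the kernel of `h_{n+1}` is needed (`overlap_estimate`).

The recursion `β_{n+1} = 1 / (1 + r β_n)` reduces `f_n(r)` to a function of `β_{n-1}` alone
(`overlapRatio_eq`); maximizing it over `β_{n-1}` bounds `f` by a function of `r` which is below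
`1 / 3` for `r ≤ 7.4² / 2` (`overlapSup_lt`). The gap bound is the martingale method
(`martingale_estimate`), where each bond lies in at most three of the windows (`gap_estimate`).
-/

open scoped InnerProductSpace

noncomputable section

namespace TruncatedHaldane

/-! ### The ratios of monomer-dimer partition functions and the overlap function -/

/-- The ratios `N_{n-1} / N_n` of the monomer-dimer partition functions
`N_{n+2} = N_{n+1} + r N_n`, `N_0 = N_1 = 1`, given by the recursion they satisfy. -/
def ratio (r : ℝ) : ℕ → ℝ
  | 0 => 1
  | 1 => 1
  | n + 2 => 1 / (1 + r * ratio r (n + 1))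

theorem ratio_pos {r : ℝ} (hr : 0 ≤ r) : ∀ n, 0 < ratio r n
  | 0 => one_pos
  | 1 => one_pos
  | n + 2 => by
    have := ratio_pos hr (n + 1)
    rw [ratio]
    positivity

theorem ratio_succ {r : ℝ} {n : ℕ} (hn : 1 ≤ n) :
    ratio r (n + 1) = 1 / (1 + r * ratio r n) := by
  obtain ⟨m, rfl⟩ := Nat.exists_eq_add_of_le' hn
  rfl

/-- The expression `f_n(r)`, in terms of `ratio`. -/
def overlapRatio (r : ℝ) (n : ℕ) : ℝ :=
  r * ratio r n * ratio r (n - 2) *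
    ((1 - ratio r (n - 1) * (1 + r)) ^ 2 / (1 + 2 * r)
      + r * ratio r (n - 3) * (1 - ratio r (n - 1)) ^ 2 / (1 + r))

theorem overlapRatio_nonneg {r : ℝ} (hr : 0 ≤ r) (n : ℕ) : 0 ≤ overlapRatio r n := by
  have h1 := ratio_pos hr n
  have h2 := ratio_pos hr (n - 2)
  have h3 := ratio_pos hr (n - 3)
  unfold overlapRatio
  positivity

/-- With `b = β_{n-1}` and `t = (1 + r) b - 1 ≥ 0` the recursion for the ratios turns `f_n(r)` into
`r t (r - t) / ((1 + r) (1 + 2 r) (1 + t))`. -/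
theorem overlapRatio_eq {r : ℝ} (hr : 0 ≤ r) (n : ℕ) :
    overlapRatio r (n + 4) =
      r * ((1 + r) * ratio r (n + 3) - 1) * (r - ((1 + r) * ratio r (n + 3) - 1)) /
        ((1 + r) * (1 + 2 * r) * ((1 + r) * ratio r (n + 3))) := by
  have e4 := ratio_succ (r := r) (n := n + 3) (by omega)
  have e3 := ratio_succ (r := r) (n := n + 2) (by omega)
  have e2 := ratio_succ (r := r) (n := n + 1) (by omega)
  have p := ratio_pos hr (n + 1)
  simp only [overlapRatio, show n + 4 - 2 = n + 2 by omega, show n + 4 - 1 = n + 3 by omega,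
    show n + 4 - 3 = n + 1 by omega]
  rw [show n + 4 = n + 3 + 1 from rfl, e4, show n + 3 = n + 2 + 1 from rfl, e3,
    show n + 2 = n + 1 + 1 from rfl, e2]
  generalize ratio r (n + 1) = a at *
  field_simp
  ring

/-- Maximizing `f_n(r)` over `t` bounds it by `r (√(1 + r) - 1)² / ((1 + r) (1 + 2 r))`. -/
theorem overlapRatio_le {r : ℝ} (hr : 0 ≤ r) (n : ℕ) :
    overlapRatio r (n + 4) ≤ r * (√(1 + r) - 1) ^ 2 / ((1 + r) * (1 + 2 * r)) := by
  rw [overlapRatio_eq hr]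
  have hb := ratio_pos hr (n + 3)
  set s := (1 + r) * ratio r (n + 3) with hs
  have hs0 : 0 < s := by positivity
  have hq : √(1 + r) ^ 2 = 1 + r := Real.sq_sqrt (by positivity)
  rw [div_le_div_iff₀ (by positivity) (by positivity)]
  have key : (s - 1) * (r - (s - 1)) ≤ (√(1 + r) - 1) ^ 2 * s := by
    nlinarith [sq_nonneg (s - √(1 + r))]
  have h2 : 0 ≤ r * ((1 + r) * (1 + 2 * r)) := by positivity
  nlinarith [mul_le_mul_of_nonneg_left key h2]

theorem overlapRatio_le_one {r : ℝ} (hr : 0 ≤ r) (n : ℕ) : overlapRatio r (n + 4) ≤ 1 := by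
  refine (overlapRatio_le hr n).trans ?_
  rw [div_le_one (by positivity)]
  have hq : √(1 + r) ^ 2 = 1 + r := Real.sq_sqrt (by positivity)
  have h1 : 1 ≤ √(1 + r) := Real.one_le_sqrt.2 (by linarith)
  nlinarith

theorem overlapRatio_le_of_le {r : ℝ} (hr : 0 ≤ r) (hr' : r ≤ 27.38) (n : ℕ) :
    overlapRatio r (n + 4) ≤ 0.33 := by
  refine (overlapRatio_le hr n).trans ?_
  rw [div_le_iff₀ (by positivity)]
  have hq : √(1 + r) ^ 2 = 1 + r := Real.sq_sqrt (by positivity)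
  have h1 : 1 ≤ √(1 + r) := Real.one_le_sqrt.2 (by linarith)
  have h2 : √(1 + r) ≤ 5.33 := Real.sqrt_le_iff.2 ⟨by norm_num, by norm_num at hr' ⊢; linarith⟩
  generalize √(1 + r) = q at *
  obtain rfl : r = q ^ 2 - 1 := by linarith
  -- the difference of the two sides is `-(0.34 q⁴ - 2 q³ + 0.33 q² + 2 q - 1)`
  have h3 : 0 ≤ (q - 1) * (5.33 - q) := mul_nonneg (by linarith) (by linarith)
  have h4 : 0 ≤ (q - 1) * (5.33 - q) * q := mul_nonneg h3 (by linarith)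
  have h5 : 0 ≤ (q - 1) * (5.33 - q) * q ^ 2 := mul_nonneg h3 (by positivity)
  norm_num at *
  nlinarith

/-- The function `f(r) = sup_{n ≥ 4} f_n(r)`. -/
def overlapSup (r : ℝ) : ℝ := ⨆ n : ℕ, overlapRatio r (n + 4)

theorem bddAbove_overlapRatio {r : ℝ} (hr : 0 ≤ r) :
    BddAbove (Set.range fun n : ℕ => overlapRatio r (n + 4)) :=
  ⟨1, by rintro _ ⟨n, rfl⟩; exact overlapRatio_le_one hr n⟩

theorem overlapRatio_le_overlapSup {r : ℝ} (hr : 0 ≤ r) {n : ℕ} (hn : 4 ≤ n) :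
    overlapRatio r n ≤ overlapSup r := by
  obtain ⟨m, rfl⟩ := Nat.exists_eq_add_of_le' hn
  exact le_ciSup (bddAbove_overlapRatio hr) m

theorem overlapSup_nonneg {r : ℝ} (hr : 0 ≤ r) : 0 ≤ overlapSup r :=
  (overlapRatio_nonneg hr 4).trans (overlapRatio_le_overlapSup hr le_rfl)

theorem overlapSup_lt {r : ℝ} (hr : 0 ≤ r) (hr' : r ≤ 27.38) : overlapSup r < 1 / 3 :=
  (ciSup_le fun n => overlapRatio_le_of_le hr hr' n).trans_lt (by norm_num)

/-! ### Independent bond sets and their partition function -/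

/-- The sets of bonds `D ⊆ A` that can be occupied by dimers simultaneously. A bond is labelled by
its centre, and bonds with centres `x`, `x + 2` share a monomer. -/
def indep (A : Finset ℕ) : Finset (Finset ℕ) := A.powerset.filter fun D => ∀ x ∈ D, x + 2 ∉ D

/-- The part of `A` below `y`. -/
def lo (A : Finset ℕ) (y : ℕ) : Finset ℕ := A.filter (· < y)

/-- The monomer-dimer partition function at dimer weight `r`. -/
def partFun (r : ℝ) (A : Finset ℕ) : ℝ := ∑ D ∈ indep A, r ^ D.card

theorem mem_indep {A D : Finset ℕ} : D ∈ indep A ↔ D ⊆ A ∧ ∀ x ∈ D, x + 2 ∉ D := by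
  simp [indep]

theorem mem_lo {A : Finset ℕ} {x y : ℕ} : x ∈ lo A y ↔ x ∈ A ∧ x < y := by
  simp [lo]

theorem partFun_pos {r : ℝ} (hr : 0 ≤ r) (A : Finset ℕ) : 0 < partFun r A := by
  have h : (∅ : Finset ℕ) ∈ indep A := by simp [mem_indep]
  refine lt_of_lt_of_le one_pos ?_
  have := Finset.single_le_sum (f := fun D : Finset ℕ => r ^ D.card) (fun D _ => by positivity) h
  simpa [partFun] using this

theorem indep_mono {A B : Finset ℕ} (h : A ⊆ B) : indep A ⊆ indep B := fun D hD => by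
  rw [mem_indep] at *
  exact ⟨hD.1.trans h, hD.2⟩

theorem lo_pred {A : Finset ℕ} (hA : ∀ x ∈ A, x + 1 ∉ A) {y : ℕ} (hy : y ∈ A) :
    lo A y = lo A (y - 1) := by
  ext x
  simp only [mem_lo, and_congr_right_iff]
  intro hx
  have : x + 1 ≠ y := fun h => hA x hx (h ▸ hy)
  omega

theorem notMem_of_mem_indep_lo {A D : Finset ℕ} {y z : ℕ} (hD : D ∈ indep (lo A y)) (hz : y ≤ z) :
    z ∉ D := fun h => by
  have := mem_lo.1 ((mem_indep.1 hD).1 h)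
  omega

/-- Splitting the independent sets according to whether they contain the topmost bond. -/
theorem sum_indep_top {M : Type*} [AddCommMonoid M] {A : Finset ℕ} (hA : ∀ x ∈ A, x + 1 ∉ A)
    {y : ℕ} (hy : y ∈ A) (F : Finset ℕ → M) :
    ∑ D ∈ indep (lo A (y + 1)), F D
      = ∑ D ∈ indep (lo A (y - 1)), F D + ∑ D ∈ indep (lo A (y - 2)), F (insert y D) := by
  classical
  have h1 : (indep (lo A (y + 1))).filter (y ∉ ·) = indep (lo A (y - 1)) := by
    rw [← lo_pred hA hy]
    ext D
    simp only [Finset.mem_filter, mem_indep, Finset.subset_iff, mem_lo]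
    constructor
    · rintro ⟨⟨h1, h2⟩, h3⟩
      refine ⟨fun x hx => ⟨(h1 hx).1, ?_⟩, h2⟩
      have := (h1 hx).2
      have : x ≠ y := fun h => h3 (h ▸ hx)
      omega
    · rintro ⟨h1, h2⟩
      refine ⟨⟨fun x hx => ⟨(h1 hx).1, by have := (h1 hx).2; omega⟩, h2⟩, fun h => ?_⟩
      have := (h1 h).2
      omega
  rw [← Finset.sum_filter_add_sum_filter_not _ (y ∉ ·), h1]
  congr 1
  refine Finset.sum_bij' (fun D _ => D.erase y) (fun D _ => insert y D) ?_ ?_ ?_ ?_ ?_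
  · intro D hD
    simp only [Finset.mem_filter, mem_indep, Finset.subset_iff, mem_lo, not_not] at hD
    obtain ⟨⟨h1, h2⟩, h3⟩ := hD
    simp only [mem_indep, Finset.subset_iff, mem_lo, Finset.mem_erase]
    refine ⟨fun x hx => ⟨(h1 hx.2).1, ?_⟩, fun x hx h => h2 x hx.2 h.2⟩
    have ha := (h1 hx.2)
    have hb : x + 1 ≠ y := fun h => hA x ha.1 (h ▸ hy)
    have hc : x + 2 ≠ y := fun h => h2 x hx.2 (h ▸ h3)
    omega
  · intro D hD
    simp only [mem_indep, Finset.subset_iff, mem_lo] at hD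
    simp only [Finset.mem_filter, mem_indep, Finset.subset_iff, mem_lo, not_not, Finset.mem_insert]
    refine ⟨⟨?_, ?_⟩, Or.inl trivial⟩
    · rintro x (rfl | hx)
      · exact ⟨hy, by omega⟩
      · exact ⟨(hD.1 hx).1, by have := (hD.1 hx).2; omega⟩
    · rintro x (rfl | hx) (h | h)
      · omega
      · have := (hD.1 h).2; omega
      · have := (hD.1 hx).2; omega
      · exact hD.2 x hx h
  · intro D hD
    simp only [Finset.mem_filter, not_not] at hD
    exact Finset.insert_erase hD.2
  · intro D hD
    exact Finset.erase_insert (notMem_of_mem_indep_lo hD (by omega))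
  · intro D hD
    simp only [Finset.mem_filter, not_not] at hD
    rw [Finset.insert_erase hD.2]

theorem partFun_top {r : ℝ} {A : Finset ℕ} (hA : ∀ x ∈ A, x + 1 ∉ A) {y : ℕ} (hy : y ∈ A) :
    partFun r (lo A (y + 1)) = partFun r (lo A (y - 1)) + r * partFun r (lo A (y - 2)) := by
  rw [partFun, sum_indep_top hA hy, partFun, partFun, Finset.mul_sum]
  congr 1
  refine Finset.sum_congr rfl fun D hD => ?_
  rw [Finset.card_insert_of_notMem (notMem_of_mem_indep_lo hD (by omega)), pow_succ, mul_comm]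

/-- The number of monomers in the chain of adjacent bonds of `A` that ends with the bond `y`. -/
def chainLength (A : Finset ℕ) (y : ℕ) : ℕ :=
  if _h : y ∈ A ∧ 2 ≤ y then chainLength A (y - 2) + 1 else 1
termination_by y
decreasing_by omega

theorem one_le_chainLength (A : Finset ℕ) (y : ℕ) : 1 ≤ chainLength A y := by
  rw [chainLength]
  split_ifs <;> omega

theorem chainLength_of_mem {A : Finset ℕ} {y : ℕ} (hy : y ∈ A) (h2 : 2 ≤ y) :
    chainLength A y = chainLength A (y - 2) + 1 := by
  rw [chainLength, dif_pos ⟨hy, h2⟩]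

theorem chainLength_of_notMem {A : Finset ℕ} {y : ℕ} (hy : y ∉ A) : chainLength A y = 1 := by
  rw [chainLength, dif_neg (fun h => hy h.1)]

/-- Removing the last monomer of a chain changes the partition function by a factor that depends
only on the length of the chain. -/
theorem partFun_ratio {r : ℝ} (hr : 0 ≤ r) {A : Finset ℕ} (hA : ∀ x ∈ A, x + 1 ∉ A)
    (hA2 : ∀ x ∈ A, 2 ≤ x) {y : ℕ} (hy : y ∈ A) :
    partFun r (lo A (y - 1)) = ratio r (chainLength A y) * partFun r (lo A (y + 1)) := by
  induction y using Nat.strong_induction_on with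
  | _ y ih =>
    have h2 := hA2 y hy
    rw [partFun_top hA hy, chainLength_of_mem hy h2, ratio_succ (one_le_chainLength _ _)]
    have hz := partFun_pos hr (lo A (y - 1))
    have hb := ratio_pos hr (chainLength A (y - 2))
    have key : partFun r (lo A (y - 2)) =
        ratio r (chainLength A (y - 2)) * partFun r (lo A (y - 1)) := by
      by_cases h : y - 2 ∈ A
      · have h4 := hA2 _ h
        rw [lo_pred hA h, ih (y - 2) (by omega) h, show y - 2 + 1 = y - 1 by omega]
      · rw [chainLength_of_notMem h, ratio, one_mul]
        congr 1
        ext x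
        simp only [mem_lo, and_congr_right_iff]
        intro hx
        have : x ≠ y - 2 := fun e => h (e ▸ hx)
        omega
    rw [key]
    field_simp

theorem union_mem_indep {A D v : Finset ℕ} {t : ℕ}
    (hD : D ∈ indep (A.filter fun a => a ≤ t ∧ a + 2 ∉ v)) (hv : v ∈ indep (A.filter (t < ·))) :
    D ∪ v ∈ indep A := by
  simp only [mem_indep, Finset.subset_iff, Finset.mem_filter] at hD hv
  simp only [mem_indep, Finset.subset_iff, Finset.mem_union]
  refine ⟨fun x hx => hx.elim (fun h => (hD.1 h).1) (fun h => (hv.1 h).1), ?_⟩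
  rintro x (hx | hx) (h | h)
  · exact hD.2 x hx h
  · exact (hD.1 hx).2.2 h
  · have := (hv.1 hx).2
    have := (hD.1 h).2.1
    omega
  · exact hv.2 x hx h

theorem filter_union_of_mem_indep {A D v : Finset ℕ} {t : ℕ}
    (hD : D ∈ indep (A.filter fun a => a ≤ t ∧ a + 2 ∉ v)) (hv : v ∈ indep (A.filter (t < ·))) :
    (D ∪ v).filter (t < ·) = v ∧ (D ∪ v).filter (· ≤ t) = D := by
  simp only [mem_indep, Finset.subset_iff, Finset.mem_filter] at hD hv
  constructor
  · ext x
    simp only [Finset.mem_union, Finset.mem_filter]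
    refine ⟨fun ⟨h, h'⟩ => h.resolve_left fun hx => ?_, fun h => ⟨Or.inr h, (hv.1 h).2⟩⟩
    have := (hD.1 hx).2.1
    omega
  · ext x
    simp only [Finset.mem_union, Finset.mem_filter]
    refine ⟨fun ⟨h, h'⟩ => h.resolve_right fun hx => ?_, fun h => ⟨Or.inl h, (hD.1 h).2.1⟩⟩
    have := (hv.1 hx).2
    omega

/-- Splitting the independent sets into their parts above and below a threshold `t`. -/
theorem sum_indep_split {M : Type*} [AddCommMonoid M] (A : Finset ℕ) (t : ℕ)
    (F : Finset ℕ → M) :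
    ∑ D ∈ indep A, F D = ∑ v ∈ indep (A.filter (t < ·)),
      ∑ D ∈ indep (A.filter fun a => a ≤ t ∧ a + 2 ∉ v), F (D ∪ v) := by
  classical
  rw [Finset.sum_sigma']
  refine Finset.sum_bij' (fun D _ => ⟨D.filter (t < ·), D.filter (· ≤ t)⟩)
    (fun p _ => p.2 ∪ p.1) ?_ ?_ ?_ ?_ ?_
  · intro D hD
    rw [mem_indep] at hD
    simp only [Finset.mem_sigma, mem_indep, Finset.subset_iff, Finset.mem_filter]
    refine ⟨⟨fun x hx => ⟨hD.1 hx.1, hx.2⟩, fun x hx h => hD.2 x hx.1 h.1⟩,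
      fun x hx => ⟨hD.1 hx.1, hx.2, fun h => hD.2 x hx.1 h.1⟩, fun x hx h => hD.2 x hx.1 h.1⟩
  · rintro ⟨v, D⟩ hp
    rw [Finset.mem_sigma] at hp
    exact union_mem_indep hp.2 hp.1
  · intro D hD
    ext x
    simp only [Finset.mem_union, Finset.mem_filter]
    have := le_or_gt x t
    tauto
  · rintro ⟨v, D⟩ hp
    rw [Finset.mem_sigma] at hp
    obtain ⟨e1, e2⟩ := filter_union_of_mem_indep hp.2 hp.1
    simp only [e1, e2]
  · intro D hD
    congr 1
    ext x
    simp only [Finset.mem_union, Finset.mem_filter]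
    have := le_or_gt x t
    tauto

theorem insert_mem_indep {A D : Finset ℕ} {y : ℕ} (hy : y ∈ A)
    (hD : D ∈ indep (lo A (y - 2))) : insert y D ∈ indep (lo A (y + 1)) := by
  simp only [mem_indep, Finset.subset_iff, mem_lo] at hD
  simp only [mem_indep, Finset.subset_iff, mem_lo, Finset.mem_insert]
  refine ⟨?_, ?_⟩
  · rintro x (rfl | hx)
    · exact ⟨hy, by omega⟩
    · exact ⟨(hD.1 hx).1, by have := (hD.1 hx).2; omega⟩
  · rintro x (rfl | hx) (h | h)
    · omega
    · have := (hD.1 h).2; omega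
    · have := (hD.1 hx).2; omega
    · exact hD.2 x hx h

theorem lo_mono (A : Finset ℕ) {y z : ℕ} (h : y ≤ z) : lo A y ⊆ lo A z := fun x hx => by
  rw [mem_lo] at *
  exact ⟨hx.1, by omega⟩

/-! ### The overlap estimate for chains of monomers -/

/-- The integrand of the variational expression `2 Re ⟨χ, u⟩ - ‖χ‖²`, whose maximum over `χ` in a
subspace is the squared norm of the projection of `u` onto the subspace. -/
def projTerm (w z : ℂ) : ℝ := 2 * (starRingEnd ℂ w * z).re - ‖w‖ ^ 2

theorem two_re_sub_le {k : ℝ} (hk : 0 < k) (w z : ℂ) :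
    2 * (starRingEnd ℂ w * z).re - k * ‖w‖ ^ 2 ≤ ‖z‖ ^ 2 / k := by
  rw [le_div_iff₀ hk]
  have h1 : ‖z - k * w‖ ^ 2 = ‖z‖ ^ 2 - 2 * k * (starRingEnd ℂ w * z).re + k ^ 2 * ‖w‖ ^ 2 := by
    simp only [← Complex.normSq_eq_norm_sq, Complex.normSq_apply, Complex.sub_re, Complex.sub_im,
      Complex.mul_re, Complex.mul_im, Complex.ofReal_re, Complex.ofReal_im, Complex.conj_re,
      Complex.conj_im]
    ring
  nlinarith [sq_nonneg ‖z - k * w‖]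

theorem projTerm_le_zero (w : ℂ) : projTerm w 0 ≤ 0 := by
  simp [projTerm]

theorem projTerm_add_le (c w a b : ℂ) :
    projTerm w a + projTerm (c * w) b
      ≤ ‖a + starRingEnd ℂ c * b‖ ^ 2 / (1 + ‖c‖ ^ 2) := by
  refine le_trans (le_of_eq ?_) (two_re_sub_le (by positivity) w _)
  simp only [projTerm, norm_mul, mul_pow, map_mul, mul_add, Complex.add_re]
  rw [show starRingEnd ℂ c * starRingEnd ℂ w * b = starRingEnd ℂ w * (starRingEnd ℂ c * b) by ring]
  ring

theorem projTerm_add_add_le (c w a b d : ℂ) :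
    projTerm w a + projTerm (c * w) b + projTerm (c * w) d
      ≤ ‖a + starRingEnd ℂ c * b + starRingEnd ℂ c * d‖ ^ 2 / (1 + 2 * ‖c‖ ^ 2) := by
  refine le_trans (le_of_eq ?_) (two_re_sub_le (by positivity) w _)
  simp only [projTerm, norm_mul, mul_pow, map_mul, mul_add, Complex.add_re]
  rw [show starRingEnd ℂ c * starRingEnd ℂ w * b = starRingEnd ℂ w * (starRingEnd ℂ c * b) by ring,
    show starRingEnd ℂ c * starRingEnd ℂ w * d = starRingEnd ℂ w * (starRingEnd ℂ c * d) by ring]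
  ring

theorem conj_pow_mul_pow (c : ℂ) (n : ℕ) :
    starRingEnd ℂ c ^ n * c ^ n = (((‖c‖ ^ 2) ^ n : ℝ) : ℂ) := by
  rw [← mul_pow, ← Complex.normSq_eq_conj_mul_self, Complex.normSq_eq_norm_sq]
  push_cast
  rfl

/-- The estimate on a single chain of monomers whose last bond is `y`. The function `u` is a ground
state of all bonds below `y` and is orthogonal to the ground state of the whole chain, and `χ` is a
ground state of the last two bonds `y - 2` and `y`. -/
theorem chain_estimate {A : Finset ℕ} (hA : ∀ x ∈ A, x + 1 ∉ A) (hA2 : ∀ x ∈ A, 2 ≤ x)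
    {y : ℕ} (hy : y ∈ A) {c a b : ℂ} {F : ℝ} (hF0 : 0 ≤ F)
    (hF : ∀ n, 4 ≤ n → overlapRatio (‖c‖ ^ 2) n ≤ F) {u χ : Finset ℕ → ℂ}
    (ha : ∀ D ∈ indep (lo A (y - 1)), u D = c ^ D.card * a)
    (hb : ∀ D ∈ indep (lo A (y - 2)), u (insert y D) = c ^ D.card * b)
    (h1 : ∀ D ∈ indep (lo A (y - 2)), χ (insert y D) = c * χ D)
    (h2 : y - 2 ∈ A → ∀ D ∈ indep (lo A (y - 4)), χ (insert (y - 2) D) = c * χ D)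
    (orth : ∑ D ∈ indep (lo A (y + 1)), starRingEnd ℂ c ^ D.card * u D = 0) :
    ∑ D ∈ indep (lo A (y + 1)), projTerm (χ D) (u D)
      ≤ F * ∑ D ∈ indep (lo A (y + 1)), ‖u D‖ ^ 2 := by
  have hr : 0 ≤ ‖c‖ ^ 2 := by positivity
  have hcc : starRingEnd ℂ c * c = ((‖c‖ ^ 2 : ℝ) : ℂ) := by simpa using conj_pow_mul_pow c 1
  have hrhs : 0 ≤ F * ∑ D ∈ indep (lo A (y + 1)), ‖u D‖ ^ 2 :=
    mul_nonneg hF0 (Finset.sum_nonneg fun D _ => by positivity)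
  set r := ‖c‖ ^ 2 with hrdef
  have hnorm : ∀ n : ℕ, ‖c ^ n‖ ^ 2 = r ^ n := fun n => by
    rw [norm_pow, ← pow_mul, mul_comm, pow_mul]
  -- the coefficients `a` and `b` are related by orthogonality
  have orth' : a * partFun r (lo A (y - 1)) + starRingEnd ℂ c * b * partFun r (lo A (y - 2)) = 0 := by
    rw [← orth, sum_indep_top hA hy, partFun, partFun]
    push_cast
    rw [Finset.mul_sum, Finset.mul_sum]
    congr 1
    · refine Finset.sum_congr rfl fun D hD => ?_
      rw [ha D hD, ← mul_assoc, conj_pow_mul_pow, ← hrdef]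
      push_cast
      ring
    · refine Finset.sum_congr rfl fun D hD => ?_
      have hpow := conj_pow_mul_pow c D.card
      rw [← hrdef] at hpow
      push_cast at hpow
      rw [hb D hD, Finset.card_insert_of_notMem (notMem_of_mem_indep_lo hD (by omega))]
      linear_combination (-(starRingEnd ℂ c * b)) * hpow
  have zpos : ∀ B : Finset ℕ, (partFun r B : ℂ) ≠ 0 := fun B => by
    exact_mod_cast (partFun_pos hr B).ne'
  have lo_eq : ∀ z, z ∉ A → lo A (z + 1) = lo A z := fun z hz => by
    ext x
    simp only [mem_lo, and_congr_right_iff]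
    intro hx
    have : x ≠ z := fun e => hz (e ▸ hx)
    omega
  have hy2 := hA2 y hy
  rw [sum_indep_top hA hy]
  -- A chain of two or three monomers has no bonds besides `y - 2` and `y`, so that on it `χ` is a
  -- multiple of the ground state, to which `u` is orthogonal. Only longer chains contribute.
  by_cases m2 : y - 2 ∈ A
  · have hy4 := hA2 _ m2
    have top2 : ∀ {M : Type} [AddCommMonoid M] (G : Finset ℕ → M),
        ∑ D ∈ indep (lo A (y - 1)), G D = ∑ D ∈ indep (lo A (y - 3)), G D
          + ∑ D ∈ indep (lo A (y - 4)), G (insert (y - 2) D) := fun G => by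
      have := sum_indep_top hA m2 G
      rwa [show y - 2 + 1 = y - 1 by omega, show y - 2 - 1 = y - 3 by omega,
        show y - 2 - 2 = y - 4 by omega] at this
    have e23 : lo A (y - 2) = lo A (y - 3) := by
      rw [lo_pred hA m2, show y - 2 - 1 = y - 3 by omega]
    have sub41 : indep (lo A (y - 4)) ⊆ indep (lo A (y - 1)) := indep_mono (lo_mono A (by omega))
    have sub42 : indep (lo A (y - 4)) ⊆ indep (lo A (y - 2)) := indep_mono (lo_mono A (by omega))
    -- the three states of the last two bonds
    have term3 : ∀ D ∈ indep (lo A (y - 4)),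
        projTerm (χ D) (u D) + projTerm (χ (insert y D)) (u (insert y D))
          + projTerm (χ (insert (y - 2) D)) (u (insert (y - 2) D))
        ≤ r ^ D.card * (‖a * (1 + r) + starRingEnd ℂ c * b‖ ^ 2 / (1 + 2 * r)) := fun D hD => by
      have hi : insert (y - 2) D ∈ indep (lo A (y - 1)) := by
        have := insert_mem_indep m2 (show D ∈ indep (lo A (y - 2 - 2)) by
          rwa [show y - 2 - 2 = y - 4 by omega])
        rwa [show y - 2 + 1 = y - 1 by omega] at this
      rw [h1 D (sub42 hD), h2 m2 D hD, ha D (sub41 hD), hb D (sub42 hD), ha _ hi,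
        Finset.card_insert_of_notMem (notMem_of_mem_indep_lo hD (by omega))]
      refine (projTerm_add_add_le c _ _ _ _).trans (le_of_eq ?_)
      rw [show c ^ D.card * a + starRingEnd ℂ c * (c ^ D.card * b)
          + starRingEnd ℂ c * (c ^ (D.card + 1) * a)
          = c ^ D.card * (a * (1 + r) + starRingEnd ℂ c * b) by
        linear_combination c ^ D.card * a * hcc, norm_mul, mul_pow, hnorm, mul_div_assoc]
    by_cases m4 : y - 4 ∈ A
    · have hy6 := hA2 _ m4
      have top4 : ∀ {M : Type} [AddCommMonoid M] (G : Finset ℕ → M),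
          ∑ D ∈ indep (lo A (y - 3)), G D = ∑ D ∈ indep (lo A (y - 4)), G D
            + ∑ D ∈ indep (lo A (y - 6)), G (insert (y - 4) D) := fun G => by
        have := sum_indep_top hA m4 G
        rwa [show y - 4 + 1 = y - 3 by omega, ← lo_pred hA m4,
          show y - 4 - 2 = y - 6 by omega] at this
      have term2 : ∀ D ∈ indep (lo A (y - 6)),
          projTerm (χ (insert (y - 4) D)) (u (insert (y - 4) D))
            + projTerm (χ (insert y (insert (y - 4) D))) (u (insert y (insert (y - 4) D)))
          ≤ r ^ D.card * (r * (‖a + starRingEnd ℂ c * b‖ ^ 2 / (1 + r))) := fun D hD => by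
        have hi : insert (y - 4) D ∈ indep (lo A (y - 3)) := by
          have := insert_mem_indep m4 (show D ∈ indep (lo A (y - 4 - 2)) by
            rwa [show y - 4 - 2 = y - 6 by omega])
          rwa [show y - 4 + 1 = y - 3 by omega] at this
        have hi2 : insert (y - 4) D ∈ indep (lo A (y - 2)) := e23 ▸ hi
        have hi1 := indep_mono (lo_mono A (show y - 3 ≤ y - 1 by omega)) hi
        rw [h1 _ hi2, ha _ hi1, hb _ hi2,
          Finset.card_insert_of_notMem (notMem_of_mem_indep_lo hD (by omega))]
        refine (projTerm_add_le c _ _ _).trans (le_of_eq ?_)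
        rw [show c ^ (D.card + 1) * a + starRingEnd ℂ c * (c ^ (D.card + 1) * b)
            = c ^ (D.card + 1) * (a + starRingEnd ℂ c * b) by ring, norm_mul, mul_pow, hnorm,
          mul_div_assoc, pow_succ, mul_assoc]
      -- the partition functions of the chain and of its shortenings
      have s1 := partFun_ratio hr hA hA2 hy
      have s2 := partFun_ratio hr hA hA2 m2
      have s3 := partFun_ratio hr hA hA2 m4
      rw [show y - 2 + 1 = y - 1 by omega, show y - 2 - 1 = y - 3 by omega] at s2
      rw [show y - 4 + 1 = y - 3 by omega, ← lo_pred hA m4] at s3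
      have e3 := partFun_top (r := r) hA m4
      rw [show y - 4 + 1 = y - 3 by omega, ← lo_pred hA m4, show y - 4 - 2 = y - 6 by omega] at e3
      have l1 := chainLength_of_mem hy hy2
      have l2 := chainLength_of_mem m2 hy4
      have l3 := chainLength_of_mem m4 hy6
      rw [show y - 2 - 2 = y - 4 by omega] at l2
      rw [show y - 4 - 2 = y - 6 by omega] at l3
      have l4 := one_le_chainLength A (y - 6)
      set s := chainLength A y with hs
      have f := hF s (by omega)
      rw [show chainLength A (y - 2) = s - 1 by omega] at s2
      rw [show chainLength A (y - 4) = s - 2 by omega] at s3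
      have b1 := ratio_succ (r := r) (show 1 ≤ s - 1 by omega)
      rw [show s - 1 + 1 = s by omega] at b1
      have b3 := ratio_succ (r := r) (show 1 ≤ s - 3 by omega)
      rw [show s - 3 + 1 = s - 2 by omega] at b3
      rw [e23] at orth'
      have p1 := ratio_pos hr (s - 1)
      have p2 := ratio_pos hr (s - 2)
      have p3 := ratio_pos hr (s - 3)
      have q1 := partFun_pos hr (lo A (y - 1))
      have q2 := partFun_pos hr (lo A (y - 3))
      have hab : a = -(starRingEnd ℂ c * b * ratio r (s - 1)) := by
        have hs2 : (partFun r (lo A (y - 3)) : ℂ) = ratio r (s - 1) * partFun r (lo A (y - 1)) := by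
          exact_mod_cast s2
        rw [hs2] at orth'
        refine mul_right_cancel₀ (zpos (lo A (y - 1))) ?_
        linear_combination orth'
      have nb : ‖starRingEnd ℂ c * b‖ ^ 2 = r * ‖b‖ ^ 2 := by
        rw [norm_mul, mul_pow, RCLike.norm_conj]
      have n3 : ‖a * (1 + r) + starRingEnd ℂ c * b‖ ^ 2
          = r * ‖b‖ ^ 2 * (1 - ratio r (s - 1) * (1 + r)) ^ 2 := by
        rw [hab, show -(starRingEnd ℂ c * b * (ratio r (s - 1) : ℂ)) * (1 + r) + starRingEnd ℂ c * b
          = starRingEnd ℂ c * b * ((1 - ratio r (s - 1) * (1 + r) : ℝ) : ℂ) by push_cast; ring,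
          norm_mul, mul_pow, nb, Complex.norm_real, Real.norm_eq_abs, sq_abs]
      have n2 : ‖a + starRingEnd ℂ c * b‖ ^ 2 = r * ‖b‖ ^ 2 * (1 - ratio r (s - 1)) ^ 2 := by
        rw [hab, show -(starRingEnd ℂ c * b * (ratio r (s - 1) : ℂ)) + starRingEnd ℂ c * b
          = starRingEnd ℂ c * b * ((1 - ratio r (s - 1) : ℝ) : ℂ) by push_cast; ring,
          norm_mul, mul_pow, nb, Complex.norm_real, Real.norm_eq_abs, sq_abs]
      have na : ‖a‖ ^ 2 = r * ‖b‖ ^ 2 * ratio r (s - 1) ^ 2 := by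
        rw [hab, norm_neg, norm_mul, mul_pow, nb, Complex.norm_real, Real.norm_eq_abs, sq_abs]
      have hnu : ∑ D ∈ indep (lo A (y + 1)), ‖u D‖ ^ 2
          = ‖a‖ ^ 2 * partFun r (lo A (y - 1)) + ‖b‖ ^ 2 * partFun r (lo A (y - 3)) := by
        rw [sum_indep_top hA hy, ← e23, partFun, partFun, Finset.mul_sum, Finset.mul_sum]
        congr 1
        · refine Finset.sum_congr rfl fun D hD => ?_
          rw [ha D hD, norm_mul, mul_pow, hnorm, mul_comm]
        · refine Finset.sum_congr rfl fun D hD => ?_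
          rw [hb D hD, norm_mul, mul_pow, hnorm, mul_comm]
      rw [hnu, e23, top2, top4, top4]
      have bound3 := Finset.sum_le_sum term3
      have bound2 := Finset.sum_le_sum term2
      rw [Finset.sum_add_distrib, Finset.sum_add_distrib, ← Finset.sum_mul] at bound3
      rw [Finset.sum_add_distrib, ← Finset.sum_mul] at bound2
      rw [← partFun] at bound2 bound3
      have hfin : partFun r (lo A (y - 4)) * (‖a * (1 + r) + starRingEnd ℂ c * b‖ ^ 2 / (1 + 2 * r))
          + partFun r (lo A (y - 6)) * (r * (‖a + starRingEnd ℂ c * b‖ ^ 2 / (1 + r)))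
          = overlapRatio r s *
            (‖a‖ ^ 2 * partFun r (lo A (y - 1)) + ‖b‖ ^ 2 * partFun r (lo A (y - 3))) := by
        rw [n3, n2, na, s3]
        have e3' : r * partFun r (lo A (y - 6)) = (1 - ratio r (s - 2)) * partFun r (lo A (y - 3)) := by
          linarith
        have hq1 : partFun r (lo A (y - 1)) = partFun r (lo A (y - 3)) / ratio r (s - 1) := by
          rw [s2]; field_simp
        have e4 : 1 - ratio r (s - 2) = r * ratio r (s - 3) * ratio r (s - 2) := by
          rw [b3]; field_simp; ring
        rw [hq1, overlapRatio, b1]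
        rw [e4] at e3'
        rw [show partFun r (lo A (y - 6)) * (r * (r * ‖b‖ ^ 2 * (1 - ratio r (s - 1)) ^ 2 / (1 + r)))
          = (r * partFun r (lo A (y - 6))) * (r * ‖b‖ ^ 2 * (1 - ratio r (s - 1)) ^ 2 / (1 + r)) by
            ring, e3']
        field_simp
        ring
      have hfin2 := mul_le_mul_of_nonneg_right f (show 0 ≤ ‖a‖ ^ 2 * partFun r (lo A (y - 1))
        + ‖b‖ ^ 2 * partFun r (lo A (y - 3)) by positivity)
      linarith
    · have e34 : lo A (y - 3) = lo A (y - 4) := by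
        rw [← lo_eq _ m4, show y - 4 + 1 = y - 3 by omega]
      have e1 := partFun_top (r := r) hA m2
      rw [show y - 2 + 1 = y - 1 by omega, show y - 2 - 1 = y - 3 by omega,
        show y - 2 - 2 = y - 4 by omega, e34] at e1
      have hab : a * (1 + r) + starRingEnd ℂ c * b = 0 := by
        rw [e23, e34, e1] at orth'
        refine mul_right_cancel₀ (zpos (lo A (y - 4))) ?_
        push_cast at orth'
        linear_combination orth'
      refine le_trans ?_ hrhs
      rw [e23, top2, e34, ← Finset.sum_add_distrib, ← Finset.sum_add_distrib]
      refine Finset.sum_nonpos fun D hD => ?_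
      have := term3 D hD
      rw [hab] at this
      simp only [norm_zero, ne_eq, OfNat.ofNat_ne_zero, not_false_eq_true, zero_pow, zero_div,
        mul_zero] at this
      linarith
  · have e12 : lo A (y - 1) = lo A (y - 2) := by
      rw [← lo_eq _ m2, show y - 2 + 1 = y - 1 by omega]
    have hab : a + starRingEnd ℂ c * b = 0 := by
      rw [e12] at orth'
      refine mul_right_cancel₀ (zpos (lo A (y - 2))) ?_
      linear_combination orth'
    refine le_trans ?_ hrhs
    rw [e12, ← Finset.sum_add_distrib]
    refine Finset.sum_nonpos fun D hD => ?_
    rw [h1 D hD, ha D (e12 ▸ hD), hb D hD]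
    refine (projTerm_add_le c _ _ _).trans (le_of_eq ?_)
    rw [show c ^ D.card * a + starRingEnd ℂ c * (c ^ D.card * b)
      = c ^ D.card * (a + starRingEnd ℂ c * b) by ring, hab]
    simp

/-- Removing dimers one by one from a ground state. -/
theorem apply_union_of_insert {A : Finset ℕ} {c : ℂ} {u : Finset ℕ → ℂ} {s : ℕ}
    (hu : ∀ x ∈ A, x < s → ∀ D, x ∉ D → insert x D ∈ indep A → u (insert x D) = c * u D)
    {D w : Finset ℕ} (hD : D ⊆ lo A s) (hd : Disjoint D w) (h : D ∪ w ∈ indep A) :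
    u (D ∪ w) = c ^ D.card * u w := by
  induction D using Finset.induction_on with
  | empty => simp
  | insert x D hx ih =>
    have hxs := mem_lo.1 (hD (Finset.mem_insert_self x D))
    rw [Finset.disjoint_insert_left] at hd
    rw [Finset.insert_union] at h ⊢
    have h' : D ∪ w ∈ indep A := by
      rw [mem_indep] at h ⊢
      exact ⟨(Finset.subset_insert _ _).trans h.1, fun z hz hz' =>
        h.2 z (Finset.mem_insert_of_mem hz) (Finset.mem_insert_of_mem hz')⟩
    rw [hu x hxs.1 hxs.2 _ (by simp [hx, hd.1]) h,
      ih ((Finset.subset_insert _ _).trans hD) hd.2 h', Finset.card_insert_of_notMem hx]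
    ring

/-- The estimate for all chains: `u` is a ground state of the bonds below `t - 1` and orthogonal to
the ground states of the bonds up to `t`, and `χ` is a ground state of the last four of them. -/
theorem bond_estimate {A : Finset ℕ} (hA : ∀ x ∈ A, x + 1 ∉ A) (hA2 : ∀ x ∈ A, 2 ≤ x)
    {t : ℕ} {c : ℂ} {F : ℝ} (hF0 : 0 ≤ F)
    (hF : ∀ n, 4 ≤ n → overlapRatio (‖c‖ ^ 2) n ≤ F) {u χ : Finset ℕ → ℂ}
    (hu : ∀ x ∈ A, x < t - 1 → ∀ D, x ∉ D → insert x D ∈ indep A → u (insert x D) = c * u D)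
    (hχ : ∀ x ∈ A, t - 3 ≤ x → x ≤ t → ∀ D, x ∉ D → insert x D ∈ indep A →
      χ (insert x D) = c * χ D)
    (orth : ∀ v ∈ indep (A.filter (t < ·)),
      ∑ D ∈ indep (A.filter fun a => a ≤ t ∧ a + 2 ∉ v), starRingEnd ℂ c ^ D.card * u (D ∪ v) = 0) :
    ∑ D ∈ indep A, projTerm (χ D) (u D) ≤ F * ∑ D ∈ indep A, ‖u D‖ ^ 2 := by
  rw [sum_indep_split A t, sum_indep_split A t, Finset.mul_sum]
  refine Finset.sum_le_sum fun v hv => ?_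
  have horth := orth v hv
  have hun : ∀ D ∈ indep (A.filter fun a => a ≤ t ∧ a + 2 ∉ v), D ∪ v ∈ indep A :=
    fun D hD => union_mem_indep hD hv
  have hvt : ∀ x ∈ v, t < x := fun x hx => (Finset.mem_filter.1 ((mem_indep.1 hv).1 hx)).2
  by_cases hB : ∃ y ∈ A, y ≤ t ∧ t ≤ y + 1 ∧ y + 2 ∉ v
  · obtain ⟨y, hy, hyt, hty, hyv⟩ := hB
    have hBlo : (A.filter fun a => a ≤ t ∧ a + 2 ∉ v) = lo A (y + 1) := by
      ext a
      simp only [Finset.mem_filter, mem_lo, and_congr_right_iff]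
      intro ha
      have n1 : a ≠ y + 1 := fun h => hA y hy (h ▸ ha)
      have n2 : y ≠ a + 1 := fun h => hA a ha (h ▸ hy)
      refine ⟨fun h => by omega, fun h => ⟨by omega, fun hav => ?_⟩⟩
      have := hvt _ hav
      rcases Nat.lt_or_ge a y with h' | h'
      · omega
      · exact hyv ((show y = a by omega) ▸ hav)
    rw [hBlo] at hun horth ⊢
    have hdisj : ∀ {z}, z ≤ t + 1 → ∀ D ∈ indep (lo A z), Disjoint D v := fun hz D hD =>
      Finset.disjoint_left.2 fun x hx hxv => by
        have := hvt x hxv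
        have := (mem_lo.1 ((mem_indep.1 hD).1 hx)).2
        omega
    have hy2 := hA2 y hy
    have hyv' : y ∉ v := fun h => by have := hvt y h; omega
    refine chain_estimate hA hA2 hy (a := u v) (b := u (insert y v)) hF0 hF
      (u := fun D => u (D ∪ v)) (χ := fun D => χ (D ∪ v)) ?_ ?_ ?_ ?_ horth
    · intro D hD
      have hD' := indep_mono (lo_mono A (show y - 1 ≤ y + 1 by omega)) hD
      refine apply_union_of_insert hu ?_ (hdisj (by omega) D hD) (hun D hD')
      exact (mem_indep.1 hD).1.trans (lo_mono A (by omega))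
    · intro D hD
      have hins := hun _ (insert_mem_indep hy hD)
      change u (insert y D ∪ v) = _
      rw [Finset.insert_union, ← Finset.union_insert] at *
      refine apply_union_of_insert hu ?_ ?_ hins
      · exact (mem_indep.1 hD).1.trans (lo_mono A (by omega))
      · rw [Finset.disjoint_insert_right]
        exact ⟨notMem_of_mem_indep_lo hD (by omega), hdisj (by omega) D hD⟩
    · intro D hD
      have hins := hun _ (insert_mem_indep hy hD)
      change χ (insert y D ∪ v) = _
      rw [Finset.insert_union] at *
      refine hχ y hy (by omega) hyt _ ?_ hins
      rw [Finset.mem_union, not_or]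
      exact ⟨notMem_of_mem_indep_lo hD (by omega), hyv'⟩
    · intro hy' D hD
      have hD' : insert (y - 2) D ∈ indep (lo A (y + 1)) := by
        refine indep_mono (lo_mono A (by omega)) (insert_mem_indep hy' ?_)
        rwa [show y - 2 - 2 = y - 4 by omega]
      have hins := hun _ hD'
      change χ (insert (y - 2) D ∪ v) = _
      rw [Finset.insert_union] at *
      refine hχ _ hy' (by omega) (by omega) _ ?_ hins
      rw [Finset.mem_union, not_or]
      refine ⟨notMem_of_mem_indep_lo hD (by omega), fun h => ?_⟩
      have := hvt _ h
      omega
  · -- no bond near `t` is available, so `u` is a ground state of all bonds up to `t`, and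
    -- orthogonality makes it vanish
    have hval : ∀ D ∈ indep (A.filter fun a => a ≤ t ∧ a + 2 ∉ v), u (D ∪ v) = c ^ D.card * u v := by
      intro D hD
      have hsub : ∀ x ∈ D, x ∈ A ∧ x ≤ t ∧ x + 2 ∉ v := fun x hx =>
        Finset.mem_filter.1 ((mem_indep.1 hD).1 hx)
      refine apply_union_of_insert hu (fun x hx => ?_) ?_ (hun D hD)
      · have h := hsub x hx
        rw [mem_lo]
        refine ⟨h.1, ?_⟩
        by_contra hlt
        exact hB ⟨x, h.1, h.2.1, by omega, h.2.2⟩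
      · refine Finset.disjoint_left.2 fun x hx hxv => ?_
        have := hvt x hxv
        have := (hsub x hx).2.1
        omega
    have huv : u v = 0 := by
      have h0 : (partFun (‖c‖ ^ 2) (A.filter fun a => a ≤ t ∧ a + 2 ∉ v) : ℂ) * u v = 0 := by
        rw [← horth, partFun, Complex.ofReal_sum, Finset.sum_mul]
        refine Finset.sum_congr rfl fun D hD => ?_
        rw [hval D hD, ← mul_assoc, conj_pow_mul_pow]
      refine (mul_eq_zero.1 h0).resolve_left ?_
      exact_mod_cast (partFun_pos (by positivity) _).ne'
    refine le_trans (Finset.sum_nonpos fun D hD => ?_)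
      (mul_nonneg hF0 (Finset.sum_nonneg fun D _ => by positivity))
    rw [hval D hD, huv, mul_zero]
    exact projTerm_le_zero _

/-! ### Unbounded operators that leave a finite-dimensional space invariant -/

section Restriction

variable {E : Type*} [NormedAddCommGroup E] [InnerProductSpace ℂ E]

/-- The symmetric operator `A` leaves `C` invariant and restricts to the linear map `T` on `C`. -/
def Implements {C : Submodule ℂ E} (A : E →ₗ.[ℂ] E) (T : C →ₗ[ℂ] C) : Prop :=
  (∀ φ ψ : A.domain, ⟪A φ, (ψ : E)⟫_ℂ = ⟪(φ : E), A ψ⟫_ℂ) ∧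
    ∀ ψ : C, ∃ h : (ψ : E) ∈ A.domain, A ⟨ψ, h⟩ = T ψ

variable {C : Submodule ℂ E} {A : E →ₗ.[ℂ] E} {T : C →ₗ[ℂ] C}

theorem Implements.add {A' : E →ₗ.[ℂ] E} {T' : C →ₗ[ℂ] C} (h : Implements A T)
    (h' : Implements A' T') : Implements (A + A') (T + T') := by
  refine ⟨fun φ ψ => ?_, fun ψ => ?_⟩
  · change ⟪A ⟨φ, φ.2.1⟩ + A' ⟨φ, φ.2.2⟩, (ψ : E)⟫_ℂ = ⟪(φ : E), A ⟨ψ, ψ.2.1⟩ + A' ⟨ψ, ψ.2.2⟩⟫_ℂ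
    rw [inner_add_left, inner_add_right]
    exact congr_arg₂ _ (h.1 ⟨φ, φ.2.1⟩ ⟨ψ, ψ.2.1⟩) (h'.1 ⟨φ, φ.2.2⟩ ⟨ψ, ψ.2.2⟩)
  · obtain ⟨m, e⟩ := h.2 ψ
    obtain ⟨m', e'⟩ := h'.2 ψ
    refine ⟨⟨m, m'⟩, ?_⟩
    change A ⟨ψ, m⟩ + A' ⟨ψ, m'⟩ = _
    rw [e, e']
    rfl

theorem Implements.zero : Implements (0 : E →ₗ.[ℂ] E) (0 : C →ₗ[ℂ] C) := by
  refine ⟨fun φ ψ => ?_, fun ψ => ⟨trivial, rfl⟩⟩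
  change ⟪(0 : E), (ψ : E)⟫_ℂ = ⟪(φ : E), (0 : E)⟫_ℂ
  simp

theorem Implements.sum {ι : Type*} {A : ι → E →ₗ.[ℂ] E} {T : ι → C →ₗ[ℂ] C} {s : Finset ι}
    (h : ∀ i ∈ s, Implements (A i) (T i)) : Implements (∑ i ∈ s, A i) (∑ i ∈ s, T i) := by
  classical
  induction s using Finset.induction_on with
  | empty => exact Implements.zero
  | insert i s hi ih =>
    rw [Finset.sum_insert hi, Finset.sum_insert hi]
    exact (h i (Finset.mem_insert_self i s)).add
      (ih fun j hj => h j (Finset.mem_insert_of_mem hj))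

theorem Implements.restrictsTo (h : Implements A T) : RestrictsTo A C := by
  refine ⟨fun ψ hψ => (h.2 ⟨ψ, hψ⟩).1, fun ψ hψ => ?_⟩
  obtain ⟨m, e⟩ := h.2 ⟨ψ, hψ⟩
  change A ⟨ψ, m⟩ ∈ C
  rw [e]
  exact (T ⟨ψ, hψ⟩).2

theorem Implements.apply_eq (h : Implements A T) (ψ : C) (hψ : (ψ : E) ∈ A.domain) :
    A ⟨ψ, hψ⟩ = T ψ := (h.2 ψ).2

theorem Implements.isSymmetric (h : Implements A T) : T.IsSymmetric := fun φ ψ => by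
  obtain ⟨m, e⟩ := h.2 φ
  obtain ⟨m', e'⟩ := h.2 ψ
  rw [Submodule.coe_inner, Submodule.coe_inner, ← e, ← e']
  exact h.1 ⟨φ, m⟩ ⟨ψ, m'⟩

theorem mem_kernel_iff {ψ : E} : ψ ∈ kernel A ↔ ∃ h : ψ ∈ A.domain, A ⟨ψ, h⟩ = 0 := by
  simp only [kernel, Submodule.mem_map, LinearMap.mem_ker]
  constructor
  · rintro ⟨φ, h, rfl⟩
    exact ⟨φ.2, h⟩
  · rintro ⟨h, h'⟩
    exact ⟨⟨ψ, h⟩, h', rfl⟩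

theorem Implements.mem_kernel_iff (h : Implements A T) (ψ : C) :
    (ψ : E) ∈ kernel A ↔ T ψ = 0 := by
  rw [TruncatedHaldane.mem_kernel_iff]
  obtain ⟨m, e⟩ := h.2 ψ
  constructor
  · rintro ⟨_, h'⟩
    exact Subtype.ext (e.symm.trans h')
  · intro h'
    exact ⟨m, by rw [e, h']; rfl⟩

/-- The range of `T` on `C` is orthogonal to the kernel of `A`, so that on `C` the projection onto
the kernel of the unbounded operator `A` is the projection onto the kernel of `T`. -/
theorem Implements.kerProj_eq [CompleteSpace E] [FiniteDimensional ℂ C] (h : Implements A T)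
    (ψ : C) : kerProj A ψ = (T.ker.starProjection ψ : C) := by
  have h1 : ψ - T.ker.starProjection ψ ∈ T.range := by
    have h2 := Submodule.sub_starProjection_mem_orthogonal (K := T.ker) ψ
    have h3 : T.kerᗮ = T.range := by
      rw [← h.isSymmetric.orthogonal_range, Submodule.orthogonal_orthogonal]
    rwa [h3] at h2
  obtain ⟨χ, hχ⟩ := h1
  obtain ⟨m, e⟩ := h.2 χ
  refine Submodule.eq_starProjection_of_mem_orthogonal
    (K := (kernel A).topologicalClosure) ?_ ?_
  · refine Submodule.le_topologicalClosure _ ((h.mem_kernel_iff _).2 ?_)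
    exact LinearMap.mem_ker.1 (Submodule.starProjection_apply_mem _ _)
  · rw [Submodule.orthogonal_closure, ← Submodule.coe_sub, ← hχ, ← e, Submodule.mem_orthogonal]
    intro φ hφ
    obtain ⟨hφ, h0⟩ := TruncatedHaldane.mem_kernel_iff.1 hφ
    rw [← h.1 ⟨φ, hφ⟩ ⟨χ, m⟩, h0, inner_zero_left]

end Restriction

/-! ### Positive maps on a finite-dimensional space -/

section Positive

variable {V : Type*} [NormedAddCommGroup V] [InnerProductSpace ℂ V]

theorem IsPositive_ker {P : V →ₗ[ℂ] V} (hP : P.IsPositive) {v : V}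
    (hv : (⟪v, P v⟫_ℂ).re ≤ 0) : P v = 0 := by
  by_contra hne
  have hn : 0 < ‖P v‖ ^ 2 := by positivity
  set w := P v with hw
  have hk := hP.re_inner_nonneg_right w
  set k := (⟪w, P w⟫_ℂ).re with hkdef
  change 0 ≤ k at hk
  have expand : ∀ t : ℝ, 0 ≤ -(2 * t * ‖w‖ ^ 2) + t ^ 2 * k := fun t => by
    have h1 := hP.re_inner_nonneg_right (v - (t : ℂ) • w)
    have h2 : ⟪v, P w⟫_ℂ = ⟪w, w⟫_ℂ := (hP.isSymmetric v w).symm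
    simp only [map_sub, map_smul, inner_sub_left, inner_sub_right, inner_smul_left,
      inner_smul_right, ← hw, h2, inner_self_eq_norm_sq_to_K, Complex.conj_ofReal] at h1
    have h3 : (⟪v, w⟫_ℂ).re ≤ 0 := hv
    simp only [RCLike.re_to_complex, Complex.sub_re, Complex.re_ofReal_mul, Complex.coe_algebraMap]
      at h1
    norm_cast at h1
    have : (t : ℝ) * (t * k) = t ^ 2 * k := by ring
    nlinarith [h1]
  have h5 := expand (‖w‖ ^ 2 / (k + 1))
  have h6 : ‖w‖ ^ 2 / (k + 1) * (k + 1) = ‖w‖ ^ 2 := by field_simp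
  have h7 : 0 < ‖w‖ ^ 2 / (k + 1) := by positivity
  generalize ‖w‖ ^ 2 / (k + 1) = t at *
  nlinarith [mul_pos h7 h7, mul_nonneg (mul_pos h7 h7).le hk]

theorem sum_apply_eq_zero_iff {ι : Type*} {s : Finset ι} {P : ι → V →ₗ[ℂ] V}
    (hP : ∀ i ∈ s, (P i).IsPositive) {v : V} :
    (∑ i ∈ s, P i) v = 0 ↔ ∀ i ∈ s, P i v = 0 := by
  refine ⟨fun h i hi => IsPositive_ker (hP i hi) ?_, fun h => ?_⟩
  · have h0 : ∑ j ∈ s, (⟪v, P j v⟫_ℂ).re = 0 := by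
      rw [← Complex.re_sum, ← inner_sum, ← LinearMap.sum_apply, h, inner_zero_right,
        Complex.zero_re]
    have := Finset.single_le_sum (f := fun j => (⟪v, P j v⟫_ℂ).re)
      (fun j hj => (hP j hj).re_inner_nonneg_right v) hi
    simpa [h0] using this
  · rw [LinearMap.sum_apply]
    exact Finset.sum_eq_zero h

variable [FiniteDimensional ℂ V]

/-- If `T² ≥ γ T` for a positive `T`, then `T ≥ γ` off its kernel. -/
theorem gap_of_sq_ge {T : V →ₗ[ℂ] V} (hT : T.IsPositive) {γ : ℝ}
    (h : ∀ u, γ * (⟪u, T u⟫_ℂ).re ≤ ‖T u‖ ^ 2) (hγ : 0 ≤ γ) (v : V) :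
    γ * (⟪v, v - T.ker.starProjection v⟫_ℂ).re ≤ (⟪v, T v⟫_ℂ).re := by
  set p := T.ker.starProjection v with hp
  have hpk : T p = 0 := LinearMap.mem_ker.1 (Submodule.starProjection_apply_mem _ _)
  have h2 : v - p ∈ T.kerᗮ := Submodule.sub_starProjection_mem_orthogonal v
  have h2' := h2
  rw [← hT.isSymmetric.orthogonal_range, Submodule.orthogonal_orthogonal] at h2
  obtain ⟨u, hu⟩ := h2
  have e1 : (⟪v, v - p⟫_ℂ).re = ‖v - p‖ ^ 2 := by
    have h3 : ⟪p, v - p⟫_ℂ = 0 := h2' p (Submodule.starProjection_apply_mem _ _)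
    rw [← sub_zero (⟪v, v - p⟫_ℂ), ← h3, ← inner_sub_left, ← RCLike.re_to_complex,
      inner_self_eq_norm_sq]
  have e2 : (⟪v, T v⟫_ℂ).re = (⟪v - p, T (v - p)⟫_ℂ).re := by
    have h3 : ⟪p, T v⟫_ℂ = 0 := by rw [← hT.isSymmetric p v, hpk, inner_zero_left]
    rw [map_sub, hpk, sub_zero, inner_sub_left, h3, sub_zero]
  rw [e1, e2]
  set w := v - p
  -- positivity of `T` at `w - γ u`, where `w = T u`
  have h4 := hT.re_inner_nonneg_right (w - (γ : ℂ) • u)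
  have h5 : ⟪u, T w⟫_ℂ = ⟪w, w⟫_ℂ := by rw [← hT.isSymmetric u w, hu]
  have h6 := h u
  rw [hu] at h6
  simp only [map_sub, map_smul, inner_sub_left, inner_sub_right, inner_smul_left,
    inner_smul_right, hu, h5, inner_self_eq_norm_sq_to_K, Complex.conj_ofReal,
    RCLike.re_to_complex, Complex.sub_re, Complex.re_ofReal_mul, Complex.coe_algebraMap] at h4
  norm_cast at h4
  nlinarith [mul_le_mul_of_nonneg_left h6 hγ]

theorem starProjection_ker_comm {S T : V →ₗ[ℂ] V} (hS : S.IsSymmetric)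
    (h : ∀ v, S (T v) = T (S v)) (v : V) :
    S (T.ker.starProjection v) = T.ker.starProjection (S v) := by
  refine (Submodule.eq_starProjection_of_mem_orthogonal (K := T.ker) ?_ ?_).symm
  · rw [LinearMap.mem_ker, ← h, LinearMap.mem_ker.1 (Submodule.starProjection_apply_mem T.ker v),
      map_zero]
  · rw [← map_sub, Submodule.mem_orthogonal]
    intro u hu
    rw [← hS]
    refine Submodule.sub_starProjection_mem_orthogonal (K := T.ker) v _ ?_
    rw [LinearMap.mem_ker] at hu ⊢
    rw [← h, hu, map_zero]

theorem starProjection_ker_comm_starProjection_ker {S T : V →ₗ[ℂ] V}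
    (hT : T.IsSymmetric) (h : ∀ v, S (T v) = T (S v)) (v : V) :
    S.ker.starProjection (T.ker.starProjection v) =
      T.ker.starProjection (S.ker.starProjection v) :=
  starProjection_ker_comm (S := (S.ker.starProjection : V →ₗ[ℂ] V))
    (Submodule.starProjection_isSymmetric _) (fun u =>
      (starProjection_ker_comm (S := T) (T := S) hT (fun u => (h u).symm) u).symm) v

theorem starProjection_starProjection_of_le {K K' : Submodule ℂ V} (h : K ≤ K') (v : V) :
    K'.starProjection (K.starProjection v) = K.starProjection v :=
  Submodule.starProjection_eq_self_iff.2 (h (Submodule.starProjection_apply_mem _ _))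

theorem starProjection_starProjection_of_le' {K K' : Submodule ℂ V} (h : K ≤ K') (v : V) :
    K.starProjection (K'.starProjection v) = K.starProjection v :=
  congr($(Submodule.starProjection_comp_starProjection_of_le h) v)

end Positive

/-! ### The martingale method -/

/-- The martingale method with overlap length three: if a vector is a sum of orthogonal components
`e_n`, each close to the range of `1 - p_n`, where `p_n` does not mix `e_n` with the components
outside `n - 2, …, n`, then it has weight on the ranges of the `1 - p_n`. -/
theorem martingale_estimate {V : Type*} [NormedAddCommGroup V] [InnerProductSpace ℂ V]
    {M : ℕ} {e : ℕ → V} {ψ : V} (p : ℕ → V →L[ℂ] V) (hp : ∀ n u v, ⟪p n u, v⟫_ℂ = ⟪u, p n v⟫_ℂ)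
    {ε : ℝ} (hε : 0 ≤ ε) (hε1 : √3 * ε < 1)
    (hsum : ∑ n ∈ Finset.Icc 1 M, e n = ψ)
    (horth : ∀ m ∈ Finset.Icc 1 M, ∀ n ∈ Finset.Icc 1 M, m ≠ n → ⟪e m, e n⟫_ℂ = 0)
    (hloc : ∀ m ∈ Finset.Icc 1 M, ∀ n ∈ Finset.Icc 1 M, ¬(m ≤ n ∧ n ≤ m + 2) →
      ⟪e m, p n (e n)⟫_ℂ = 0)
    (hov : ∀ n ∈ Finset.Icc 1 M, ‖p n (e n)‖ ≤ ε * ‖e n‖) :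
    (1 - √3 * ε) ^ 2 * ‖ψ‖ ^ 2 ≤ ∑ n ∈ Finset.Icc 1 M, ‖ψ - p n ψ‖ ^ 2 := by
  set I := Finset.Icc 1 M
  have pyth : ∀ s ⊆ I, ‖∑ n ∈ s, e n‖ ^ 2 = ∑ n ∈ s, ‖e n‖ ^ 2 := fun s hs => by
    have h1 : ⟪∑ n ∈ s, e n, ∑ n ∈ s, e n⟫_ℂ = ∑ n ∈ s, ⟪e n, e n⟫_ℂ := by
      rw [sum_inner]
      refine Finset.sum_congr rfl fun n hn => ?_
      rw [inner_sum, Finset.sum_eq_single_of_mem n hn]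
      intro m hm hmn
      exact horth n (hs hn) m (hs hm) (Ne.symm hmn)
    simp only [inner_self_eq_norm_sq_to_K] at h1
    exact_mod_cast h1
  have hψ : ‖ψ‖ ^ 2 = ∑ n ∈ I, ‖e n‖ ^ 2 := by rw [← hsum, pyth I subset_rfl]
  set δ := 1 - √3 * ε with hδ
  have hδ0 : 0 < δ := by linarith
  have h3 : √3 ^ 2 = 3 := Real.sq_sqrt (by norm_num)
  have h30 : 0 < √3 := by positivity
  set w : ℕ → V := fun n => ∑ m ∈ I.filter (fun m => m ≤ n ∧ n ≤ m + 2), e m with hw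
  have step : ∀ n ∈ I, ‖e n‖ ^ 2 ≤ (1 / (2 * δ)) * ‖ψ - p n ψ‖ ^ 2 + δ / 2 * ‖e n‖ ^ 2
      + ε * (√3 / 6 * ‖w n‖ ^ 2 + √3 / 2 * ‖e n‖ ^ 2) := fun n hn => by
    have a1 : ⟪ψ, e n⟫_ℂ = ⟪e n, e n⟫_ℂ := by
      rw [← hsum, sum_inner, Finset.sum_eq_single_of_mem n hn]
      exact fun m hm hmn => horth m hm n hn hmn
    have a2 : ⟪ψ, p n (e n)⟫_ℂ = ⟪w n, p n (e n)⟫_ℂ := by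
      rw [hw, ← hsum, sum_inner, sum_inner, Finset.sum_filter]
      refine Finset.sum_congr rfl fun m hm => ?_
      split_ifs with h
      · rfl
      · exact hloc m hm n hn h
    have a3 : ‖e n‖ ^ 2 = (⟪ψ - p n ψ, e n⟫_ℂ).re + (⟪w n, p n (e n)⟫_ℂ).re := by
      rw [← a2, inner_sub_left, hp, Complex.sub_re, sub_add_cancel, a1, ← RCLike.re_to_complex,
        inner_self_eq_norm_sq]
    have a4 : (⟪ψ - p n ψ, e n⟫_ℂ).re ≤ ‖ψ - p n ψ‖ * ‖e n‖ :=
      (Complex.re_le_norm _).trans (norm_inner_le_norm _ _)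
    have a5 : (⟪w n, p n (e n)⟫_ℂ).re ≤ ‖w n‖ * (ε * ‖e n‖) :=
      ((Complex.re_le_norm _).trans (norm_inner_le_norm _ _)).trans
        (mul_le_mul_of_nonneg_left (hov n hn) (norm_nonneg _))
    have a6 : ‖ψ - p n ψ‖ * ‖e n‖ ≤ (1 / (2 * δ)) * ‖ψ - p n ψ‖ ^ 2 + δ / 2 * ‖e n‖ ^ 2 := by
      have : (1 / (2 * δ)) * ‖ψ - p n ψ‖ ^ 2 + δ / 2 * ‖e n‖ ^ 2 - ‖ψ - p n ψ‖ * ‖e n‖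
        = (‖ψ - p n ψ‖ - δ * ‖e n‖) ^ 2 / (2 * δ) := by field_simp; ring
      have h7 : 0 ≤ (‖ψ - p n ψ‖ - δ * ‖e n‖) ^ 2 / (2 * δ) := by positivity
      linarith
    have a7 : ‖w n‖ * ‖e n‖ ≤ √3 / 6 * ‖w n‖ ^ 2 + √3 / 2 * ‖e n‖ ^ 2 := by
      have h7 : 0 ≤ √3 / 6 * (‖w n‖ - √3 * ‖e n‖) ^ 2 := by positivity
      nlinarith
    nlinarith [mul_le_mul_of_nonneg_left a7 hε]
  have hwsum : ∑ n ∈ I, ‖w n‖ ^ 2 ≤ 3 * ‖ψ‖ ^ 2 := by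
    have b1 : ∀ n ∈ I, ‖w n‖ ^ 2 = ∑ m ∈ I, if m ≤ n ∧ n ≤ m + 2 then ‖e m‖ ^ 2 else 0 :=
      fun n _ => by rw [hw, pyth _ (Finset.filter_subset _ _), Finset.sum_filter]
    rw [Finset.sum_congr rfl b1, Finset.sum_comm, hψ, Finset.mul_sum]
    refine Finset.sum_le_sum fun m _ => ?_
    rw [← Finset.sum_filter, Finset.sum_const, nsmul_eq_mul]
    refine mul_le_mul_of_nonneg_right ?_ (by positivity)
    have b2 : (I.filter fun n => m ≤ n ∧ n ≤ m + 2) ⊆ Finset.Icc m (m + 2) := fun n hn => by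
      simp only [Finset.mem_filter, Finset.mem_Icc] at hn ⊢
      exact hn.2
    have := Finset.card_le_card b2
    rw [Nat.card_Icc] at this
    exact_mod_cast this.trans (by omega)
  have total := Finset.sum_le_sum step
  simp only [Finset.sum_add_distrib, ← Finset.mul_sum] at total
  rw [← hψ] at total
  have c1 : ε * (√3 / 6 * ∑ n ∈ I, ‖w n‖ ^ 2) ≤ ε * (√3 / 6 * (3 * ‖ψ‖ ^ 2)) := by gcongr
  set S := ∑ n ∈ I, ‖ψ - p n ψ‖ ^ 2
  have c2 : δ / 2 * ‖ψ‖ ^ 2 ≤ 1 / (2 * δ) * S := by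
    rw [hδ] at total ⊢
    linarith
  have c3 := mul_le_mul_of_nonneg_left c2 (show 0 ≤ 2 * δ by positivity)
  have c4 : 2 * δ * (1 / (2 * δ) * S) = S := by field_simp
  nlinarith

/-! ### Separated configurations and the bond moves -/

section Configurations

variable {L : ℕ}

theorem occ_of_mem {μ : Config L} {x : ℕ} (h : x ∈ Finset.Icc 1 L) : occ μ x = μ ⟨x, h⟩ :=
  dif_pos h

theorem occ_of_notMem {μ : Config L} {x : ℕ} (h : ¬(1 ≤ x ∧ x ≤ L)) : occ μ x = 0 :=
  dif_neg (by simpa using h)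

theorem config_ext {μ ν : Config L} (h : ∀ x, 1 ≤ x → x ≤ L → occ μ x = occ ν x) : μ = ν := by
  ext ⟨x, hx⟩
  have := h x (Finset.mem_Icc.1 hx).1 (Finset.mem_Icc.1 hx).2
  rwa [occ_of_mem hx, occ_of_mem hx] at this

/-- The configurations in which two occupied sites are at least as far apart as the total number of
particles on them. These are the configurations of the tilings with bulk roots. -/
def IsSeparated (μ : Config L) : Prop :=
  (∀ x, occ μ x ≤ 2) ∧
    ∀ x y, x < y → occ μ x ≠ 0 → occ μ y ≠ 0 → x + occ μ x + occ μ y ≤ y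

theorem finite_isSeparated (L : ℕ) : {μ : Config L | IsSeparated μ}.Finite := by
  refine (Set.finite_Iic (fun _ => 2 : Config L)).subset fun μ hμ => ?_
  intro y
  have := hμ.1 y
  rwa [occ_of_mem y.2] at this

/-- The finite set of separated configurations. -/
def separated (L : ℕ) : Finset (Config L) := (finite_isSeparated L).toFinset

theorem mem_separated {μ : Config L} : μ ∈ separated L ↔ IsSeparated μ := by
  simp [separated]

/-- The configuration with a dimer at `x`. -/
def dimerAt (x : ℕ) (μ : Config L) : Config L :=
  fun y => if (y : ℕ) = x then 2 else if (y : ℕ) + 1 = x ∨ (y : ℕ) = x + 1 then 0 else μ y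

/-- The configuration with two monomers around `x`. -/
def monosAt (x : ℕ) (μ : Config L) : Config L :=
  fun y => if (y : ℕ) = x then 0 else if (y : ℕ) + 1 = x ∨ (y : ℕ) = x + 1 then 1 else μ y

/-- The configuration with no particles at `x` and its neighbours. -/
def clearAt (x : ℕ) (μ : Config L) : Config L :=
  fun y => if (y : ℕ) = x then 0 else if (y : ℕ) + 1 = x ∨ (y : ℕ) = x + 1 then 0 else μ y

variable {x : ℕ} {μ : Config L}

theorem occ_dimerAt (h2 : 2 ≤ x) (hL : x + 1 ≤ L) (y : ℕ) : occ (dimerAt x μ) y =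
    if y = x then 2 else if y + 1 = x ∨ y = x + 1 then 0 else occ μ y := by
  simp only [occ, dimerAt, Finset.mem_Icc]
  split_ifs <;> first | rfl | omega

theorem occ_monosAt (h2 : 2 ≤ x) (hL : x + 1 ≤ L) (y : ℕ) : occ (monosAt x μ) y =
    if y = x then 0 else if y + 1 = x ∨ y = x + 1 then 1 else occ μ y := by
  simp only [occ, monosAt, Finset.mem_Icc]
  split_ifs <;> first | rfl | omega

theorem occ_clearAt (y : ℕ) : occ (clearAt x μ) y =
    if y = x then 0 else if y + 1 = x ∨ y = x + 1 then 0 else occ μ y := by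
  simp only [occ, clearAt, Finset.mem_Icc]
  split_ifs <;> rfl

/-- The configuration has monomers on both sides of `x`. -/
def HasMonos (x : ℕ) (μ : Config L) : Prop := occ μ (x - 1) = 1 ∧ occ μ (x + 1) = 1

instance (x : ℕ) (μ : Config L) : Decidable (HasMonos x μ) := instDecidableAnd

theorem IsSeparated.occ_eq_zero_of_dimer (hμ : IsSeparated μ) (hx : occ μ x = 2) {y : ℕ}
    (hy : y ≠ x) (h1 : y ≤ x + 2) (h2 : x ≤ y + 2) : occ μ y = 0 := by
  by_contra h
  have a := hμ.2 x y
  have b := hμ.2 y x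
  omega

theorem IsSeparated.occ_eq_zero_of_hasMonos (hμ : IsSeparated μ) (hx : HasMonos x μ)
    (h2 : 2 ≤ x) : occ μ x = 0 := by
  by_contra h
  have a := hμ.2 (x - 1) x (by omega)
  have := hx.1
  omega

theorem dimerAt_eq_self (hμ : IsSeparated μ) (hx : occ μ x = 2) (h2 : 2 ≤ x) (hL : x + 1 ≤ L) :
    dimerAt x μ = μ := by
  refine config_ext fun y _ _ => ?_
  rw [occ_dimerAt h2 hL]
  split_ifs with e e'
  · rw [e, hx]
  · exact (hμ.occ_eq_zero_of_dimer hx (by omega) (by omega) (by omega)).symm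
  · rfl

theorem monosAt_eq_self (hμ : IsSeparated μ) (hx : HasMonos x μ) (h2 : 2 ≤ x) (hL : x + 1 ≤ L) :
    monosAt x μ = μ := by
  refine config_ext fun y _ _ => ?_
  rw [occ_monosAt h2 hL]
  split_ifs with e e'
  · rw [e, hμ.occ_eq_zero_of_hasMonos hx h2]
  · rcases e' with e' | e'
    · rw [← hx.1, show x - 1 = y by omega]
    · rw [← hx.2, e']
  · rfl

theorem isSeparated_dimerAt (hμ : IsSeparated μ) (hx : HasMonos x μ) (h2 : 2 ≤ x)
    (hL : x + 1 ≤ L) : IsSeparated (dimerAt x μ) := by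
  obtain ⟨m1, m2⟩ := hx
  refine ⟨fun y => ?_, fun y z hyz => ?_⟩
  · have := hμ.1 y
    rw [occ_dimerAt h2 hL]
    split_ifs <;> omega
  · have a := hμ.2 y z hyz
    have b := hμ.2 (x - 1) z
    have c := hμ.2 (x + 1) z
    have d := hμ.2 y (x - 1)
    have e := hμ.2 y (x + 1)
    rw [m1] at b d
    rw [m2] at c e
    rw [occ_dimerAt h2 hL, occ_dimerAt h2 hL]
    split_ifs <;> omega

theorem isSeparated_monosAt (hμ : IsSeparated μ) (hx : occ μ x = 2) (h2 : 2 ≤ x)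
    (hL : x + 1 ≤ L) : IsSeparated (monosAt x μ) := by
  refine ⟨fun y => ?_, fun y z hyz => ?_⟩
  · have := hμ.1 y
    rw [occ_monosAt h2 hL]
    split_ifs <;> omega
  · have a := hμ.2 y z hyz
    have b := hμ.2 x z
    have d := hμ.2 y x
    rw [hx] at b d
    rw [occ_monosAt h2 hL, occ_monosAt h2 hL]
    split_ifs <;> omega

theorem hasMonos_monosAt (h2 : 2 ≤ x) (hL : x + 1 ≤ L) : HasMonos x (monosAt x μ) := by
  constructor <;> rw [occ_monosAt h2 hL] <;> split_ifs <;> omega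

theorem occ_dimerAt_self (h2 : 2 ≤ x) (hL : x + 1 ≤ L) : occ (dimerAt x μ) x = 2 := by
  rw [occ_dimerAt h2 hL, if_pos rfl]

theorem dimerAt_dimerAt : dimerAt x (dimerAt x μ) = dimerAt x μ := by
  ext y; simp only [dimerAt]; split_ifs <;> rfl

theorem dimerAt_monosAt : dimerAt x (monosAt x μ) = dimerAt x μ := by
  ext y; simp only [dimerAt, monosAt]; split_ifs <;> rfl

theorem monosAt_dimerAt : monosAt x (dimerAt x μ) = monosAt x μ := by
  ext y; simp only [dimerAt, monosAt]; split_ifs <;> rfl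

theorem dimerAt_clearAt : dimerAt x (clearAt x μ) = dimerAt x μ := by
  ext y; simp only [dimerAt, clearAt]; split_ifs <;> rfl

theorem IsSeparated.not_hasMonos_of_dimer (hμ : IsSeparated μ) (hx : occ μ x = 2) {y : ℕ}
    (h1 : y ≤ x + 3) (h2 : x ≤ y + 3) (hy2 : 2 ≤ y) : ¬HasMonos y μ := fun h => by
  have a := hμ.2 x (y - 1)
  have b := hμ.2 x (y + 1)
  have c := hμ.2 (y - 1) x
  have d := hμ.2 (y + 1) x
  have e := h.1
  have f := h.2
  rcases Nat.lt_trichotomy y x with g | g | g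
  · rcases eq_or_ne x (y + 1) with rfl | _ <;> omega
  · subst g; have := hμ.occ_eq_zero_of_hasMonos h hy2; omega
  · rcases eq_or_ne x (y - 1) with h' | _
    · rw [← h'] at e
      omega
    · omega

theorem IsSeparated.ne_two_of_dimer (hμ : IsSeparated μ) (hx : occ μ x = 2) {y : ℕ}
    (h1 : y ≤ x + 3) (h2 : x ≤ y + 3) (hy : y ≠ x) : occ μ y ≠ 2 := fun h => by
  have a := hμ.2 x y
  have b := hμ.2 y x
  omega

end Configurations

/-! ### The bond operators `q_x^* q_x` on the separated configurations -/

section Bond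

variable {L : ℕ} (lam : ℂ) (x : ℕ)

/-- The coefficient of `q_x ψ` after the removal of the two particles around `x` from `μ`. -/
def bond (ψ : Config L → ℂ) (μ : Config L) : ℂ :=
  (√2 : ℝ) * ψ (dimerAt x μ) - lam * ψ (monosAt x μ)

/-- The coefficients of `q_x^* q_x ψ`. -/
def bondTerm (ψ : Config L → ℂ) (μ : Config L) : ℂ :=
  if occ μ x = 2 then (√2 : ℝ) * bond lam x ψ μ
  else if HasMonos x μ then -(starRingEnd ℂ lam) * bond lam x ψ μ else 0

variable {lam x}

theorem bond_congr {ψ : Config L → ℂ} {μ ν : Config L} (h1 : dimerAt x μ = dimerAt x ν)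
    (h2 : monosAt x μ = monosAt x ν) : bond lam x ψ μ = bond lam x ψ ν := by
  rw [bond, bond, h1, h2]

/-- The quadratic form of `q_x^* q_x`: the two configurations related by the move at `x` combine
into the square of one coefficient. -/
theorem sum_conj_mul_bondTerm (h2 : 2 ≤ x) (hL : x + 1 ≤ L) (φ ψ : Config L → ℂ) :
    ∑ μ ∈ separated L, starRingEnd ℂ (φ μ) * bondTerm lam x ψ μ
      = ∑ μ ∈ (separated L).filter (fun μ => occ μ x = 2),
          starRingEnd ℂ (bond lam x φ μ) * bond lam x ψ μ := by
  have hsplit : ∀ μ ∈ separated L, starRingEnd ℂ (φ μ) * bondTerm lam x ψ μ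
      = (if occ μ x = 2 then starRingEnd ℂ (φ μ) * ((√2 : ℝ) * bond lam x ψ μ) else 0)
        + if HasMonos x μ then starRingEnd ℂ (φ μ) * (-(starRingEnd ℂ lam) * bond lam x ψ μ)
          else 0 := by
    intro μ hμ
    rw [mem_separated] at hμ
    rw [bondTerm]
    split_ifs with a b
    · exact absurd (hμ.occ_eq_zero_of_hasMonos b h2) (by omega)
    all_goals simp
  rw [Finset.sum_congr rfl hsplit, Finset.sum_add_distrib, ← Finset.sum_filter,
    ← Finset.sum_filter]
  have hre : ∑ μ ∈ (separated L).filter (HasMonos x),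
      starRingEnd ℂ (φ μ) * (-(starRingEnd ℂ lam) * bond lam x ψ μ)
      = ∑ μ ∈ (separated L).filter (fun μ => occ μ x = 2),
        starRingEnd ℂ (φ (monosAt x μ)) * (-(starRingEnd ℂ lam) * bond lam x ψ μ) := by
    refine Finset.sum_bij' (fun μ _ => dimerAt x μ) (fun μ _ => monosAt x μ) ?_ ?_ ?_ ?_ ?_
    · intro μ hμ
      simp only [Finset.mem_filter, mem_separated] at hμ ⊢
      exact ⟨isSeparated_dimerAt hμ.1 hμ.2 h2 hL, occ_dimerAt_self h2 hL⟩
    · intro μ hμ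
      simp only [Finset.mem_filter, mem_separated] at hμ ⊢
      exact ⟨isSeparated_monosAt hμ.1 hμ.2 h2 hL, hasMonos_monosAt h2 hL⟩
    · intro μ hμ
      simp only [Finset.mem_filter, mem_separated] at hμ
      rw [monosAt_dimerAt, monosAt_eq_self hμ.1 hμ.2 h2 hL]
    · intro μ hμ
      simp only [Finset.mem_filter, mem_separated] at hμ
      rw [dimerAt_monosAt, dimerAt_eq_self hμ.1 hμ.2 h2 hL]
    · intro μ hμ
      simp only [Finset.mem_filter, mem_separated] at hμ
      rw [monosAt_dimerAt, monosAt_eq_self hμ.1 hμ.2 h2 hL]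
      congr 2
      exact bond_congr dimerAt_dimerAt.symm monosAt_dimerAt.symm
  rw [hre, ← Finset.sum_add_distrib]
  refine Finset.sum_congr rfl fun μ hμ => ?_
  simp only [Finset.mem_filter, mem_separated] at hμ
  have hd := dimerAt_eq_self hμ.1 hμ.2 h2 hL
  conv_rhs => rw [bond]
  rw [hd, map_sub, map_mul, map_mul, Complex.conj_ofReal]
  ring

end Bond

/-- The space spanned by the separated configurations. -/
def sepSpace (L : ℕ) : Submodule ℂ (Fock L) := Submodule.span ℂ (ket '' {μ | IsSeparated μ})

section SepSpace

variable {L : ℕ}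

theorem ket_apply (μ ν : Config L) : (ket μ : Config L → ℂ) ν = if ν = μ then 1 else 0 := by
  classical
  rw [ket, lp.coeFn_single, Pi.single_apply]

theorem inner_ket (μ : Config L) (ψ : Fock L) : ⟪ket μ, ψ⟫_ℂ = ψ μ := by
  rw [ket, lp.inner_single_left]
  simp

theorem ket_mem_sepSpace {μ : Config L} (h : IsSeparated μ) : ket μ ∈ sepSpace L :=
  Submodule.subset_span ⟨μ, h, rfl⟩

theorem apply_eq_zero_of_mem {ψ : Fock L} (h : ψ ∈ sepSpace L) {μ : Config L}
    (hμ : ¬IsSeparated μ) : ψ μ = 0 := by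
  induction h using Submodule.span_induction with
  | mem ψ h =>
    obtain ⟨ν, hν, rfl⟩ := h
    rw [ket_apply, if_neg]
    rintro rfl
    exact hμ hν
  | zero => rfl
  | add φ ψ _ _ h1 h2 => rw [lp.coeFn_add, Pi.add_apply, h1, h2, add_zero]
  | smul z ψ _ h1 => rw [lp.coeFn_smul, Pi.smul_apply, h1, smul_zero]

theorem sum_smul_ket_apply (s : Finset (Config L)) (f : Config L → ℂ) (μ : Config L) :
    (∑ ν ∈ s, f ν • ket ν : Fock L) μ = if μ ∈ s then f μ else 0 := by
  classical
  rw [← inner_ket, inner_sum]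
  simp only [inner_smul_right, inner_ket, ket_apply]
  simp

theorem sum_smul_ket_mem (f : Config L → ℂ) : (∑ ν ∈ separated L, f ν • ket ν) ∈ sepSpace L :=
  Submodule.sum_mem _ fun _ hν =>
    Submodule.smul_mem _ _ (ket_mem_sepSpace (mem_separated.1 hν))

theorem eq_sum_of_mem {ψ : Fock L} (h : ψ ∈ sepSpace L) :
    ψ = ∑ ν ∈ separated L, ψ ν • ket ν := by
  ext μ
  rw [sum_smul_ket_apply]
  split_ifs with hμ
  · rfl
  · exact apply_eq_zero_of_mem h (fun h' => hμ (mem_separated.2 h'))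

theorem inner_of_mem (χ : Fock L) {ψ : Fock L} (h : ψ ∈ sepSpace L) :
    ⟪χ, ψ⟫_ℂ = ∑ μ ∈ separated L, starRingEnd ℂ (χ μ) * ψ μ := by
  conv_lhs => rw [eq_sum_of_mem h]
  rw [inner_sum]
  refine Finset.sum_congr rfl fun μ _ => ?_
  rw [inner_smul_right, ← inner_conj_symm, inner_ket, mul_comm]

theorem norm_sq_of_mem {ψ : Fock L} (h : ψ ∈ sepSpace L) :
    ‖ψ‖ ^ 2 = ∑ μ ∈ separated L, ‖ψ μ‖ ^ 2 := by
  rw [← inner_self_eq_norm_sq (𝕜 := ℂ), inner_of_mem ψ h, RCLike.re_to_complex, Complex.re_sum]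
  refine Finset.sum_congr rfl fun μ _ => ?_
  rw [← Complex.normSq_eq_conj_mul_self, Complex.ofReal_re, Complex.normSq_eq_norm_sq]

instance : FiniteDimensional ℂ (sepSpace L) :=
  FiniteDimensional.span_of_finite ℂ ((finite_isSeparated L).image _)

/-- The operator `q_x^* q_x` on the space of the separated configurations. -/
def bondMap (lam : ℂ) (x : ℕ) : sepSpace L →ₗ[ℂ] sepSpace L where
  toFun ψ := ⟨∑ μ ∈ separated L, bondTerm lam x (ψ : Fock L) μ • ket μ, sum_smul_ket_mem _⟩
  map_add' φ ψ := by
    ext1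
    change _ = (∑ μ ∈ separated L, _) + ∑ μ ∈ separated L, _
    rw [← Finset.sum_add_distrib]
    refine Finset.sum_congr rfl fun μ _ => ?_
    rw [← add_smul, Submodule.coe_add, lp.coeFn_add]
    congr 1
    simp only [bondTerm, bond, Pi.add_apply]
    split_ifs <;> ring
  map_smul' z ψ := by
    ext1
    change _ = z • ∑ μ ∈ separated L, _
    rw [Finset.smul_sum]
    refine Finset.sum_congr rfl fun μ _ => ?_
    rw [smul_smul, Submodule.coe_smul, lp.coeFn_smul]
    congr 1
    simp only [bondTerm, bond, Pi.smul_apply, smul_eq_mul]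
    split_ifs <;> ring

variable {lam : ℂ} {x : ℕ}

theorem bondMap_apply (ψ : sepSpace L) {μ : Config L} (h : IsSeparated μ) :
    (bondMap lam x ψ : Fock L) μ = bondTerm lam x (ψ : Fock L) μ := by
  change (∑ μ ∈ separated L, bondTerm lam x (ψ : Fock L) μ • ket μ : Fock L) μ = _
  rw [sum_smul_ket_apply, if_pos (mem_separated.2 h)]

theorem inner_bondMap (h2 : 2 ≤ x) (hL : x + 1 ≤ L) (χ : Fock L) (ψ : sepSpace L) :
    ⟪χ, (bondMap lam x ψ : Fock L)⟫_ℂ = ∑ μ ∈ (separated L).filter (fun μ => occ μ x = 2),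
      starRingEnd ℂ (bond lam x χ μ) * bond lam x (ψ : Fock L) μ := by
  rw [inner_of_mem χ (bondMap lam x ψ).2, ← sum_conj_mul_bondTerm h2 hL]
  refine Finset.sum_congr rfl fun μ hμ => ?_
  rw [bondMap_apply ψ (mem_separated.1 hμ)]

theorem re_inner_bondMap (h2 : 2 ≤ x) (hL : x + 1 ≤ L) (ψ : sepSpace L) :
    (⟪ψ, bondMap lam x ψ⟫_ℂ).re = ∑ μ ∈ (separated L).filter (fun μ => occ μ x = 2),
      ‖bond lam x (ψ : Fock L) μ‖ ^ 2 := by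
  rw [Submodule.coe_inner, inner_bondMap h2 hL, Complex.re_sum]
  refine Finset.sum_congr rfl fun μ _ => ?_
  rw [← Complex.normSq_eq_conj_mul_self, Complex.ofReal_re, Complex.normSq_eq_norm_sq]

theorem bondMap_isPositive (h2 : 2 ≤ x) (hL : x + 1 ≤ L) :
    (bondMap (L := L) lam x).IsPositive := by
  refine ⟨fun φ ψ => ?_, fun ψ => ?_⟩
  · rw [← inner_conj_symm, Submodule.coe_inner, Submodule.coe_inner, inner_bondMap h2 hL,
      inner_bondMap h2 hL, map_sum]
    refine Finset.sum_congr rfl fun μ _ => ?_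
    rw [map_mul, Complex.conj_conj, mul_comm]
  · rw [← inner_conj_symm, RCLike.conj_re]
    change 0 ≤ (⟪ψ, bondMap lam x ψ⟫_ℂ).re
    rw [re_inner_bondMap h2 hL]
    exact Finset.sum_nonneg fun μ _ => by positivity

/-- The ground states of a bond: the amplitude of a dimer is `λ / √2` times the amplitude of the
two monomers it replaces. -/
theorem bondMap_eq_zero_iff (h2 : 2 ≤ x) (hL : x + 1 ≤ L) (ψ : sepSpace L) :
    bondMap lam x ψ = 0 ↔ ∀ μ : Config L, IsSeparated μ → occ μ x = 2 →
      (ψ : Fock L) μ = lam / (√2 : ℝ) * (ψ : Fock L) (monosAt x μ) := by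
  have hs : ((√2 : ℝ) : ℂ) ≠ 0 := by
    simp
  have hiff : ∀ μ : Config L, IsSeparated μ → occ μ x = 2 → (bond lam x (ψ : Fock L) μ = 0 ↔
      (ψ : Fock L) μ = lam / (√2 : ℝ) * (ψ : Fock L) (monosAt x μ)) := fun μ h1 h => by
    rw [bond, dimerAt_eq_self h1 h h2 hL, sub_eq_zero, div_mul_eq_mul_div, eq_div_iff hs, mul_comm]
  constructor
  · intro h μ h1 h3
    have h4 := re_inner_bondMap (lam := lam) h2 hL ψ
    rw [h, inner_zero_right, Complex.zero_re] at h4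
    have h5 := (Finset.sum_eq_zero_iff_of_nonneg (fun μ _ => by positivity)).1 h4.symm μ
      (Finset.mem_filter.2 ⟨mem_separated.2 h1, h3⟩)
    exact (hiff μ h1 h3).1 (by simpa using h5)
  · intro h
    refine IsPositive_ker (bondMap_isPositive h2 hL) ?_
    rw [re_inner_bondMap h2 hL]
    refine (Finset.sum_eq_zero fun μ hμ => ?_).le
    rw [Finset.mem_filter, mem_separated] at hμ
    rw [(hiff μ hμ.1 hμ.2).2 (h μ hμ.1 hμ.2)]
    simp

end SepSpace

/-! ### The Hamiltonian on the separated configurations -/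

section Hamiltonian

variable {L : ℕ} {lam : ℂ} {x : ℕ}

theorem occ_addParticle {ν : Config L} (h1 : 1 ≤ x) (hL : x ≤ L) (y : ℕ) :
    occ (addParticle x ν) y = if y = x then occ ν y + 1 else occ ν y := by
  simp only [occ, addParticle, Finset.mem_Icc]
  split_ifs <;> first | rfl | omega

theorem hop_clearAt (h2 : 2 ≤ x) (χ : Config L → ℂ) (μ : Config L) :
    hop lam x χ (clearAt x μ) = bond lam x χ μ := by
  have e1 : addParticle x (addParticle x (clearAt x μ)) = dimerAt x μ := by
    ext y
    simp only [addParticle, clearAt, dimerAt]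
    split_ifs <;> rfl
  have e2 : addParticle (x + 1) (addParticle (x - 1) (clearAt x μ)) = monosAt x μ := by
    ext y
    simp only [addParticle, clearAt, monosAt]
    split_ifs <;> first | rfl | omega
  have o0 : occ (clearAt x μ) x = 0 := by rw [occ_clearAt, if_pos rfl]
  have o1 : occ (clearAt x μ) (x - 1) = 0 := by
    rw [occ_clearAt, if_neg (by omega), if_pos (by omega)]
  have o2 : occ (clearAt x μ) (x + 1) = 0 := by
    rw [occ_clearAt, if_neg (by omega), if_pos (by omega)]
  rw [hop, bond, e1, e2, o0, o1, o2]
  simp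

theorem exists_clearAt_of_dimer {ν : Config L} (h2 : 2 ≤ x) (hL : x + 1 ≤ L)
    (h : IsSeparated (addParticle x (addParticle x ν))) :
    ∃ μ : Config L, IsSeparated μ ∧ occ μ x = 2 ∧ clearAt x μ = ν := by
  have o : ∀ y, occ (addParticle x (addParticle x ν)) y
      = if y = x then occ ν y + 2 else occ ν y := fun y => by
    rw [occ_addParticle (by omega) (by omega), occ_addParticle (by omega) (by omega)]
    split_ifs <;> rfl
  have hx : occ ν x = 0 := by
    have := h.1 x
    rw [o, if_pos rfl] at this
    omega
  have hx2 : occ (addParticle x (addParticle x ν)) x = 2 := by rw [o, if_pos rfl, hx]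
  refine ⟨_, h, hx2, config_ext fun y _ _ => ?_⟩
  rw [occ_clearAt]
  have hz := o y
  split_ifs with a b
  · rw [a, hx]
  · rw [if_neg a] at hz
    rw [← hz]
    exact (h.occ_eq_zero_of_dimer hx2 a (by omega) (by omega)).symm
  · rw [if_neg a] at hz
    exact hz

theorem exists_clearAt_of_monos {ν : Config L} (h2 : 2 ≤ x) (hL : x + 1 ≤ L)
    (h : IsSeparated (addParticle (x + 1) (addParticle (x - 1) ν))) :
    ∃ μ : Config L, IsSeparated μ ∧ occ μ x = 2 ∧ clearAt x μ = ν := by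
  have o : ∀ y, occ (addParticle (x + 1) (addParticle (x - 1) ν)) y
      = if y + 1 = x ∨ y = x + 1 then occ ν y + 1 else occ ν y := fun y => by
    rw [occ_addParticle (by omega) (by omega), occ_addParticle (by omega) (by omega)]
    split_ifs <;> omega
  have o1 := o (x - 1)
  have o2 := o (x + 1)
  rw [if_pos (by omega)] at o1 o2
  have hs := h.2 (x - 1) (x + 1) (by omega) (by omega) (by omega)
  have hm : HasMonos x (addParticle (x + 1) (addParticle (x - 1) ν)) := ⟨by omega, by omega⟩
  have hx := h.occ_eq_zero_of_hasMonos hm h2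
  refine ⟨_, isSeparated_dimerAt h hm h2 hL, occ_dimerAt_self h2 hL, config_ext fun y _ _ => ?_⟩
  rw [occ_clearAt, occ_dimerAt h2 hL, o]
  rw [o, if_neg (by omega)] at hx
  split_ifs with a b
  · rw [a, hx]
  · rcases b with b | b
    · rw [show y = x - 1 by omega]; omega
    · rw [b]; omega
  · rfl

/-- The matrix elements of `q_x^* q_x` in the energy form, against a vector of the space of the
separated configurations. -/
theorem tsum_hop_eq_inner (h2 : 2 ≤ x) (hL : x + 1 ≤ L) (χ : Fock L) (ψ : sepSpace L) :
    ∑' ν : Config L, starRingEnd ℂ (hop lam x χ ν) * hop lam x (ψ : Fock L) ν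
      = ⟪χ, (bondMap lam x ψ : Fock L)⟫_ℂ := by
  classical
  rw [inner_bondMap h2 hL]
  rw [tsum_eq_sum (s := ((separated L).filter (fun μ => occ μ x = 2)).image (clearAt x)),
    Finset.sum_image]
  · exact Finset.sum_congr rfl fun μ _ => by rw [hop_clearAt h2, hop_clearAt h2]
  · intro μ hμ ν hν h
    simp only [Finset.coe_filter, mem_separated, Set.mem_ofPred_eq] at hμ hν
    rw [← dimerAt_eq_self hμ.1 hμ.2 h2 hL, ← dimerAt_eq_self hν.1 hν.2 h2 hL,
      ← dimerAt_clearAt, h, dimerAt_clearAt]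
  · intro ν hν
    simp only [Finset.mem_image, Finset.mem_filter, mem_separated, not_exists, not_and] at hν
    have z1 : (ψ : Fock L) (addParticle x (addParticle x ν)) = 0 :=
      apply_eq_zero_of_mem ψ.2 fun h => by
        obtain ⟨μ, h3, h4, h5⟩ := exists_clearAt_of_dimer h2 hL h
        exact hν μ ⟨h3, h4⟩ h5
    have z2 : (ψ : Fock L) (addParticle (x + 1) (addParticle (x - 1) ν)) = 0 :=
      apply_eq_zero_of_mem ψ.2 fun h => by
        obtain ⟨μ, h3, h4, h5⟩ := exists_clearAt_of_monos h2 hL h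
        exact hν μ ⟨h3, h4⟩ h5
    rw [show hop lam x (ψ : Fock L) ν = 0 by rw [hop, z1, z2]; ring, mul_zero]

theorem electro_eq_zero {μ : Config L} (h : IsSeparated μ) (c d : ℕ) : electro c d μ = 0 := by
  refine Finset.sum_eq_zero fun x _ => ?_
  by_contra hne
  have := h.2 x (x + 1) (by omega) (left_ne_zero_of_mul hne) (right_ne_zero_of_mul hne)
  have := left_ne_zero_of_mul hne
  have := right_ne_zero_of_mul hne
  omega

theorem energyForm_conj (κ : ℝ) (c d : ℕ) (φ ψ : Fock L) :
    energyForm L κ lam c d φ ψ = starRingEnd ℂ (energyForm L κ lam c d ψ φ) := by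
  simp only [energyForm, map_add, map_mul, Complex.conj_ofReal, map_sum, Complex.conj_tsum,
    Complex.conj_conj, map_natCast]
  congr 1
  · exact tsum_congr fun μ => by ring
  · congr 1
    exact Finset.sum_congr rfl fun x _ => tsum_congr fun ν => by ring

theorem mem_ham_graph {κ : ℝ} {c d : ℕ} (ψ : (ham L κ lam c d).domain) :
    ((ψ : Fock L), ham L κ lam c d ψ) ∈ hamGraph L κ lam c d := by
  rw [← ham_graph]
  exact LinearPMap.mem_graph _ ψ

variable (L lam) in
/-- The restriction of the Hamiltonian with bonds in `X` to the space of the separated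
configurations. -/
def bondSum (κ : ℝ) (X : Finset ℕ) : sepSpace L →ₗ[ℂ] sepSpace L :=
  ∑ x ∈ X, (κ : ℂ) • bondMap lam x

/-- On separated configurations the electrostatic energy vanishes, and `q_x^* q_x` only exchanges a
dimer at `x` with two monomers around `x`. -/
theorem implements_ham {κ : ℝ} {c d : ℕ} (hc : 1 ≤ c) (hd : d ≤ L) :
    Implements (ham L κ lam c d) (bondSum L lam κ (Finset.Ioo c d)) := by
  refine ⟨fun φ ψ => ?_, fun ψ => ?_⟩
  · have h1 := mem_ham_graph φ
    have h2 := mem_ham_graph ψ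
    rw [← h2.2 _ h1.1, ← inner_conj_symm, ← h1.2 _ h2.1, energyForm_conj]
    simp
  · have hmem : ((ψ : Fock L), (bondSum L lam κ (Finset.Ioo c d) ψ : Fock L))
        ∈ hamGraph L κ lam c d := by
      refine ⟨?_, fun χ _ => ?_⟩
      · have : sepSpace L ≤ formDomain L κ lam c d := by
          rw [sepSpace, Submodule.span_le]
          rintro _ ⟨μ, _, rfl⟩
          exact ket_mem_formDomain κ lam c d μ
        exact this ψ.2
      · change energyForm L κ lam c d χ (ψ : Fock L) = _
        have h0 : ∑' μ : Config L, (electro c d μ : ℂ) * (starRingEnd ℂ (χ μ) * (ψ : Fock L) μ)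
            = 0 := by
          rw [← tsum_zero (α := ℂ) (β := Config L)]
          refine tsum_congr fun μ => ?_
          by_cases hμ : IsSeparated μ
          · rw [electro_eq_zero hμ, Nat.cast_zero, zero_mul]
          · rw [apply_eq_zero_of_mem ψ.2 hμ, mul_zero, mul_zero]
        rw [energyForm, h0, zero_add, bondSum, LinearMap.sum_apply, Submodule.coe_sum, inner_sum,
          Finset.mul_sum]
        refine Finset.sum_congr rfl fun x hx => ?_
        rw [Finset.mem_Ioo] at hx
        rw [tsum_hop_eq_inner (by omega) (by omega), LinearMap.smul_apply, Submodule.coe_smul,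
          inner_smul_right]
    rw [← ham_graph, LinearPMap.mem_graph_iff] at hmem
    obtain ⟨⟨y, hyd⟩, hy, hy'⟩ := hmem
    change y = ψ at hy
    subst hy
    exact ⟨hyd, hy'⟩

theorem bondSum_isPositive {κ : ℝ} (hκ : 0 ≤ κ) {X : Finset ℕ}
    (hX : ∀ x ∈ X, 2 ≤ x ∧ x + 1 ≤ L) : (bondSum L lam κ X).IsPositive :=
  LinearMap.isPositive_sum X fun x hx =>
    (bondMap_isPositive (hX x hx).1 (hX x hx).2).smul_of_nonneg (by exact_mod_cast hκ)

/-- The square of the Hamiltonian of at most four consecutive bonds dominates twice the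
Hamiltonian, since a configuration with a dimer at one of the bonds allows no other move. -/
theorem sq_ge_window {X : Finset ℕ} (hX : ∀ x ∈ X, 2 ≤ x ∧ x + 1 ≤ L)
    (hw : ∀ x ∈ X, ∀ y ∈ X, y ≤ x + 3) (ψ : sepSpace L) :
    2 * ∑ x ∈ X, (⟪ψ, bondMap lam x ψ⟫_ℂ).re ≤ ‖∑ x ∈ X, bondMap lam x ψ‖ ^ 2 := by
  have hco : ∀ μ : Config L, IsSeparated μ →
      ((∑ x ∈ X, bondMap lam x ψ : sepSpace L) : Fock L) μ
        = ∑ x ∈ X, bondTerm lam x (ψ : Fock L) μ := fun μ hμ => by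
    rw [Submodule.coe_sum, ← inner_ket, inner_sum]
    refine Finset.sum_congr rfl fun x _ => ?_
    rw [inner_ket, bondMap_apply ψ hμ]
  rw [Submodule.coe_norm, norm_sq_of_mem (∑ x ∈ X, bondMap lam x ψ : sepSpace L).2,
    Finset.sum_congr rfl fun x hx => re_inner_bondMap (hX x hx).1 (hX x hx).2 ψ]
  simp only [Finset.sum_filter]
  rw [Finset.sum_comm, Finset.mul_sum]
  refine Finset.sum_le_sum fun μ hμ => ?_
  rw [mem_separated] at hμ
  rw [hco μ hμ]
  by_cases h : ∃ x ∈ X, occ μ x = 2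
  · obtain ⟨x, hx, hx2⟩ := h
    have hne : ∀ y ∈ X, y ≠ x → occ μ y ≠ 2 ∧ ¬HasMonos y μ := fun y hy hyx =>
      ⟨hμ.ne_two_of_dimer hx2 (hw x hx y hy) (hw y hy x hx) hyx,
        hμ.not_hasMonos_of_dimer hx2 (hw x hx y hy) (hw y hy x hx) (hX y hy).1⟩
    rw [Finset.sum_eq_single_of_mem x hx fun y hy hyx => if_neg (hne y hy hyx).1,
      Finset.sum_eq_single_of_mem x hx fun y hy hyx => by
        rw [bondTerm, if_neg (hne y hy hyx).1, if_neg (hne y hy hyx).2],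
      if_pos hx2, bondTerm, if_pos hx2, norm_mul, mul_pow, Complex.norm_real, Real.norm_eq_abs,
      sq_abs, Real.sq_sqrt (by norm_num)]
  · push Not at h
    rw [Finset.sum_eq_zero fun x hx => if_neg (h x hx), mul_zero]
    positivity

theorem bondSum_gap {κ : ℝ} (hκ : 0 ≤ κ) {X : Finset ℕ} (hX : ∀ x ∈ X, 2 ≤ x ∧ x + 1 ≤ L)
    (hw : ∀ x ∈ X, ∀ y ∈ X, y ≤ x + 3) (ψ : sepSpace L) :
    2 * κ * (⟪ψ, ψ - (bondSum L lam κ X).ker.starProjection ψ⟫_ℂ).re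
      ≤ (⟪ψ, bondSum L lam κ X ψ⟫_ℂ).re := by
  refine gap_of_sq_ge (bondSum_isPositive hκ hX) (fun u => ?_) (by positivity) ψ
  have e : bondSum L lam κ X u = (κ : ℂ) • ∑ x ∈ X, bondMap lam x u := by
    rw [bondSum, LinearMap.sum_apply, Finset.smul_sum]
    rfl
  rw [e, inner_smul_right u (∑ x ∈ X, bondMap lam x u) (κ : ℂ), Complex.re_ofReal_mul, inner_sum,
    Complex.re_sum, norm_smul, mul_pow,
    Complex.norm_real, Real.norm_eq_abs, sq_abs]
  nlinarith [mul_le_mul_of_nonneg_left (sq_ge_window (lam := lam) hX hw u) (sq_nonneg κ)]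

/-- Moves at distance at least three act on disjoint sets of sites. -/
theorem bondMap_comm {y : ℕ} (hx2 : 2 ≤ x) (hxL : x + 1 ≤ L) (hy2 : 2 ≤ y) (hyL : y + 1 ≤ L)
    (h : x + 3 ≤ y) (ψ : sepSpace L) :
    bondMap lam x (bondMap lam y ψ) = bondMap lam y (bondMap lam x ψ) := by
  have hdd : ∀ μ : Config L, dimerAt x (dimerAt y μ) = dimerAt y (dimerAt x μ) := fun μ => by
    ext z; simp only [dimerAt]; split_ifs <;> first | rfl | omega
  have hdm : ∀ μ : Config L, dimerAt x (monosAt y μ) = monosAt y (dimerAt x μ) := fun μ => by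
    ext z; simp only [dimerAt, monosAt]; split_ifs <;> first | rfl | omega
  have hmd : ∀ μ : Config L, monosAt x (dimerAt y μ) = dimerAt y (monosAt x μ) := fun μ => by
    ext z; simp only [dimerAt, monosAt]; split_ifs <;> first | rfl | omega
  have hmm : ∀ μ : Config L, monosAt x (monosAt y μ) = monosAt y (monosAt x μ) := fun μ => by
    ext z; simp only [monosAt]; split_ifs <;> first | rfl | omega
  -- whether a move is possible at one of the bonds does not depend on the other one
  have o1 : ∀ (μ : Config L) z, z ≤ x + 1 → occ (dimerAt y μ) z = occ μ z := fun μ z hz => by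
    rw [occ_dimerAt hy2 hyL, if_neg (by omega), if_neg (by omega)]
  have o2 : ∀ (μ : Config L) z, z ≤ x + 1 → occ (monosAt y μ) z = occ μ z := fun μ z hz => by
    rw [occ_monosAt hy2 hyL, if_neg (by omega), if_neg (by omega)]
  have o3 : ∀ (μ : Config L) z, y ≤ z + 1 → occ (dimerAt x μ) z = occ μ z := fun μ z hz => by
    rw [occ_dimerAt hx2 hxL, if_neg (by omega), if_neg (by omega)]
  have o4 : ∀ (μ : Config L) z, y ≤ z + 1 → occ (monosAt x μ) z = occ μ z := fun μ z hz => by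
    rw [occ_monosAt hx2 hxL, if_neg (by omega), if_neg (by omega)]
  have sep : ∀ (z : ℕ), 2 ≤ z → z + 1 ≤ L → ∀ μ : Config L, IsSeparated μ →
      (occ μ z = 2 ∨ HasMonos z μ) → IsSeparated (dimerAt z μ) ∧ IsSeparated (monosAt z μ) := by
    rintro z hz2 hzL μ hμ (hz | hz)
    · exact ⟨(dimerAt_eq_self hμ hz hz2 hzL).symm ▸ hμ, isSeparated_monosAt hμ hz hz2 hzL⟩
    · exact ⟨isSeparated_dimerAt hμ hz hz2 hzL, (monosAt_eq_self hμ hz hz2 hzL).symm ▸ hμ⟩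
  ext μ
  by_cases hμ : IsSeparated μ
  swap
  · rw [apply_eq_zero_of_mem (bondMap lam x _).2 hμ, apply_eq_zero_of_mem (bondMap lam y _).2 hμ]
  rw [bondMap_apply _ hμ, bondMap_apply _ hμ]
  by_cases hx : occ μ x = 2 ∨ HasMonos x μ <;> by_cases hy : occ μ y = 2 ∨ HasMonos y μ
  · obtain ⟨sx1, sx2⟩ := sep x hx2 hxL μ hμ hx
    obtain ⟨sy1, sy2⟩ := sep y hy2 hyL μ hμ hy
    simp only [bondTerm, bond, bondMap_apply _ sx1, bondMap_apply _ sx2, bondMap_apply _ sy1,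
      bondMap_apply _ sy2, HasMonos, o1 _ x (by omega), o2 _ x (by omega), o3 _ y (by omega),
      o4 _ y (by omega), o1 _ (x - 1) (by omega), o2 _ (x - 1) (by omega), o3 _ (y - 1) (by omega),
      o4 _ (y - 1) (by omega), o1 _ (x + 1) (by omega), o2 _ (x + 1) (by omega),
      o3 _ (y + 1) (by omega), o4 _ (y + 1) (by omega), hdd, hdm, hmd, hmm]
    split_ifs <;> ring
  · obtain ⟨sx1, sx2⟩ := sep x hx2 hxL μ hμ hx
    simp only [not_or, HasMonos] at hy
    simp only [bondTerm, bond, bondMap_apply _ sx1, bondMap_apply _ sx2, HasMonos,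
      o3 _ y (by omega), o4 _ y (by omega), o3 _ (y - 1) (by omega),
      o4 _ (y - 1) (by omega), o3 _ (y + 1) (by omega), o4 _ (y + 1) (by omega), if_neg hy.1,
      if_neg hy.2]
    simpa using fun a b => absurd ⟨a, b⟩ hy.2
  · obtain ⟨sy1, sy2⟩ := sep y hy2 hyL μ hμ hy
    simp only [not_or, HasMonos] at hx
    simp only [bondTerm, bond, bondMap_apply _ sy1, bondMap_apply _ sy2, HasMonos,
      o1 _ x (by omega), o2 _ x (by omega), o1 _ (x - 1) (by omega), o2 _ (x - 1) (by omega),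
      o1 _ (x + 1) (by omega), o2 _ (x + 1) (by omega), if_neg hx.1, if_neg hx.2]
    simpa using fun a b => absurd ⟨a, b⟩ hx.2
  · rw [not_or] at hx hy
    rw [bondTerm, bondTerm, if_neg hx.1, if_neg hx.2, if_neg hy.1, if_neg hy.2]

theorem bondSum_comm {κ : ℝ} {X Y : Finset ℕ} (hX : ∀ x ∈ X, 2 ≤ x ∧ x + 1 ≤ L)
    (hY : ∀ x ∈ Y, 2 ≤ x ∧ x + 1 ≤ L) (h : ∀ x ∈ X, ∀ y ∈ Y, x + 3 ≤ y) (ψ : sepSpace L) :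
    bondSum L lam κ X (bondSum L lam κ Y ψ) = bondSum L lam κ Y (bondSum L lam κ X ψ) := by
  simp only [bondSum, LinearMap.sum_apply, LinearMap.smul_apply, map_sum, map_smul,
    Finset.smul_sum]
  rw [Finset.sum_comm]
  refine Finset.sum_congr rfl fun x hx => Finset.sum_congr rfl fun y hy => ?_
  rw [bondMap_comm (hX x hx).1 (hX x hx).2 (hY y hy).1 (hY y hy).2 (h x hx y hy)]

theorem mem_ker_bondSum {κ : ℝ} (hκ : 0 ≤ κ) {X : Finset ℕ} (hX : ∀ x ∈ X, 2 ≤ x ∧ x + 1 ≤ L)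
    {ψ : sepSpace L} :
    ψ ∈ (bondSum L lam κ X).ker ↔ ∀ x ∈ X, (κ : ℂ) • bondMap lam x ψ = 0 := by
  rw [LinearMap.mem_ker, bondSum, sum_apply_eq_zero_iff]
  · rfl
  · exact fun x hx => (bondMap_isPositive (hX x hx).1 (hX x hx).2).smul_of_nonneg
      (by exact_mod_cast hκ)

end Hamiltonian

/-! ### Tilings and separated configurations -/

/-- A tiling without a left boundary tile. -/
def IsTail : List Tile → Prop
  | [] => True
  | t :: T => (t ∈ bulkTiles ∨ (T = [] ∧ t ∈ rightTiles)) ∧ IsTail T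

theorem isTail_iff (T : List Tile) : IsTail T ↔
    ∀ i (hi : i < T.length), T[i] ∈ bulkTiles ∨ (i + 1 = T.length ∧ T[i] ∈ rightTiles) := by
  induction T with
  | nil => simp [IsTail]
  | cons t T ih =>
    rw [IsTail, ih]
    constructor
    · rintro ⟨h1, h2⟩ (_ | i) hi
      · rcases h1 with h1 | ⟨rfl, h1⟩
        · exact Or.inl h1
        · exact Or.inr ⟨rfl, h1⟩
      · have := h2 i (by simpa using hi)
        simpa using this
    · intro h
      refine ⟨?_, fun i hi => ?_⟩
      · have := h 0 (by simp)
        simpa [eq_comm] using this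
      · have := h (i + 1) (by simpa using hi)
        simpa using this

theorem isTiling_iff {L : ℕ} {T : List Tile} : IsTiling L T ↔
    (T.flatMap Tile.sites).length = L ∧
      (IsTail T ∨ ∃ n T', 2 ≤ n ∧ T = .leftB n :: T' ∧ IsTail T') := by
  refine and_congr_right fun _ => ?_
  cases T with
  | nil => simp [IsTail]
  | cons t T =>
    constructor
    · intro h
      have hT : IsTail T := by
        rw [isTail_iff]
        intro i hi
        have := h (i + 1) (by simpa using hi)
        simpa using this
      have h0 := h 0 (by simp)
      simp only [List.getElem_cons_zero, true_and, List.length_cons] at h0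
      rcases h0 with h0 | ⟨n, hn, rfl⟩ | ⟨h0, h1⟩
      · exact Or.inl ⟨Or.inl h0, hT⟩
      · exact Or.inr ⟨n, T, hn, rfl, hT⟩
      · exact Or.inl ⟨Or.inr ⟨List.length_eq_zero_iff.1 (by omega), h1⟩, hT⟩
    · rintro (h | ⟨n, T', hn, h, hT⟩) i hi
      · rcases (isTail_iff _).1 h i hi with h | h
        · exact Or.inl h
        · exact Or.inr (Or.inr h)
      · obtain ⟨rfl, rfl⟩ := List.cons.inj h
        rcases i with _ | i
        · exact Or.inr (Or.inl ⟨rfl, n, hn, rfl⟩)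
        · have := (isTail_iff _).1 hT i (by simpa using hi)
          simp only [List.getElem_cons_succ, List.length_cons, Nat.add_right_cancel_iff]
          tauto

theorem IsTail.mem {T : List Tile} (hT : IsTail T) {t : Tile} (ht : t ∈ T) :
    t ∈ bulkTiles ∨ t ∈ rightTiles := by
  obtain ⟨i, hi, rfl⟩ := List.mem_iff_getElem.1 ht
  exact ((isTail_iff T).1 hT i hi).imp_right And.right

theorem leftB_notMem_bulkTiles (n : ℕ) : Tile.leftB n ∉ bulkTiles := by simp [bulkTiles]

theorem leftB_notMem_rightTiles (n : ℕ) : Tile.leftB n ∉ rightTiles := by simp [rightTiles]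

/-- The tiles `(n00)` and `(0n)` of the tiling have `n = 2`. -/
def HasBulkEnds (T : List Tile) : Prop :=
  ∀ n, (.leftB n ∈ T → n = 2) ∧ (.rightB n ∈ T → n = 2)

/-- The separation condition for a list of occupation numbers. -/
def ListSep (l : List ℕ) : Prop :=
  (∀ i, l.getD i 0 ≤ 2) ∧
    ∀ i j, i < j → l.getD i 0 ≠ 0 → l.getD j 0 ≠ 0 → i + l.getD i 0 + l.getD j 0 ≤ j

/-- The first two occupation numbers are at most `1` and `2`, so that the list needs no left boundary
tile and can follow any bulk tile. -/
def ListClear (l : List ℕ) : Prop := ∀ i, l.getD i 0 ≤ i + 1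

theorem ListSep.void_cons {l : List ℕ} (h : ListSep l) : ListSep (0 :: l) := by
  refine ⟨fun i => ?_, fun i j hij => ?_⟩
  · rcases i with _ | i
    · simp
    · simpa using h.1 i
  · rcases i with _ | i <;> rcases j with _ | j <;> simp
    have := h.2 i j
    simp only [List.getD_eq_getElem?_getD] at this
    omega

theorem ListSep.mono_cons {l : List ℕ} (h : ListSep l) (hc : ListClear l) :
    ListSep (1 :: 0 :: l) := by
  refine ⟨fun i => ?_, fun i j hij => ?_⟩
  · rcases i with _ | _ | i
    · simp
    · simp
    · simpa using h.1 i
  · rcases i with _ | _ | i <;> rcases j with _ | _ | j <;> simp at hij ⊢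
    · have := hc j
      simp only [List.getD_eq_getElem?_getD] at this
      omega
    · have := h.2 i j
      simp only [List.getD_eq_getElem?_getD] at this
      omega

theorem ListSep.leftB_cons {l : List ℕ} (h : ListSep l) (hc : ListClear l) :
    ListSep (2 :: 0 :: 0 :: l) := by
  refine ⟨fun i => ?_, fun i j hij => ?_⟩
  · rcases i with _ | _ | _ | i
    · simp
    · simp
    · simp
    · simpa using h.1 i
  · rcases i with _ | _ | _ | i <;> rcases j with _ | _ | _ | j <;> simp at hij ⊢
    · have := hc j
      simp only [List.getD_eq_getElem?_getD] at this
      omega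
    · have := h.2 i j
      simp only [List.getD_eq_getElem?_getD] at this
      omega

theorem ListClear.void_cons {l : List ℕ} (h : ListClear l) : ListClear (0 :: l) := by
  rintro (_ | i)
  · simp
  · have := h i
    simp only [List.getD_cons_succ]
    omega

theorem ListClear.mono_cons {l : List ℕ} (h : ListClear l) : ListClear (1 :: 0 :: l) := by
  rintro (_ | _ | i)
  · simp
  · simp
  · have := h i
    simp only [List.getD_cons_succ]
    omega

theorem ListClear.dimer_cons {l : List ℕ} (h : ListClear l) : ListClear (0 :: 2 :: 0 :: 0 :: l) := by
  rintro (_ | _ | _ | _ | i)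
  · simp
  · simp
  · simp
  · simp
  · have := h i
    simp only [List.getD_cons_succ]
    omega

theorem listSep_listClear_nil : ListSep [] ∧ ListClear [] := by
  refine ⟨⟨fun i => by simp, fun i j _ => by simp⟩, fun i => by simp⟩

theorem IsTail.listSep {T : List Tile} (hT : IsTail T) (hb : HasBulkEnds T) :
    ListSep (T.flatMap Tile.sites) ∧ ListClear (T.flatMap Tile.sites) := by
  induction T with
  | nil => exact listSep_listClear_nil
  | cons t T ih =>
    obtain ⟨h1, h2⟩ := ih hT.2 fun n => ⟨fun h => (hb n).1 (List.mem_cons_of_mem _ h),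
      fun h => (hb n).2 (List.mem_cons_of_mem _ h)⟩
    obtain ⟨n1, n2⟩ := listSep_listClear_nil
    rw [List.flatMap_cons]
    rcases hT.1 with (rfl | rfl | rfl) | ⟨rfl, (rfl | rfl) | ⟨n, hn, rfl⟩⟩
    · exact ⟨h1.void_cons, h2.void_cons⟩
    · exact ⟨h1.mono_cons h2, h2.mono_cons⟩
    · exact ⟨(h1.leftB_cons h2).void_cons, h2.dimer_cons⟩
    · refine ⟨⟨?_, ?_⟩, ?_⟩
      · rintro (_ | i) <;> simp [Tile.sites]
      · rintro (_ | i) (_ | j) <;> simp [Tile.sites]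
      · rintro (_ | i) <;> simp [Tile.sites]
    · refine ⟨⟨?_, ?_⟩, ?_⟩
      · rintro (_ | _ | _ | i) <;> simp [Tile.sites]
      · rintro (_ | _ | _ | i) (_ | _ | _ | j) <;> simp [Tile.sites]
      · rintro (_ | _ | _ | i) <;> simp [Tile.sites]
    · obtain rfl := (hb n).2 List.mem_cons_self
      refine ⟨⟨?_, ?_⟩, ?_⟩
      · rintro (_ | _ | i) <;> simp [Tile.sites]
      · rintro (_ | _ | i) (_ | _ | j) <;> simp [Tile.sites]
      · rintro (_ | _ | i) <;> simp [Tile.sites]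

theorem ListSep.tail {a : ℕ} {l : List ℕ} (h : ListSep (a :: l)) : ListSep l := by
  refine ⟨fun i => ?_, fun i j hij => ?_⟩
  · simpa using h.1 (i + 1)
  · have := h.2 (i + 1) (j + 1) (by omega)
    simp only [List.getD_cons_succ] at this
    omega

/-- A separated list of occupation numbers is tiled greedily from the left. -/
theorem exists_isTail (l : List ℕ) (h : ListSep l) (hc : ListClear l) :
    ∃ T, IsTail T ∧ HasBulkEnds T ∧ T.flatMap Tile.sites = l := by
  induction hn : l.length using Nat.strong_induction_on generalizing l with
  | _ n ih =>
    subst hn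
    -- the first tile is followed by a shorter list
    have step : ∀ (t : Tile) (l' : List ℕ), t ∈ bulkTiles → l = t.sites ++ l' → ListSep l' →
        ListClear l' → l'.length < l.length →
        ∃ T, IsTail T ∧ HasBulkEnds T ∧ T.flatMap Tile.sites = l := by
      rintro t l' ht rfl h1 h2 h3
      obtain ⟨T, hT, hb, e⟩ := ih _ h3 l' h1 h2 rfl
      refine ⟨t :: T, ⟨Or.inl ht, hT⟩, fun n => ⟨fun hm => ?_, fun hm => ?_⟩, ?_⟩
      · rcases List.mem_cons.1 hm with rfl | hm
        · exact absurd ht (leftB_notMem_bulkTiles n)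
        · exact (hb n).1 hm
      · rcases List.mem_cons.1 hm with rfl | hm
        · simp [bulkTiles] at ht
        · exact (hb n).2 hm
      · rw [List.flatMap_cons, e]
    match l, h, hc, step with
    | [], _, _, _ => exact ⟨[], trivial, fun n => by simp, rfl⟩
    | 0 :: l', h, hc, step =>
      by_cases h2 : l'.getD 0 0 = 2
      · match l', h, hc, step, h2 with
        | [2], _, _, _, _ =>
          exact ⟨[.rightB 2], ⟨Or.inr ⟨rfl, Or.inr ⟨2, le_rfl, rfl⟩⟩, trivial⟩,
            fun n => by simp, rfl⟩
        | [2, a], h, _, _, _ =>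
          have ha := h.2 1 2 (by omega)
          simp at ha
          obtain rfl : a = 0 := by omega
          exact ⟨[.dimerR], ⟨Or.inr ⟨rfl, Or.inl (Or.inr rfl)⟩, trivial⟩, fun n => by simp, rfl⟩
        | 2 :: a :: b :: l'', h, _, step, _ =>
          have ha := h.2 1 2 (by omega)
          have hb := h.2 1 3 (by omega)
          simp at ha hb
          obtain rfl : a = 0 := by omega
          obtain rfl : b = 0 := by omega
          refine step .dimer l'' (by simp [bulkTiles]) rfl h.tail.tail.tail.tail (fun i => ?_)
            (by simp; omega)
          have := h.2 1 (i + 4) (by omega)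
          simp only [List.getD_cons_succ, List.getD_cons_zero] at this
          omega
      · refine step .void l' (by simp [bulkTiles]) rfl h.tail (fun i => ?_) (by simp)
        have h1 := h.1 (i + 1)
        rw [List.getD_cons_succ] at h1
        rcases i with _ | i
        · omega
        · omega
    | [1], _, _, _ =>
      exact ⟨[.monoR], ⟨Or.inr ⟨rfl, Or.inl (Or.inl rfl)⟩, trivial⟩, fun n => by simp, rfl⟩
    | 1 :: a :: l', h, _, step =>
      have ha := h.2 0 1 (by omega)
      simp at ha
      obtain rfl : a = 0 := by omega
      refine step .mono l' (by simp [bulkTiles]) rfl h.tail.tail (fun i => ?_) (by simp)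
      have := h.2 0 (i + 2) (by omega)
      simp only [List.getD_cons_succ, List.getD_cons_zero] at this
      omega
    | (a + 2) :: l', _, hc, _ =>
      have := hc 0
      simp at this

theorem occ_tilingConfig {L : ℕ} {T : List Tile} (h : (T.flatMap Tile.sites).length = L) (i : ℕ) :
    occ (tilingConfig L T) (i + 1) = (T.flatMap Tile.sites).getD i 0 := by
  by_cases hi : i + 1 ≤ L
  · rw [occ_of_mem (Finset.mem_Icc.2 ⟨by omega, hi⟩)]
    rfl
  · rw [occ_of_notMem (by omega), List.getD_eq_default]
    omega

theorem isSeparated_iff_listSep {L : ℕ} {μ : Config L} {l : List ℕ}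
    (h : ∀ i, occ μ (i + 1) = l.getD i 0) : IsSeparated μ ↔ ListSep l := by
  have h0 : occ μ 0 = 0 := occ_of_notMem (by omega)
  constructor
  · intro hμ
    refine ⟨fun i => h i ▸ hμ.1 _, fun i j hij => ?_⟩
    rw [← h, ← h]
    have := hμ.2 (i + 1) (j + 1) (by omega)
    omega
  · intro hl
    refine ⟨fun i => ?_, fun i j hij => ?_⟩
    · rcases i with _ | i
      · omega
      · rw [h]
        exact hl.1 i
    · rcases i with _ | i
      · exact fun h' => absurd h0 h'
      · rcases j with _ | j
        · omega
        · rw [h, h]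
          have := hl.2 i j (by omega)
          omega

/-! ### Replacements of dimers -/

theorem eqvGen_iff {P : List Tile → Prop} (hP : ∀ S T, Replace S T → (P S ↔ P T))
    {S T : List Tile} (h : Relation.EqvGen Replace S T) : P S ↔ P T := by
  induction h with
  | rel S T h => exact hP S T h
  | refl => rfl
  | symm S T _ ih => exact ih.symm
  | trans S T U _ _ ih ih' => exact ih.trans ih'

theorem hasBulkEnds_iff {S T : List Tile} (h : Relation.EqvGen Replace S T) :
    HasBulkEnds S ↔ HasBulkEnds T := by
  refine eqvGen_iff (fun S T h => ?_) h
  cases h <;> simp [HasBulkEnds]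

/-- The replacement of dimers by monomers. -/
def undimer : Tile → List Tile
  | .dimer => [.mono, .mono]
  | .dimerR => [.mono, .monoR]
  | t => [t]

theorem eqvGen_cons (t : Tile) {S T : List Tile} (h : Relation.EqvGen Replace S T) :
    Relation.EqvGen Replace (t :: S) (t :: T) := by
  induction h with
  | rel S T h =>
    cases h with
    | bulk l r => exact .rel _ _ (.bulk (t :: l) r)
    | right l => exact .rel _ _ (.right (t :: l))
  | refl => exact .refl _
  | symm S T _ ih => exact ih.symm
  | trans S T U _ _ ih ih' => exact ih.trans _ _ _ ih'

theorem undimer_of_ne {t : Tile} (h1 : t ≠ .dimer) (h2 : t ≠ .dimerR) : undimer t = [t] := by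
  cases t <;> simp_all [undimer]

theorem eqvGen_undimer {T : List Tile} (hT : IsTail T) :
    Relation.EqvGen Replace (T.flatMap undimer) T := by
  induction T with
  | nil => exact .refl _
  | cons t T ih =>
    have h := ih hT.2
    rw [List.flatMap_cons]
    by_cases h1 : t = .dimer
    · subst h1
      exact .trans _ _ _ (.symm _ _ (.rel _ _ (.bulk [] _))) (eqvGen_cons _ h)
    by_cases h2 : t = .dimerR
    · subst h2
      rcases hT.1 with h' | ⟨rfl, _⟩
      · simp [bulkTiles] at h'
      · exact .symm _ _ (.rel _ _ (.right []))
    · rw [undimer_of_ne h1 h2]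
      exact eqvGen_cons _ h

theorem length_sites_undimer (T : List Tile) :
    ((T.flatMap undimer).flatMap Tile.sites).length = (T.flatMap Tile.sites).length := by
  induction T with
  | nil => rfl
  | cons t T ih =>
    rw [List.flatMap_cons, List.flatMap_append, List.flatMap_cons, List.length_append,
      List.length_append, ih]
    cases t <;> rfl

theorem IsTail.undimer {T : List Tile} (hT : IsTail T) : IsTail (T.flatMap undimer) := by
  induction T with
  | nil => trivial
  | cons t T ih =>
    have h := ih hT.2
    rw [List.flatMap_cons]
    rcases hT.1 with (rfl | rfl | rfl) | ⟨rfl, (rfl | rfl) | ⟨n, hn, rfl⟩⟩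
    · exact ⟨Or.inl (by simp [bulkTiles]), h⟩
    · exact ⟨Or.inl (by simp [bulkTiles]), h⟩
    · exact ⟨Or.inl (by simp [bulkTiles]), Or.inl (by simp [bulkTiles]), h⟩
    · exact ⟨Or.inr ⟨rfl, by simp [rightTiles]⟩, trivial⟩
    · exact ⟨Or.inl (by simp [bulkTiles]), Or.inr ⟨rfl, by simp [rightTiles]⟩, trivial⟩
    · exact ⟨Or.inr ⟨rfl, Or.inr ⟨n, hn, rfl⟩⟩, trivial⟩

theorem notMem_undimer (T : List Tile) :
    .dimer ∉ T.flatMap undimer ∧ .dimerR ∉ T.flatMap undimer := by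
  constructor <;>
  · simp only [List.mem_flatMap, not_exists, not_and]
    intro t _
    cases t <;> simp [undimer]

/-- The root tilings with the allowed boundary tiles. -/
theorem mem_bulkRoots_of_isTail {L : ℕ} (hL : 7 ≤ L) {T : List Tile} (hT : IsTail T)
    (hb : HasBulkEnds T) (hlen : (T.flatMap Tile.sites).length = L) (h1 : .dimer ∉ T)
    (h2 : .dimerR ∉ T) : T ∈ bulkRoots L := by
  have hmem : ∀ t ∈ T, t = .void ∨ t = .mono ∨ t = .monoR ∨ t = .rightB 2 := fun t ht => by
    rcases hT.mem ht with (rfl | rfl | rfl) | (rfl | rfl) | ⟨n, -, rfl⟩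
    · simp
    · simp
    · exact absurd ht h1
    · simp
    · exact absurd ht h2
    · simp [(hb n).2 ht]
  refine ⟨⟨isTiling_iff.2 ⟨hlen, Or.inl hT⟩, h1, h2⟩, fun t ht => ?_,
    fun t ht => hmem t (List.mem_of_getLast? ht)⟩
  cases T with
  | nil => simp at ht
  | cons s T =>
    obtain rfl : s = t := by simpa using ht
    rcases hT.1 with (rfl | rfl | rfl) | ⟨rfl, h⟩
    · simp
    · simp
    · simp at h1
    · rcases hmem s List.mem_cons_self with rfl | rfl | rfl | rfl <;>
        simp [Tile.sites] at hlen <;> omega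

theorem mem_bulkRoots_of_leftB {L : ℕ} (hL : 7 ≤ L) {T : List Tile} (hT : IsTail T)
    (hb : HasBulkEnds T) (hlen : ((Tile.leftB 2 :: T).flatMap Tile.sites).length = L)
    (h1 : .dimer ∉ T) (h2 : .dimerR ∉ T) : .leftB 2 :: T ∈ bulkRoots L := by
  have hmem : ∀ t ∈ T, t = .void ∨ t = .mono ∨ t = .monoR ∨ t = .rightB 2 := fun t ht => by
    rcases hT.mem ht with (rfl | rfl | rfl) | (rfl | rfl) | ⟨n, -, rfl⟩
    · simp
    · simp
    · exact absurd ht h1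
    · simp
    · exact absurd ht h2
    · simp [(hb n).2 ht]
  refine ⟨⟨isTiling_iff.2 ⟨hlen, Or.inr ⟨2, T, le_rfl, rfl, hT⟩⟩, by simpa using h1,
    by simpa using h2⟩, fun t ht => ?_, fun t ht => ?_⟩
  · simp at ht
    simp [← ht]
  · cases T with
    | nil =>
      simp [Tile.sites] at hlen
      omega
    | cons s T =>
      rw [List.getLast?_cons_cons] at ht
      exact hmem t (List.mem_of_getLast? ht)

theorem hasBulkEnds_of_mem_bulkRoots {L : ℕ} {R : List Tile} (h : R ∈ bulkRoots L) :
    HasBulkEnds R := by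
  obtain ⟨⟨hR, h1, h2⟩, h3, h4⟩ := h
  intro n
  rw [IsTiling] at hR
  constructor <;> intro hn <;> obtain ⟨i, hi, e⟩ := List.mem_iff_getElem.1 hn
  · have := hR.2 i hi
    rw [e] at this
    rcases this with h | ⟨rfl, _⟩ | ⟨_, h⟩
    · exact absurd h (leftB_notMem_bulkTiles n)
    · have := h3 (.leftB n) (by rw [← e, List.head?_eq_getElem?, List.getElem?_eq_getElem hi]; rfl)
      simpa using this
    · exact absurd h (leftB_notMem_rightTiles n)
  · have := hR.2 i hi
    rw [e] at this
    rcases this with h | ⟨_, h⟩ | ⟨h, _⟩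
    · simp [bulkTiles] at h
    · simp [leftTiles] at h
    · have := h4 (.rightB n) (by
        rw [← e, List.getLast?_eq_getElem?, show R.length - 1 = i by omega,
          List.getElem?_eq_getElem hi]
        rfl)
      simpa using this

/-- The bulk tiling space is spanned by the separated configurations. -/
theorem bulkSpace_eq {L : ℕ} (hL : 7 ≤ L) : bulkSpace L = sepSpace L := by
  apply le_antisymm
  · refine iSup₂_le fun R hR => Submodule.span_le.2 ?_
    rintro _ ⟨T, ⟨hT, hRT⟩, rfl⟩
    refine ket_mem_sepSpace ?_
    have hb := (hasBulkEnds_iff hRT).1 (hasBulkEnds_of_mem_bulkRoots hR)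
    obtain ⟨hlen, h⟩ := isTiling_iff.1 hT
    rw [isSeparated_iff_listSep (occ_tilingConfig hlen)]
    rcases h with h | ⟨n, T', -, rfl, h⟩
    · exact (h.listSep hb).1
    · obtain rfl := (hb n).1 List.mem_cons_self
      obtain ⟨a, b⟩ := h.listSep fun n => ⟨fun h => (hb n).1 (List.mem_cons_of_mem _ h),
        fun h => (hb n).2 (List.mem_cons_of_mem _ h)⟩
      exact a.leftB_cons b
  · rw [sepSpace, Submodule.span_le]
    rintro _ ⟨μ, hμ, rfl⟩
    -- the occupation numbers of `μ`
    set l : List ℕ := (List.range L).map fun i => occ μ (i + 1) with hl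
    have hocc : ∀ i, occ μ (i + 1) = l.getD i 0 := fun i => by
      by_cases hi : i < L
      · rw [List.getD_eq_getElem _ _ (by simpa [hl] using hi)]
        simp [hl]
      · rw [List.getD_eq_default _ _ (by simpa [hl] using hi), occ_of_notMem (by omega)]
    have hlL : l.length = L := by simp [hl]
    have hsep := (isSeparated_iff_listSep hocc).1 hμ
    have key : ∃ R ∈ bulkRoots L, ∃ T ∈ tilingClass L R, T.flatMap Tile.sites = l := by
      by_cases h0 : l.getD 0 0 = 2
      · match hl' : l, hsep, hlL, h0 with
        | 2 :: a :: b :: l', hsep, hlL, _ =>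
          have ha := hsep.2 0 1 (by omega)
          have hb := hsep.2 0 2 (by omega)
          simp at ha hb
          obtain rfl : a = 0 := by omega
          obtain rfl : b = 0 := by omega
          obtain ⟨T, hT, hb, rfl⟩ := exists_isTail l' hsep.tail.tail.tail fun i => by
            have := hsep.2 0 (i + 3) (by omega)
            simp only [List.getD_cons_succ, List.getD_cons_zero] at this
            omega
          have hlen : ((Tile.leftB 2 :: T).flatMap Tile.sites).length = L := hlL
          have hR := eqvGen_undimer hT
          refine ⟨.leftB 2 :: T.flatMap undimer, mem_bulkRoots_of_leftB hL hT.undimer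
            ((hasBulkEnds_iff hR).2 hb) ?_ (notMem_undimer T).1 (notMem_undimer T).2,
            .leftB 2 :: T, ⟨isTiling_iff.2 ⟨hlen, Or.inr ⟨2, T, le_rfl, rfl, hT⟩⟩,
              eqvGen_cons _ hR⟩, rfl⟩
          rw [← hlen, List.flatMap_cons, List.flatMap_cons, List.length_append, List.length_append,
            length_sites_undimer]
        | [], _, hlL, _ => simp at hlL; omega
        | [_], _, hlL, _ => simp at hlL; omega
        | [_, _], _, hlL, _ => simp at hlL; omega
      · obtain ⟨T, hT, hb, hTl⟩ := exists_isTail l hsep fun i => by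
          have := hsep.1 i
          rcases i with _ | i
          · omega
          · omega
        have hlen : (T.flatMap Tile.sites).length = L := by rw [hTl, hlL]
        have hR := eqvGen_undimer hT
        exact ⟨T.flatMap undimer, mem_bulkRoots_of_isTail hL hT.undimer
          ((hasBulkEnds_iff hR).2 hb) (by rw [length_sites_undimer, hlen]) (notMem_undimer T).1
          (notMem_undimer T).2, T, ⟨isTiling_iff.2 ⟨hlen, Or.inl hT⟩, hR⟩, hTl⟩
    obtain ⟨R, hR, T, hT, hTl⟩ := key
    have hμT : μ = tilingConfig L T := by
      refine config_ext fun x hx1 _ => ?_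
      obtain ⟨i, rfl⟩ := Nat.exists_eq_add_of_le' hx1
      rw [hocc, occ_tilingConfig (by rw [hTl, hlL]), hTl]
    rw [hμT]
    exact Submodule.mem_iSup_of_mem R (Submodule.mem_iSup_of_mem hR
      (Submodule.subset_span ⟨T, hT, rfl⟩))

/-! ### The norms of the squeezed Tao-Thouless states -/

open Classical in
/-- The coverings of `2 n` sites by monomers and dimers. -/
def monoDimer : ℕ → Finset (List Tile)
  | 0 => {[]}
  | 1 => {[.mono]}
  | n + 2 => (monoDimer (n + 1)).image (.mono :: ·) ∪ (monoDimer n).image (.dimer :: ·)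

theorem mem_monoDimer {n : ℕ} {T : List Tile} : T ∈ monoDimer n ↔
    (∀ t ∈ T, t = .mono ∨ t = .dimer) ∧ (T.flatMap Tile.sites).length = 2 * n := by
  induction n using Nat.strong_induction_on generalizing T with
  | _ n ih =>
    match n, ih, T with
    | 0, _, [] => simp [monoDimer]
    | 0, _, t :: T =>
      simp only [monoDimer, Finset.mem_singleton, reduceCtorEq, List.mem_cons, forall_eq_or_imp,
        false_iff, not_and]
      rintro ⟨rfl | rfl, _⟩ <;> simp [Tile.sites]
    | 1, _, [] => simp [monoDimer]
    | 1, ih, t :: T =>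
      have h0 := ih 0 (by omega) (T := T)
      simp only [monoDimer, Finset.mem_singleton, List.cons.injEq, List.mem_cons,
        forall_eq_or_imp] at h0 ⊢
      constructor
      · rintro ⟨rfl, rfl⟩
        simp [Tile.sites]
      · rintro ⟨⟨rfl | rfl, h⟩, h'⟩
        · simp only [List.flatMap_cons, List.length_append, Tile.sites, List.length_cons,
            List.length_nil] at h'
          exact ⟨rfl, h0.2 ⟨h, by omega⟩⟩
        · simp [Tile.sites] at h'
    | n + 2, _, [] => simp [monoDimer]
    | n + 2, ih, t :: T =>
      have h1 := ih (n + 1) (by omega) (T := T)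
      have h0 := ih n (by omega) (T := T)
      simp only [monoDimer, Finset.mem_union, Finset.mem_image, List.cons.injEq, List.mem_cons,
        forall_eq_or_imp, exists_eq_right_right, h0, h1, List.flatMap_cons, List.length_append]
      constructor
      · rintro (⟨⟨h, h'⟩, rfl⟩ | ⟨⟨h, h'⟩, rfl⟩)
        · exact ⟨⟨Or.inl rfl, h⟩, by simp [Tile.sites, h']; omega⟩
        · exact ⟨⟨Or.inr rfl, h⟩, by simp [Tile.sites, h']; omega⟩
      · rintro ⟨⟨rfl | rfl, h⟩, h'⟩
        · simp only [Tile.sites, List.length_cons, List.length_nil] at h'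
          exact Or.inl ⟨⟨h, by omega⟩, rfl⟩
        · simp only [Tile.sites, List.length_cons, List.length_nil] at h'
          exact Or.inr ⟨⟨h, by omega⟩, rfl⟩

theorem isTail_of_monoDimer {T : List Tile} (h : ∀ t ∈ T, t = .mono ∨ t = .dimer) : IsTail T := by
  rw [isTail_iff]
  intro i hi
  rcases h _ (List.getElem_mem hi) with e | e <;> rw [e] <;> simp [bulkTiles]

theorem tilingClass_replicate (n : ℕ) :
    tilingClass (2 * n) (List.replicate n .mono) = (monoDimer n : Set (List Tile)) := by
  ext T
  rw [Finset.mem_coe, mem_monoDimer, tilingClass, Set.mem_ofPred_eq]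
  constructor
  · rintro ⟨hT, h⟩
    refine ⟨?_, hT.1⟩
    refine (eqvGen_iff (P := fun T => ∀ t ∈ T, t = .mono ∨ t = .dimer) (fun S T h => ?_) h).1
      fun t ht => Or.inl (List.eq_of_mem_replicate ht)
    cases h with
    | bulk l r =>
      simp only [List.mem_append, List.mem_cons, List.not_mem_nil]
      grind
    | right l =>
      refine iff_of_false (fun h => ?_) (fun h => ?_)
      · simpa using h .dimerR (by simp)
      · simpa using h .monoR (by simp)
  · rintro ⟨h, hlen⟩
    have hT := isTail_of_monoDimer h
    refine ⟨isTiling_iff.2 ⟨hlen, Or.inl hT⟩, ?_⟩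
    have e : T.flatMap undimer = List.replicate n .mono := by
      have hm : ∀ t ∈ T.flatMap undimer, t = .mono := by
        simp only [List.mem_flatMap]
        rintro t ⟨s, hs, ht⟩
        rcases h s hs with rfl | rfl <;> simpa [undimer] using ht
      obtain ⟨m, h1⟩ : ∃ m, T.flatMap undimer = List.replicate m .mono :=
        ⟨_, List.eq_replicate_of_mem hm⟩
      have h2 : ((T.flatMap undimer).flatMap Tile.sites).length = 2 * n := by
        rw [length_sites_undimer, hlen]
      rw [h1] at h2
      simp only [List.length_flatMap, List.map_replicate, List.sum_replicate, Tile.sites,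
        List.length_cons, List.length_nil, smul_eq_mul] at h2
      rw [h1]
      congr 1
      omega
    rw [← e]
    exact eqvGen_undimer hT

theorem sites_injective_of_monoDimer {S T : List Tile} (hS : ∀ t ∈ S, t = .mono ∨ t = .dimer)
    (hT : ∀ t ∈ T, t = .mono ∨ t = .dimer) (h : S.flatMap Tile.sites = T.flatMap Tile.sites) :
    S = T := by
  induction S generalizing T with
  | nil =>
    cases T with
    | nil => rfl
    | cons t T =>
      rcases hT t List.mem_cons_self with rfl | rfl <;> simp [Tile.sites] at h
  | cons s S ih =>
    have hS' : ∀ t ∈ S, t = .mono ∨ t = .dimer := fun t ht => hS t (List.mem_cons_of_mem _ ht)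
    cases T with
    | nil => rcases hS s List.mem_cons_self with rfl | rfl <;> simp [Tile.sites] at h
    | cons t T =>
      have hT' : ∀ s ∈ T, s = .mono ∨ s = .dimer := fun s hs => hT s (List.mem_cons_of_mem _ hs)
      rcases hS s List.mem_cons_self with rfl | rfl <;>
        rcases hT t List.mem_cons_self with rfl | rfl <;> simp [Tile.sites] at h <;>
        rw [ih hS' hT' h]

theorem tilingConfig_injOn (n : ℕ) :
    Set.InjOn (tilingConfig (2 * n)) (monoDimer n : Set (List Tile)) := by
  intro S hS T hT h
  rw [Finset.mem_coe, mem_monoDimer] at hS hT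
  refine sites_injective_of_monoDimer hS.1 hT.1 (List.ext_getElem (by rw [hS.2, hT.2]) ?_)
  intro i h1 h2
  have := congrArg (occ · (i + 1)) h
  simp only [occ_tilingConfig hS.2, occ_tilingConfig hT.2] at this
  rwa [List.getD_eq_getElem _ _ h1, List.getD_eq_getElem _ _ h2] at this

/-- The squared norm of `φ_n` as a function of `r = |λ|² / 2`. -/
def taoSum (r : ℝ) (n : ℕ) : ℝ := ∑ T ∈ monoDimer n, r ^ dimerCount T

theorem taoSum_succ_succ (r : ℝ) (n : ℕ) :
    taoSum r (n + 2) = taoSum r (n + 1) + r * taoSum r n := by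
  classical
  rw [taoSum, monoDimer, Finset.sum_union, Finset.sum_image, Finset.sum_image, taoSum, taoSum,
    Finset.mul_sum]
  · congr 1
    refine Finset.sum_congr rfl fun T _ => ?_
    rw [dimerCount, List.countP_cons_of_pos rfl, pow_succ, mul_comm, dimerCount]
  · exact fun S _ T _ h => (List.cons.inj h).2
  · exact fun S _ T _ h => (List.cons.inj h).2
  · rw [Finset.disjoint_left]
    intro T h1 h2
    simp only [Finset.mem_image] at h1 h2
    obtain ⟨_, _, rfl⟩ := h1
    obtain ⟨_, _, h⟩ := h2
    simp at h

theorem norm_sq_taoThouless (lam : ℂ) (n : ℕ) :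
    ‖taoThouless lam n‖ ^ 2 = taoSum (‖lam‖ ^ 2 / 2) n := by
  rw [taoThouless, tilingState, tilingClass_replicate, finsum_mem_coe_finset,
    ← inner_self_eq_norm_sq (𝕜 := ℂ), sum_inner, map_sum, taoSum]
  refine Finset.sum_congr rfl fun S hS => ?_
  rw [inner_sum, Finset.sum_eq_single_of_mem S hS]
  · rw [inner_smul_left, inner_smul_right, inner_ket, ket_apply, if_pos rfl, mul_one, map_pow,
      conj_pow_mul_pow, RCLike.re_to_complex, Complex.ofReal_re, norm_div, div_pow,
      Complex.norm_real, Real.norm_eq_abs, sq_abs, Real.sq_sqrt (by norm_num)]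
  · intro T hT hTS
    rw [inner_smul_left, inner_smul_right, inner_ket, ket_apply, if_neg, mul_zero, mul_zero]
    exact fun h => hTS (tilingConfig_injOn n hS hT h).symm

theorem taoSum_pos {r : ℝ} (hr : 0 ≤ r) : ∀ n, 0 < taoSum r n
  | 0 => by simp [taoSum, monoDimer, dimerCount]
  | 1 => by simp [taoSum, monoDimer, dimerCount]
  | n + 2 => by
    have := taoSum_pos hr (n + 1)
    have := taoSum_pos hr n
    rw [taoSum_succ_succ]
    positivity

theorem beta_eq (lam : ℂ) (n : ℕ) : beta lam n = ratio (‖lam‖ ^ 2 / 2) n := by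
  rw [beta, norm_sq_taoThouless, norm_sq_taoThouless]
  have hr : 0 ≤ ‖lam‖ ^ 2 / 2 := by positivity
  generalize ‖lam‖ ^ 2 / 2 = r at *
  induction n with
  | zero => simpa [ratio] using div_self (taoSum_pos hr 0).ne'
  | succ n ih =>
    cases n with
    | zero => simp [taoSum, monoDimer, dimerCount, ratio]
    | succ n =>
      have h1 := taoSum_pos hr (n + 1)
      have h0 := taoSum_pos hr n
      rw [ratio, ← ih, taoSum_succ_succ]
      simp only [Nat.add_sub_cancel]
      field_simp

theorem overlapTerm_eq (lam : ℂ) (n : ℕ) :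
    overlapTerm lam n = overlapRatio (‖lam‖ ^ 2 / 2) n := by
  simp only [overlapTerm, overlapRatio, beta_eq]

/-! ### Root configurations and their bonds -/

section Roots

variable {L : ℕ} {μ : Config L} {x : ℕ}

/-- The centres of the dimers of a configuration; doubly occupied end sites do not count. -/
def dimers (μ : Config L) : Finset ℕ := (Finset.Icc 2 (L - 1)).filter fun x => occ μ x = 2

/-- The bonds of a configuration at which two monomers can be replaced by a dimer. -/
def bonds (μ : Config L) : Finset ℕ := (Finset.Icc 2 (L - 1)).filter fun x => HasMonos x μ

/-- The configuration in which all dimers are replaced by monomers. -/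
def rootConfig (μ : Config L) : Config L :=
  fun y => if (y : ℕ) ∈ dimers μ then 0
    else if (y : ℕ) + 1 ∈ dimers μ ∨ (y : ℕ) - 1 ∈ dimers μ then 1 else μ y

/-- The configuration in which the monomers at the bonds `D` are replaced by dimers. -/
def addDimers (ρ : Config L) (D : Finset ℕ) : Config L :=
  fun y => if (y : ℕ) ∈ D then 2 else if (y : ℕ) + 1 ∈ D ∨ (y : ℕ) - 1 ∈ D then 0 else ρ y

theorem mem_dimers : x ∈ dimers μ ↔ (2 ≤ x ∧ x + 1 ≤ L) ∧ occ μ x = 2 := by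
  simp only [dimers, Finset.mem_filter, Finset.mem_Icc]
  refine and_congr_left fun _ => ?_
  omega

theorem mem_bonds : x ∈ bonds μ ↔ (2 ≤ x ∧ x + 1 ≤ L) ∧ HasMonos x μ := by
  simp only [bonds, Finset.mem_filter, Finset.mem_Icc]
  refine and_congr_left fun _ => ?_
  omega

theorem IsSeparated.succ_notMem_bonds (hμ : IsSeparated μ) (hx : x ∈ bonds μ) :
    x + 1 ∉ bonds μ := fun h => by
  rw [mem_bonds] at hx h
  have h1 := hμ.occ_eq_zero_of_hasMonos h.2 (by omega)
  have := hx.2.2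
  omega

theorem addDimers_empty (ρ : Config L) : addDimers ρ ∅ = ρ := by
  ext y
  simp [addDimers]

theorem rootConfig_of_dimers_eq_empty (h : dimers μ = ∅) : rootConfig μ = μ := by
  ext y
  simp [rootConfig, h]

theorem addDimers_rootConfig (hμ : IsSeparated μ) : addDimers (rootConfig μ) (dimers μ) = μ := by
  refine config_ext fun y hy1 hyL => ?_
  rw [occ_of_mem (Finset.mem_Icc.2 ⟨hy1, hyL⟩), addDimers]
  split_ifs with h1 h2
  · exact (mem_dimers.1 h1).2.symm
  · rcases h2 with h2 | h2
    · change y + 1 ∈ dimers μ at h2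
      rw [mem_dimers] at h2
      exact (hμ.occ_eq_zero_of_dimer h2.2 (by omega) (by omega) (by omega)).symm
    · change y - 1 ∈ dimers μ at h2
      rw [mem_dimers] at h2
      exact (hμ.occ_eq_zero_of_dimer h2.2 (by omega) (by omega) (by omega)).symm
  · simp only [rootConfig, h1, h2, if_false]
    rw [occ_of_mem (Finset.mem_Icc.2 ⟨hy1, hyL⟩)]

theorem dimers_monosAt (hμ : IsSeparated μ) (hx : x ∈ dimers μ) :
    dimers (monosAt x μ) = (dimers μ).erase x := by
  rw [mem_dimers] at hx
  obtain ⟨⟨h2, hL⟩, hx⟩ := hx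
  ext y
  rw [Finset.mem_erase, mem_dimers, mem_dimers, occ_monosAt h2 hL]
  split_ifs with c1 c2
  · simp [c1]
  · have h0 := hμ.occ_eq_zero_of_dimer hx c1 (by omega) (by omega)
    omega
  · omega

theorem rootConfig_monosAt (hμ : IsSeparated μ) (hx : x ∈ dimers μ) :
    rootConfig (monosAt x μ) = rootConfig μ := by
  ext ⟨y, hy⟩
  simp only [rootConfig, dimers_monosAt hμ hx, Finset.mem_erase]
  have hx' := hx
  rw [mem_dimers] at hx
  obtain ⟨⟨h2, hL⟩, hx⟩ := hx
  have n : ∀ z, z ≠ x → z ≤ x + 2 → x ≤ z + 2 → z ∉ dimers μ := fun z a b c h => by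
    have := hμ.occ_eq_zero_of_dimer hx a b c
    have := (mem_dimers.1 h).2
    omega
  by_cases c1 : y = x
  · subst c1
    simp [hx', n (y + 1) (by omega) (by omega) (by omega),
      n (y - 1) (by omega) (by omega) (by omega), monosAt]
  by_cases c2 : y + 1 = x
  · subst c2
    simp [hx', n y (by omega) (by omega) (by omega),
      n (y - 1) (by omega) (by omega) (by omega), monosAt]
  by_cases c3 : y = x + 1
  · subst c3
    simp [hx', n (x + 1) (by omega) (by omega) (by omega),
      n (x + 1 + 1) (by omega) (by omega) (by omega), monosAt]
  · have c4 : y - 1 ≠ x := by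
      rw [Finset.mem_Icc] at hy
      omega
    simp only [ne_eq, c1, c2, c4, not_false_eq_true, true_and, monosAt, c3, or_self, if_false]

theorem IsSeparated.rootConfig (hμ : IsSeparated μ) :
    IsSeparated (rootConfig μ) ∧ dimers (TruncatedHaldane.rootConfig μ) = ∅ := by
  induction hn : (dimers μ).card generalizing μ with
  | zero =>
    rw [Finset.card_eq_zero] at hn
    rw [rootConfig_of_dimers_eq_empty hn]
    exact ⟨hμ, hn⟩
  | succ n ih =>
    obtain ⟨x, hx⟩ := Finset.card_pos.1 (show 0 < (dimers μ).card by omega)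
    rw [← rootConfig_monosAt hμ hx]
    obtain ⟨⟨h2, hL⟩, hx2⟩ := mem_dimers.1 hx
    refine ih (isSeparated_monosAt hμ hx2 h2 hL) ?_
    rw [dimers_monosAt hμ hx, Finset.card_erase_of_mem hx]
    omega

theorem IsSeparated.dimers_mem_indep (hμ : IsSeparated μ) :
    dimers μ ∈ indep (bonds (TruncatedHaldane.rootConfig μ)) := by
  rw [mem_indep]
  refine ⟨fun x hx => ?_, fun x hx h => ?_⟩
  · have hx' := hx
    rw [mem_dimers] at hx
    obtain ⟨⟨h2, hL⟩, hx⟩ := hx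
    have n : ∀ z, z ≠ x → z ≤ x + 2 → x ≤ z + 2 → z ∉ dimers μ := fun z a b c h => by
      have := hμ.occ_eq_zero_of_dimer hx a b c
      have := (mem_dimers.1 h).2
      omega
    refine mem_bonds.2 ⟨⟨h2, hL⟩, ?_, ?_⟩
    · rw [occ_of_mem (Finset.mem_Icc.2 ⟨by omega, by omega⟩)]
      simp [TruncatedHaldane.rootConfig, n (x - 1) (by omega) (by omega) (by omega),
        show x - 1 + 1 = x by omega, hx']
    · rw [occ_of_mem (Finset.mem_Icc.2 ⟨by omega, by omega⟩)]
      simp [TruncatedHaldane.rootConfig, n (x + 1) (by omega) (by omega) (by omega), hx']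
  · rw [mem_dimers] at hx h
    exact hμ.ne_two_of_dimer hx.2 (by omega) (by omega) (by omega) h.2

theorem addDimers_insert {ρ : Config L} (hρ : IsSeparated ρ) {D : Finset ℕ} (hxD : x ∉ D)
    (hD : insert x D ∈ indep (bonds ρ)) :
    addDimers ρ (insert x D) = dimerAt x (addDimers ρ D) ∧ HasMonos x (addDimers ρ D) := by
  rw [mem_indep] at hD
  have hx := hD.1 (Finset.mem_insert_self x D)
  have hb : ∀ z ∈ D, z ∈ bonds ρ := fun z hz => hD.1 (Finset.mem_insert_of_mem hz)
  have hxb := mem_bonds.1 hx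
  obtain ⟨⟨h2, hL⟩, hm⟩ := hxb
  have n1 : x + 1 ∉ D := fun h => hρ.succ_notMem_bonds hx (hb _ h)
  have n2 : x - 1 ∉ D := fun h => hρ.succ_notMem_bonds (hb _ h) (by
    rwa [show x - 1 + 1 = x by omega])
  have n3 : x + 2 ∉ D := fun h => hD.2 x (Finset.mem_insert_self x D) (Finset.mem_insert_of_mem h)
  have n4 : x - 2 ∉ D := fun h => hD.2 (x - 2) (Finset.mem_insert_of_mem h) (by
    have := (mem_bonds.1 (hb _ h)).1
    rw [show x - 2 + 2 = x by omega]
    exact Finset.mem_insert_self x D)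
  constructor
  · ext ⟨y, hy⟩
    rw [Finset.mem_Icc] at hy
    simp only [addDimers, dimerAt, Finset.mem_insert]
    by_cases c1 : y = x
    · simp [c1]
    by_cases c2 : y + 1 = x
    · have : y ∉ D := fun h => n2 (by rwa [show x - 1 = y by omega])
      simp [c1, c2, this]
    by_cases c3 : y = x + 1
    · subst c3
      simp [n1]
    · have c4 : y - 1 ≠ x := by omega
      simp only [c1, c2, c3, c4, false_or, if_false]
  · constructor
    · rw [occ_of_mem (Finset.mem_Icc.2 ⟨by omega, by omega⟩)]
      simp only [addDimers, n2, show x - 1 + 1 = x by omega, hxD, show x - 1 - 1 = x - 2 by omega,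
        n4, or_self, if_false]
      exact (occ_of_mem _).symm.trans hm.1
    · rw [occ_of_mem (Finset.mem_Icc.2 ⟨by omega, by omega⟩)]
      simp only [addDimers, n1, show x + 1 + 1 = x + 2 by omega, hxD, Nat.add_sub_cancel,
        n3, or_self, if_false]
      exact (occ_of_mem _).symm.trans hm.2

theorem isSeparated_addDimers {ρ : Config L} (hρ : IsSeparated ρ) (h0 : dimers ρ = ∅)
    {D : Finset ℕ} (hD : D ∈ indep (bonds ρ)) :
    IsSeparated (addDimers ρ D) ∧ dimers (addDimers ρ D) = D ∧ rootConfig (addDimers ρ D) = ρ := by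
  induction D using Finset.induction_on with
  | empty =>
    rw [addDimers_empty]
    exact ⟨hρ, h0, rootConfig_of_dimers_eq_empty h0⟩
  | insert x D hxD ih =>
    obtain ⟨e, hm⟩ := addDimers_insert hρ hxD hD
    have hD' := mem_indep.1 hD
    obtain ⟨⟨h2, hL⟩, -⟩ := mem_bonds.1 (hD'.1 (Finset.mem_insert_self x D))
    obtain ⟨i1, i2, i3⟩ := ih (mem_indep.2 ⟨(Finset.subset_insert x D).trans hD'.1,
      fun z hz hz' => hD'.2 z (Finset.mem_insert_of_mem hz) (Finset.mem_insert_of_mem hz')⟩)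
    have hs : IsSeparated (addDimers ρ (insert x D)) := e ▸ isSeparated_dimerAt i1 hm h2 hL
    have hx : x ∈ dimers (addDimers ρ (insert x D)) := by
      rw [mem_dimers, e]
      exact ⟨⟨h2, hL⟩, occ_dimerAt_self h2 hL⟩
    have em : monosAt x (addDimers ρ (insert x D)) = addDimers ρ D := by
      rw [e, monosAt_dimerAt, monosAt_eq_self i1 hm h2 hL]
    refine ⟨hs, ?_, ?_⟩
    · have := dimers_monosAt hs hx
      rw [em, i2] at this
      exact (Finset.insert_erase hx).symm.trans (by rw [← this])
    · rw [← rootConfig_monosAt hs hx, em, i3]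

theorem monosAt_addDimers_insert {ρ : Config L} (hρ : IsSeparated ρ) (h0 : dimers ρ = ∅)
    {D : Finset ℕ} (hxD : x ∉ D) (hD : insert x D ∈ indep (bonds ρ)) :
    monosAt x (addDimers ρ (insert x D)) = addDimers ρ D := by
  obtain ⟨e, hm⟩ := addDimers_insert hρ hxD hD
  have hD' := mem_indep.1 hD
  obtain ⟨⟨h2, hL⟩, -⟩ := mem_bonds.1 (hD'.1 (Finset.mem_insert_self x D))
  have i1 := (isSeparated_addDimers hρ h0 (mem_indep.2 ⟨(Finset.subset_insert x D).trans hD'.1,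
    fun z hz hz' => hD'.2 z (Finset.mem_insert_of_mem hz) (Finset.mem_insert_of_mem hz')⟩)).1
  rw [e, monosAt_dimerAt, monosAt_eq_self i1 hm h2 hL]

/-- The separated configurations, listed by their roots and their dimers. -/
theorem sum_separated {M : Type*} [AddCommMonoid M] (F : Config L → M) :
    ∑ μ ∈ separated L, F μ = ∑ ρ ∈ (separated L).filter (fun ρ => dimers ρ = ∅),
      ∑ D ∈ indep (bonds ρ), F (addDimers ρ D) := by
  rw [Finset.sum_sigma']
  refine Finset.sum_bij' (fun μ _ => ⟨rootConfig μ, dimers μ⟩) (fun p _ => addDimers p.1 p.2)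
    ?_ ?_ ?_ ?_ ?_
  · intro μ hμ
    rw [mem_separated] at hμ
    simp only [Finset.mem_sigma, Finset.mem_filter, mem_separated]
    exact ⟨hμ.rootConfig, hμ.dimers_mem_indep⟩
  · rintro ⟨ρ, D⟩ h
    simp only [Finset.mem_sigma, Finset.mem_filter, mem_separated] at h ⊢
    exact (isSeparated_addDimers h.1.1 h.1.2 h.2).1
  · intro μ hμ
    exact addDimers_rootConfig (mem_separated.1 hμ)
  · rintro ⟨ρ, D⟩ h
    simp only [Finset.mem_sigma, Finset.mem_filter, mem_separated] at h
    obtain ⟨-, h1, h2⟩ := isSeparated_addDimers h.1.1 h.1.2 h.2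
    simp only [h1, h2]
  · intro μ hμ
    simp only [addDimers_rootConfig (mem_separated.1 hμ)]

/-! ### The overlap of consecutive ground state projections -/

variable {lam : ℂ}

theorem apply_addDimers_insert {ψ : sepSpace L} {ρ : Config L} (hρ : IsSeparated ρ)
    (h0 : dimers ρ = ∅) (hx : bondMap lam x ψ = 0) {D : Finset ℕ} (hxD : x ∉ D)
    (hD : insert x D ∈ indep (bonds ρ)) :
    (ψ : Fock L) (addDimers ρ (insert x D))
      = lam / (√2 : ℝ) * (ψ : Fock L) (addDimers ρ D) := by
  obtain ⟨⟨h2, hL⟩, -⟩ := mem_bonds.1 ((mem_indep.1 hD).1 (Finset.mem_insert_self x D))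
  obtain ⟨h1, h3, -⟩ := isSeparated_addDimers hρ h0 hD
  have h4 : x ∈ dimers (addDimers ρ (insert x D)) := h3.symm ▸ Finset.mem_insert_self x D
  rw [(bondMap_eq_zero_iff h2 hL ψ).1 hx _ h1 (mem_dimers.1 h4).2,
    monosAt_addDimers_insert hρ h0 hxD hD]

/-- The ground state of the bonds up to `t` with root `ρ` and dimers `v` above `t`: a configuration
with `d` dimers up to `t` has the amplitude `(λ / √2) ^ d`. -/
def groundState (L : ℕ) (lam : ℂ) (t : ℕ) (ρ : Config L) (v : Finset ℕ) : sepSpace L :=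
  ⟨∑ μ ∈ separated L, (if rootConfig μ = ρ ∧ (dimers μ).filter (t < ·) = v then
    (lam / (√2 : ℝ)) ^ ((dimers μ).filter (· ≤ t)).card else 0) • ket μ, sum_smul_ket_mem _⟩

theorem groundState_apply {t : ℕ} {ρ : Config L} {v : Finset ℕ} (hμ : IsSeparated μ) :
    (groundState L lam t ρ v : Fock L) μ =
      if rootConfig μ = ρ ∧ (dimers μ).filter (t < ·) = v then
        (lam / (√2 : ℝ)) ^ ((dimers μ).filter (· ≤ t)).card else 0 := by
  rw [groundState, sum_smul_ket_apply, if_pos (mem_separated.2 hμ)]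

theorem bondMap_groundState (h2 : 2 ≤ x) (hL : x + 1 ≤ L) {t : ℕ} (hxt : x ≤ t) (ρ : Config L)
    (v : Finset ℕ) : bondMap lam x (groundState L lam t ρ v) = 0 := by
  rw [bondMap_eq_zero_iff h2 hL]
  intro μ hμ hx
  have hxd : x ∈ dimers μ := mem_dimers.2 ⟨⟨h2, hL⟩, hx⟩
  rw [groundState_apply hμ, groundState_apply (isSeparated_monosAt hμ hx h2 hL),
    rootConfig_monosAt hμ hxd, dimers_monosAt hμ hxd]
  have e1 : ((dimers μ).erase x).filter (t < ·) = (dimers μ).filter (t < ·) := by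
    ext z
    simp only [Finset.mem_filter, Finset.mem_erase]
    refine ⟨fun h => ⟨h.1.2, h.2⟩, fun h => ⟨⟨by omega, h.1⟩, h.2⟩⟩
  have e2 : ((dimers μ).erase x).filter (· ≤ t) = ((dimers μ).filter (· ≤ t)).erase x := by
    rw [Finset.filter_erase]
  have e3 : x ∈ (dimers μ).filter (· ≤ t) := Finset.mem_filter.2 ⟨hxd, hxt⟩
  rw [e1, e2]
  split_ifs
  · rw [← pow_succ', Finset.card_erase_add_one e3]
  · rw [mul_zero]

theorem norm_sq_div_sqrt_two (lam : ℂ) : ‖lam / (√2 : ℝ)‖ ^ 2 = ‖lam‖ ^ 2 / 2 := by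
  rw [norm_div, div_pow, Complex.norm_real, Real.norm_eq_abs, sq_abs, Real.sq_sqrt (by norm_num)]

/-- If `ψ` is a ground state of the bonds below `t - 1` and orthogonal to the ground states of the
bonds up to `t`, its projection onto the ground states of the last four bonds is small. -/
theorem overlap_estimate {t : ℕ} {F : ℝ} (hF0 : 0 ≤ F)
    (hF : ∀ n, 4 ≤ n → overlapRatio (‖lam‖ ^ 2 / 2) n ≤ F) {ψ χ : sepSpace L}
    (hψ : ∀ x, 2 ≤ x → x + 1 ≤ L → x < t - 1 → bondMap lam x ψ = 0)
    (horth : ∀ φ : sepSpace L,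
      (∀ x, 2 ≤ x → x + 1 ≤ L → x ≤ t → bondMap lam x φ = 0) → ⟪φ, ψ⟫_ℂ = 0)
    (hχ : ∀ x, 2 ≤ x → x + 1 ≤ L → t - 3 ≤ x → x ≤ t → bondMap lam x χ = 0) :
    2 * (⟪χ, ψ⟫_ℂ).re - ‖χ‖ ^ 2 ≤ F * ‖ψ‖ ^ 2 := by
  have e : 2 * (⟪χ, ψ⟫_ℂ).re - ‖χ‖ ^ 2
      = ∑ μ ∈ separated L, projTerm ((χ : Fock L) μ) ((ψ : Fock L) μ) := by
    rw [Submodule.coe_inner, Submodule.coe_norm, inner_of_mem _ ψ.2, norm_sq_of_mem χ.2,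
      Complex.re_sum, Finset.mul_sum, ← Finset.sum_sub_distrib]
    rfl
  rw [e, Submodule.coe_norm, norm_sq_of_mem ψ.2, sum_separated, sum_separated, Finset.mul_sum]
  refine Finset.sum_le_sum fun ρ hρ => ?_
  rw [Finset.mem_filter, mem_separated] at hρ
  obtain ⟨hρ, h0⟩ := hρ
  have hb : ∀ x ∈ bonds ρ, 2 ≤ x ∧ x + 1 ≤ L := fun x hx => (mem_bonds.1 hx).1
  refine bond_estimate (t := t) (c := lam / (√2 : ℝ)) (fun x hx => hρ.succ_notMem_bonds hx)
    (fun x hx => (hb x hx).1) hF0 (by rwa [norm_sq_div_sqrt_two])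
    (u := fun D => (ψ : Fock L) (addDimers ρ D)) (χ := fun D => (χ : Fock L) (addDimers ρ D))
    ?_ ?_ ?_
  · intro x hx hxt D hxD hD
    exact apply_addDimers_insert hρ h0 (hψ x (hb x hx).1 (hb x hx).2 hxt) hxD hD
  · intro x hx hxt1 hxt2 D hxD hD
    exact apply_addDimers_insert hρ h0 (hχ x (hb x hx).1 (hb x hx).2 hxt1 hxt2) hxD hD
  · intro v hv
    have h := horth (groundState L lam t ρ v) fun x h2 hL hxt =>
      bondMap_groundState h2 hL hxt ρ v
    rw [Submodule.coe_inner, inner_of_mem _ ψ.2, sum_separated,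
      Finset.sum_eq_single_of_mem ρ (Finset.mem_filter.2 ⟨mem_separated.2 hρ, h0⟩),
      sum_indep_split _ t, Finset.sum_eq_single_of_mem v hv] at h
    · rw [← h]
      refine Finset.sum_congr rfl fun D hD => ?_
      obtain ⟨e1, e2⟩ := filter_union_of_mem_indep hD hv
      obtain ⟨s1, s2, s3⟩ := isSeparated_addDimers hρ h0 (union_mem_indep hD hv)
      rw [groundState_apply s1, s2, s3, e1, e2, if_pos ⟨rfl, rfl⟩, map_pow]
    · intro v' hv' hne
      refine Finset.sum_eq_zero fun D hD => ?_
      obtain ⟨e1, e2⟩ := filter_union_of_mem_indep hD hv'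
      obtain ⟨s1, s2, s3⟩ := isSeparated_addDimers hρ h0 (union_mem_indep hD hv')
      rw [groundState_apply s1, s2, e1, if_neg fun h => hne h.2, map_zero, zero_mul]
    · intro ρ' hρ' hne
      rw [Finset.mem_filter, mem_separated] at hρ'
      refine Finset.sum_eq_zero fun D hD => ?_
      obtain ⟨s1, s2, s3⟩ := isSeparated_addDimers hρ'.1 hρ'.2 hD
      rw [groundState_apply s1, s3, if_neg fun h => hne h.1, map_zero, zero_mul]

end Roots

/-! ### Ground state projections of windows -/

section Windows

variable {L N : ℕ} {κ : ℝ} {lam : ℂ} {k n m : ℕ}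

variable (L lam κ) in
/-- The projection of `sepSpace L` onto the common ground states of the bonds in `X`. -/
def bondProj (X : Finset ℕ) : sepSpace L →L[ℂ] sepSpace L :=
  (bondSum L lam κ X).ker.starProjection

theorem bondProj_symm (X : Finset ℕ) (u v : sepSpace L) :
    ⟪bondProj L κ lam X u, v⟫_ℂ = ⟪u, bondProj L κ lam X v⟫_ℂ :=
  Submodule.inner_starProjection_left_eq_right _ u v

theorem inner_bondProj_sub (X : Finset ℕ) (v : sepSpace L) :
    ⟪bondProj L κ lam X v, v - bondProj L κ lam X v⟫_ℂ = 0 :=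
  Submodule.sub_starProjection_mem_orthogonal v _ (Submodule.starProjection_apply_mem _ v)

theorem re_inner_bondProj (X : Finset ℕ) (v : sepSpace L) :
    (⟪bondProj L κ lam X v, v⟫_ℂ).re = ‖bondProj L κ lam X v‖ ^ 2 := by
  have h := inner_bondProj_sub (κ := κ) (lam := lam) X v
  rw [inner_sub_right, sub_eq_zero] at h
  rw [h, inner_self_eq_norm_sq_to_K]
  norm_cast

theorem norm_sub_bondProj_sq (X : Finset ℕ) (v : sepSpace L) :
    ‖v - bondProj L κ lam X v‖ ^ 2 = (⟪v, v - bondProj L κ lam X v⟫_ℂ).re := by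
  have h : ⟪v - bondProj L κ lam X v, v - bondProj L κ lam X v⟫_ℂ
      = ⟪v, v - bondProj L κ lam X v⟫_ℂ := by
    rw [inner_sub_left v, inner_bondProj_sub, sub_zero]
  rw [← h]
  exact norm_sq_eq_re_inner (𝕜 := ℂ) _

theorem bondProj_empty (v : sepSpace L) : bondProj L κ lam ∅ v = v :=
  Submodule.starProjection_eq_self_iff.2 (by simp [bondSum])

theorem bondProj_zero (X : Finset ℕ) (v : sepSpace L) : bondProj L 0 lam X v = v :=
  Submodule.starProjection_eq_self_iff.2 (by simp [bondSum])

theorem ker_bondSum_anti (hκ : 0 ≤ κ) {X Y : Finset ℕ} (hY : ∀ x ∈ Y, 2 ≤ x ∧ x + 1 ≤ L)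
    (h : X ⊆ Y) : (bondSum L lam κ Y).ker ≤ (bondSum L lam κ X).ker := fun ψ hψ => by
  rw [mem_ker_bondSum hκ hY] at hψ
  rw [mem_ker_bondSum hκ fun x hx => hY x (h hx)]
  exact fun x hx => hψ x (h hx)

theorem bondProj_of_subset (hκ : 0 ≤ κ) {X Y : Finset ℕ} (hY : ∀ x ∈ Y, 2 ≤ x ∧ x + 1 ≤ L)
    (h : X ⊆ Y) (v : sepSpace L) :
    bondProj L κ lam X (bondProj L κ lam Y v) = bondProj L κ lam Y v :=
  starProjection_starProjection_of_le (ker_bondSum_anti hκ hY h) v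

theorem bondProj_of_subset' (hκ : 0 ≤ κ) {X Y : Finset ℕ} (hY : ∀ x ∈ Y, 2 ≤ x ∧ x + 1 ≤ L)
    (h : X ⊆ Y) (v : sepSpace L) :
    bondProj L κ lam Y (bondProj L κ lam X v) = bondProj L κ lam Y v :=
  starProjection_starProjection_of_le' (ker_bondSum_anti hκ hY h) v

/-- The bonds of `h_n`. -/
def window (k n : ℕ) : Finset ℕ :=
  if n = 2 then Finset.Ioo 1 (4 + k) else Finset.Ioo (2 * n + k - 5) (2 * n + k)

/-- The bonds of `H_n`; for `n = 1` there are none, so that `E_n = G_n - G_{n+1}` also holds for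
`n = 1`. -/
def initialBonds (k n : ℕ) : Finset ℕ :=
  if n ≤ 1 then ∅ else Finset.Ioo 1 (2 * n + k)

theorem mem_window (hk : 1 ≤ k) (hn : 2 ≤ n) {x : ℕ} :
    x ∈ window k n ↔ 2 ≤ x ∧ x + 1 ≤ 2 * n + k ∧ (n = 2 ∨ 2 * n + k ≤ x + 4) := by
  unfold window
  split_ifs with h <;> rw [Finset.mem_Ioo] <;> omega

theorem mem_initialBonds {x : ℕ} :
    x ∈ initialBonds k n ↔ 2 ≤ n ∧ 2 ≤ x ∧ x + 1 ≤ 2 * n + k := by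
  unfold initialBonds
  split_ifs with h
  · simp; omega
  · rw [Finset.mem_Ioo]; omega

theorem initialBonds_mono (h : m ≤ n) : initialBonds k m ⊆ initialBonds k n := fun x hx => by
  rw [mem_initialBonds] at hx ⊢
  omega

theorem window_subset_initialBonds (hk : 1 ≤ k) (hn : 2 ≤ n) (h : n ≤ m) :
    window k n ⊆ initialBonds k m := fun x hx => by
  rw [mem_window hk hn] at hx
  rw [mem_initialBonds]
  omega

theorem window_bound (hk : 1 ≤ k) (hL : L = 2 * N + k) (hn : 2 ≤ n) (hN : n ≤ N) :
    ∀ x ∈ window k n, 2 ≤ x ∧ x + 1 ≤ L := fun x hx => by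
  rw [mem_window hk hn] at hx
  omega

theorem initialBonds_bound (hL : L = 2 * N + k) (hN : n ≤ N) :
    ∀ x ∈ initialBonds k n, 2 ≤ x ∧ x + 1 ≤ L := fun x hx => by
  rw [mem_initialBonds] at hx
  omega

variable (L lam κ k) in
/-- The restriction of `g_n` to `sepSpace L`. -/
def windowProj (n : ℕ) : sepSpace L →L[ℂ] sepSpace L := bondProj L κ lam (window k n)

variable (L lam κ k) in
/-- The restriction of `G_n` to `sepSpace L`, with `G_1 = 1`. -/
def initialProj (n : ℕ) : sepSpace L →L[ℂ] sepSpace L := bondProj L κ lam (initialBonds k n)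

variable (L lam κ k) in
/-- The difference `G_n - G_{n+1}`, which is `E_n` for `n < N`. -/
def incrProj (n : ℕ) : sepSpace L →L[ℂ] sepSpace L :=
  initialProj L κ lam k n - initialProj L κ lam k (n + 1)

theorem implements_hSeq (hk : 1 ≤ k) (hL : L = 2 * N + k) (hn : 2 ≤ n) (hN : n ≤ N) :
    Implements (hSeq L κ lam k n) (bondSum L lam κ (window k n)) := by
  unfold hSeq window
  split_ifs with h
  · exact implements_ham le_rfl (by omega)
  · exact implements_ham (by omega) (by omega)

theorem implements_HSeq (hk : 1 ≤ k) (hL : L = 2 * N + k) (hN : n ≤ N) :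
    Implements (HSeq L κ lam k n) (∑ m ∈ Finset.Icc 2 n, bondSum L lam κ (window k m)) :=
  Implements.sum fun m hm => by
    rw [Finset.mem_Icc] at hm
    exact implements_hSeq hk hL hm.1 (by omega)

theorem ker_sum_window (hκ : 0 ≤ κ) (hk : 1 ≤ k) (hk' : k ≤ 2) (hL : L = 2 * N + k) (hN : n ≤ N) :
    (∑ m ∈ Finset.Icc 2 n, bondSum L lam κ (window k m)).ker
      = (bondSum L lam κ (initialBonds k n)).ker := by
  ext ψ
  have hw : ∀ m ∈ Finset.Icc 2 n, ∀ x ∈ window k m, 2 ≤ x ∧ x + 1 ≤ L := fun m hm => by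
    rw [Finset.mem_Icc] at hm
    exact window_bound hk hL hm.1 (by omega)
  rw [LinearMap.mem_ker, sum_apply_eq_zero_iff fun m hm => bondSum_isPositive hκ (hw m hm),
    mem_ker_bondSum hκ (initialBonds_bound hL hN)]
  constructor
  · intro h x hx
    rw [mem_initialBonds] at hx
    -- the bond `x` lies in the first window that ends beyond it
    have hm : ∃ m ∈ Finset.Icc 2 n, x ∈ window k m := by
      by_cases hx4 : x + 1 ≤ 4 + k
      · exact ⟨2, Finset.mem_Icc.2 ⟨le_rfl, hx.1⟩, (mem_window hk le_rfl).2 (by omega)⟩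
      · exact ⟨(x - k) / 2 + 1, Finset.mem_Icc.2 (by omega),
          (mem_window hk (by omega)).2 (by omega)⟩
    obtain ⟨m, hm, hxm⟩ := hm
    exact (mem_ker_bondSum hκ (hw m hm)).1 (LinearMap.mem_ker.2 (h m hm)) x hxm
  · intro h m hm
    have hm' := Finset.mem_Icc.1 hm
    exact LinearMap.mem_ker.1 ((mem_ker_bondSum hκ (hw m hm)).2 fun x hx =>
      h x (window_subset_initialBonds hk hm'.1 hm'.2 hx))

theorem gProj_eq (hk : 1 ≤ k) (hL : L = 2 * N + k) (hn : 2 ≤ n) (hN : n ≤ N) (ψ : sepSpace L) :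
    gProj L κ lam k n ψ = (windowProj L κ lam k n ψ : Fock L) :=
  (implements_hSeq hk hL hn hN).kerProj_eq ψ

theorem GProj_eq (hκ : 0 ≤ κ) (hk : 1 ≤ k) (hk' : k ≤ 2) (hL : L = 2 * N + k) (hN : n ≤ N)
    (ψ : sepSpace L) : GProj L κ lam k n ψ = (initialProj L κ lam k n ψ : Fock L) := by
  rw [GProj, (implements_HSeq hk hL hN).kerProj_eq ψ, initialProj, bondProj]
  simp only [ker_sum_window hκ hk hk' hL hN]

theorem initialProj_one (v : sepSpace L) : initialProj L κ lam k 1 v = v :=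
  bondProj_empty v

theorem EProj_eq (hκ : 0 ≤ κ) (hk : 1 ≤ k) (hk' : k ≤ 2) (hL : L = 2 * N + k) (hn : 1 ≤ n)
    (hN : n < N) (ψ : sepSpace L) :
    EProj L κ lam k N n ψ = (incrProj L κ lam k n ψ : Fock L) := by
  unfold EProj
  split_ifs with h1 h2
  · subst h1
    change (ψ : Fock L) - GProj L κ lam k 2 ψ = _
    rw [GProj_eq hκ hk hk' hL (by omega), incrProj, sub_apply,
      initialProj_one, Submodule.coe_sub]
  · omega
  · rw [sub_apply, GProj_eq hκ hk hk' hL (by omega),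
      GProj_eq hκ hk hk' hL (by omega), incrProj, sub_apply,
      Submodule.coe_sub]

theorem EProj_last (hκ : 0 ≤ κ) (hk : 1 ≤ k) (hk' : k ≤ 2) (hL : L = 2 * N + k) (hN : 2 ≤ N)
    (ψ : sepSpace L) :
    EProj L κ lam k N N ψ = (initialProj L κ lam k N ψ : Fock L) := by
  rw [EProj, if_neg (by omega), if_pos rfl, GProj_eq hκ hk hk' hL le_rfl]

/-- The projections `g_n` and `G_m` commute if the bonds of `h_n` are among those of `H_m`, or if
they are at least three sites away from them. -/
theorem windowProj_initialProj (hκ : 0 ≤ κ) (hk : 1 ≤ k) (hL : L = 2 * N + k) (hn : 2 ≤ n)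
    (hnN : n ≤ N) (hmN : m ≤ N) (h : n ≤ m ∨ m + 3 ≤ n) (v : sepSpace L) :
    windowProj L κ lam k n (initialProj L κ lam k m v)
      = initialProj L κ lam k m (windowProj L κ lam k n v) := by
  have hw := window_bound (L := L) hk hL hn hnN
  have hi := initialBonds_bound (L := L) hL hmN
  rcases h with h | h
  · have hs := window_subset_initialBonds hk hn h
    exact (bondProj_of_subset hκ hi hs v).trans (bondProj_of_subset' hκ hi hs v).symm
  · refine starProjection_ker_comm_starProjection_ker
      (bondSum_isPositive hκ hi).isSymmetric (fun u => (bondSum_comm hi hw ?_ u).symm) v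
    intro x hx y hy
    rw [mem_initialBonds] at hx
    rw [mem_window hk hn] at hy
    omega

theorem windowProj_incrProj (hκ : 0 ≤ κ) (hk : 1 ≤ k) (hL : L = 2 * N + k) (hn : 2 ≤ n)
    (hnN : n ≤ N) (hmN : m < N) (h : n ≤ m ∨ m + 4 ≤ n) (v : sepSpace L) :
    windowProj L κ lam k n (incrProj L κ lam k m v)
      = incrProj L κ lam k m (windowProj L κ lam k n v) := by
  simp only [incrProj, sub_apply, map_sub]
  rw [windowProj_initialProj hκ hk hL hn hnN (by omega) (by omega),
    windowProj_initialProj hκ hk hL hn hnN (by omega) (by omega)]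

theorem incrProj_symm (n : ℕ) (u v : sepSpace L) :
    ⟪incrProj L κ lam k n u, v⟫_ℂ = ⟪u, incrProj L κ lam k n v⟫_ℂ := by
  simp only [incrProj, sub_apply, inner_sub_left, inner_sub_right,
    initialProj, bondProj_symm]

theorem initialProj_initialProj (hκ : 0 ≤ κ) (hL : L = 2 * N + k) (hmN : m ≤ N) (hnN : n ≤ N)
    (v : sepSpace L) :
    initialProj L κ lam k m (initialProj L κ lam k n v) = initialProj L κ lam k (max m n) v := by
  rcases le_total m n with h | h
  · rw [max_eq_right h]
    exact bondProj_of_subset hκ (initialBonds_bound hL hnN) (initialBonds_mono h) v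
  · rw [max_eq_left h]
    exact bondProj_of_subset' hκ (initialBonds_bound hL hmN) (initialBonds_mono h) v

theorem incrProj_incrProj (hκ : 0 ≤ κ) (hL : L = 2 * N + k) (hmN : m < N) (hnN : n < N)
    (v : sepSpace L) :
    incrProj L κ lam k m (incrProj L κ lam k n v) = if m = n then incrProj L κ lam k n v else 0 := by
  simp only [incrProj, sub_apply, map_sub]
  rw [initialProj_initialProj hκ hL (by omega) (by omega),
    initialProj_initialProj hκ hL (by omega) (by omega),
    initialProj_initialProj hκ hL (by omega) (by omega),
    initialProj_initialProj hκ hL (by omega) (by omega)]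
  split_ifs with h
  · subst h
    simp
  · rcases Nat.lt_or_gt_of_ne h with h | h
    · rw [max_eq_right (show m ≤ n by omega), max_eq_right (show m ≤ n + 1 by omega),
        max_eq_right (show m + 1 ≤ n by omega), max_eq_right (show m + 1 ≤ n + 1 by omega),
        sub_self, sub_self, sub_self]
    · rw [max_eq_left (show n ≤ m by omega), max_eq_left (show n + 1 ≤ m by omega),
        max_eq_left (show n ≤ m + 1 by omega), max_eq_left (show n + 1 ≤ m + 1 by omega)]
      abel

theorem norm_incrProj_le (hκ : 0 ≤ κ) (hL : L = 2 * N + k) (hnN : n < N) (v : sepSpace L) :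
    ‖incrProj L κ lam k n v‖ ≤ ‖v‖ := by
  have h : ‖incrProj L κ lam k n v‖ ^ 2 = (⟪v, incrProj L κ lam k n v⟫_ℂ).re := by
    have e := incrProj_incrProj (lam := lam) hκ hL hnN hnN v
    rw [if_pos rfl] at e
    rw [← e, ← incrProj_symm, e]
    exact norm_sq_eq_re_inner (𝕜 := ℂ) _
  have h2 : (⟪v, incrProj L κ lam k n v⟫_ℂ).re ≤ ‖v‖ * ‖incrProj L κ lam k n v‖ :=
    re_inner_le_norm (𝕜 := ℂ) v _
  by_contra! hlt
  nlinarith [norm_nonneg v]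

/-- The overlap of `g_{n+1}` and `E_n` is at most `√F`. Vectors in the range of `E_n` are ground states
of `H_n` that are orthogonal to those of `H_{n+1}`, so `overlap_estimate` applies with the last bond
`t = 2 n + k + 1` of `h_{n+1}`. -/
theorem norm_windowProj_incrProj_le (hκ : 0 ≤ κ) (hk : 1 ≤ k) (hL : L = 2 * N + k)
    (hn : 1 ≤ n) (hnN : n < N) {F : ℝ} (hF0 : 0 ≤ F)
    (hF : ∀ n, 4 ≤ n → overlapRatio (‖lam‖ ^ 2 / 2) n ≤ F) (v : sepSpace L) :
    ‖windowProj L κ lam k (n + 1) (incrProj L κ lam k n v)‖ ≤ √F * ‖incrProj L κ lam k n v‖ := by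
  -- for `κ = 0` all projections are the identity, and `E_n = 0`
  rcases hκ.eq_or_lt with rfl | hκ0
  · simp [incrProj, initialProj, bondProj_zero]
  -- for `n = 1` the window of `h_2` consists of all the bonds of `H_2`, so `g_2 E_1 = 0`
  rcases hn.eq_or_lt with rfl | hn
  · have hw : window k 2 = initialBonds k 2 := by
      ext x
      rw [mem_window hk le_rfl, mem_initialBonds]
      omega
    have h0 : windowProj L κ lam k (1 + 1) (incrProj L κ lam k 1 v) = 0 := by
      rw [incrProj, windowProj, hw, sub_apply, map_sub, initialProj_one]
      exact sub_eq_zero.2 (bondProj_of_subset hκ (initialBonds_bound hL hnN) subset_rfl v).symm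
    rw [h0, norm_zero]
    positivity
  set ψ := incrProj L κ lam k n v with hψ
  set χ := windowProj L κ lam k (n + 1) ψ with hχ
  have hker : ∀ {X : Finset ℕ} {φ : sepSpace L}, (∀ x ∈ X, 2 ≤ x ∧ x + 1 ≤ L) →
      (φ ∈ (bondSum L lam κ X).ker ↔ ∀ x ∈ X, bondMap lam x φ = 0) := fun hX => by
    rw [mem_ker_bondSum hκ hX]
    simp only [smul_eq_zero, Complex.ofReal_eq_zero, hκ0.ne', false_or]
  have hb := initialBonds_bound (k := k) (n := n) hL hnN.le
  have hb' := initialBonds_bound (k := k) (n := n + 1) hL hnN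
  have hψ1 : initialProj L κ lam k n ψ = ψ := by
    rw [hψ, incrProj, sub_apply, map_sub,
      initialProj_initialProj hκ hL hnN.le hnN.le, initialProj_initialProj hκ hL hnN.le hnN,
      max_self, max_eq_right (Nat.le_succ n)]
  have hψ2 : initialProj L κ lam k (n + 1) ψ = 0 := by
    rw [hψ, incrProj, sub_apply, map_sub,
      initialProj_initialProj hκ hL hnN hnN.le, initialProj_initialProj hκ hL hnN hnN,
      max_self, max_eq_left (Nat.le_succ n), sub_self]
  have h1 := (hker hb).1 (Submodule.starProjection_eq_self_iff.1 hψ1)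
  have key := overlap_estimate (t := 2 * n + k + 1) hF0 hF (ψ := ψ) (χ := χ)
    (fun x h2 _ hx => h1 x (mem_initialBonds.2 (by omega)))
    (fun φ hφ => by
      have h3 : initialProj L κ lam k (n + 1) φ = φ :=
        Submodule.starProjection_eq_self_iff.2 ((hker hb').2 fun x hx => by
          have := hb' x hx
          rw [mem_initialBonds] at hx
          exact hφ x (by omega) (by omega) (by omega))
      rw [← h3, initialProj, bondProj_symm]
      exact (congrArg _ hψ2).trans (inner_zero_right _))
    (fun x h2 hxL hx hx' => (hker (window_bound hk hL (by omega) hnN)).1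
      (Submodule.starProjection_apply_mem _ ψ) x ((mem_window hk (by omega)).2 (by omega)))
  have e : (⟪χ, ψ⟫_ℂ).re = ‖χ‖ ^ 2 := re_inner_bondProj _ ψ
  -- for the projection `χ` of `ψ` the left side of `key` is `‖χ‖²`
  rw [e] at key
  refine abs_le_of_sq_le_sq' ?_ (by positivity) |>.2
  rw [mul_pow, Real.sq_sqrt hF0]
  linarith

theorem card_windows_le (hk : 1 ≤ k) (hk' : k ≤ 2) (N x : ℕ) :
    ((Finset.Icc 1 (N - 1)).filter fun n => x ∈ window k (n + 1)).card ≤ 3 := by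
  refine le_trans (Finset.card_le_card (t := {1, (x - k) / 2, (x - k) / 2 + 1}) fun n hn => ?_)
    Finset.card_le_three
  rw [Finset.mem_filter, Finset.mem_Icc, mem_window hk (by omega)] at hn
  simp only [Finset.mem_insert, Finset.mem_singleton]
  omega

/-- The lower bound on the gap given by the martingale method: every bond lies in at most three
windows. -/
theorem gap_estimate (hκ : 0 ≤ κ) (hk : 1 ≤ k) (hk' : k ≤ 2) (hL : L = 2 * N + k) (hN : 2 ≤ N)
    {F : ℝ} (hF0 : 0 ≤ F) (hF : ∀ n, 4 ≤ n → overlapRatio (‖lam‖ ^ 2 / 2) n ≤ F)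
    (hF1 : F < 1 / 3) {ψ : sepSpace L} (hψ : bondProj L κ lam (Finset.Ioo 1 L) ψ = 0) :
    2 * κ / 3 * (1 - √(3 * F)) ^ 2 * ‖ψ‖ ^ 2
      ≤ (⟪ψ, bondSum L lam κ (Finset.Ioo 1 L) ψ⟫_ℂ).re := by
  have hmem : ∀ {n}, n ∈ Finset.Icc 1 (N - 1) → 1 ≤ n ∧ n < N := fun h => by
    rw [Finset.mem_Icc] at h
    omega
  have hsq : √(3 * F) = √3 * √F := Real.sqrt_mul (by norm_num) F
  have h1 := martingale_estimate (M := N - 1) (e := fun n => incrProj L κ lam k n ψ) (ψ := ψ)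
    (fun n => windowProj L κ lam k (n + 1)) (fun n => bondProj_symm _) (Real.sqrt_nonneg F)
    (by
      rw [← hsq, Real.sqrt_lt' one_pos]
      linarith) ?_ ?_ ?_ ?_
  · rw [← hsq] at h1
    set b : ℕ → ℝ := fun x => κ * (⟪ψ, bondMap lam x ψ⟫_ℂ).re with hb
    have hin : ∀ X, (⟪ψ, bondSum L lam κ X ψ⟫_ℂ).re = ∑ x ∈ X, b x := fun X => by
      simp only [bondSum, LinearMap.sum_apply, LinearMap.smul_apply, inner_sum, inner_smul_right,
        Complex.re_sum, Complex.re_ofReal_mul, hb]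
    have hb0 : ∀ x ∈ Finset.Ioo 1 L, 0 ≤ b x := fun x hx => by
      rw [Finset.mem_Ioo] at hx
      exact mul_nonneg hκ ((bondMap_isPositive (by omega) (by omega)).re_inner_nonneg_right ψ)
    have h2 : 2 * κ * ∑ n ∈ Finset.Icc 1 (N - 1), ‖ψ - windowProj L κ lam k (n + 1) ψ‖ ^ 2
        ≤ ∑ n ∈ Finset.Icc 1 (N - 1), ∑ x ∈ window k (n + 1), b x := by
      rw [Finset.mul_sum]
      refine Finset.sum_le_sum fun n hn => ?_
      have hn := hmem hn
      rw [windowProj, norm_sub_bondProj_sq, ← hin]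
      refine bondSum_gap hκ (window_bound hk hL (by omega) hn.2) (fun x hx y hy => ?_) ψ
      rw [mem_window hk (by omega)] at hx hy
      omega
    have h3 : ∑ n ∈ Finset.Icc 1 (N - 1), ∑ x ∈ window k (n + 1), b x
        ≤ 3 * ∑ x ∈ Finset.Ioo 1 L, b x := by
      rw [Finset.sum_comm' (t' := Finset.Ioo 1 L)
        (s' := fun x => (Finset.Icc 1 (N - 1)).filter fun n => x ∈ window k (n + 1)),
        Finset.mul_sum]
      · refine Finset.sum_le_sum fun x hx => ?_
        rw [Finset.sum_const, nsmul_eq_mul]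
        exact mul_le_mul_of_nonneg_right (by exact_mod_cast card_windows_le hk hk' N x) (hb0 x hx)
      · intro n x
        simp only [Finset.mem_filter, Finset.mem_Ioo]
        refine ⟨fun h => ⟨h, ?_⟩, fun h => h.1⟩
        have := window_bound hk hL (by have := hmem h.1; omega) (hmem h.1).2 x h.2
        omega
    rw [hin]
    have h4 := mul_le_mul_of_nonneg_left h1 (show 0 ≤ 2 * κ by positivity)
    linarith
  · have hG : initialProj L κ lam k N ψ = 0 := by
      rw [initialProj, initialBonds, if_neg (by omega), ← hL, hψ]
    rw [show Finset.Icc 1 (N - 1) = Finset.Ico 1 N by ext; simp; omega]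
    have h := Finset.sum_Ico_sub (fun n => initialProj L κ lam k n ψ) (show 1 ≤ N by omega)
    rw [hG, initialProj_one, zero_sub] at h
    rw [← neg_inj, ← h, ← Finset.sum_neg_distrib]
    exact Finset.sum_congr rfl fun n _ => neg_sub _ _
  · intro m hm n hn hmn
    rw [incrProj_symm, incrProj_incrProj hκ hL (hmem hm).2 (hmem hn).2, if_neg hmn,
      inner_zero_right]
  · intro m hm n hn hmn
    have hm := hmem hm
    have hn := hmem hn
    rw [incrProj_symm, ← windowProj_incrProj hκ hk hL (by omega) hn.2 hm.2 (by omega),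
      incrProj_incrProj hκ hL hm.2 hn.2, if_neg (by omega), map_zero, inner_zero_right]
  · intro n hn
    exact norm_windowProj_incrProj_le hκ hk hL (hmem hn).1 (hmem hn).2 hF0 hF ψ

end Windows

/-! ### The martingale method on the bulk tiling space -/

section Martingale

variable {L N k : ℕ} {κ : ℝ} {lam : ℂ}

theorem restrictsTo_sequences (hκ : 0 ≤ κ) (hk : 1 ≤ k) (hk' : k ≤ 2) (hL : L = 2 * N + k)
    (hN : 2 ≤ N) :
    RestrictsTo (ham L κ lam 1 L) (sepSpace L) ∧
      (∀ n, 2 ≤ n → n ≤ N → RestrictsTo (hSeq L κ lam k n) (sepSpace L) ∧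
        RestrictsTo (HSeq L κ lam k n) (sepSpace L) ∧
        (∀ ψ ∈ sepSpace L, gProj L κ lam k n ψ ∈ sepSpace L) ∧
        (∀ ψ ∈ sepSpace L, GProj L κ lam k n ψ ∈ sepSpace L)) ∧
      (∀ n, 1 ≤ n → n ≤ N → ∀ ψ ∈ sepSpace L, EProj L κ lam k N n ψ ∈ sepSpace L) := by
  refine ⟨(implements_ham le_rfl le_rfl).restrictsTo, fun n hn hnN =>
    ⟨(implements_hSeq hk hL hn hnN).restrictsTo, (implements_HSeq hk hL hnN).restrictsTo,
      fun ψ hψ => ?_, fun ψ hψ => ?_⟩, fun n hn hnN ψ hψ => ?_⟩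
  · rw [gProj_eq hk hL hn hnN ⟨ψ, hψ⟩]
    exact Subtype.coe_prop _
  · rw [GProj_eq hκ hk hk' hL hnN ⟨ψ, hψ⟩]
    exact Subtype.coe_prop _
  · rcases hnN.eq_or_lt with rfl | hnN
    · rw [EProj_last hκ hk hk' hL hN ⟨ψ, hψ⟩]
      exact Subtype.coe_prop _
    · rw [EProj_eq hκ hk hk' hL hn hnN ⟨ψ, hψ⟩]
      exact Subtype.coe_prop _

theorem hSeq_gap (hκ : 0 ≤ κ) (hk : 1 ≤ k) (hk' : k ≤ 2) (hL : L = 2 * N + k) {n : ℕ}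
    (hn : 2 ≤ n) (hnN : n ≤ N) (ψ : Fock L) (hψ : ψ ∈ (hSeq L κ lam k n).domain)
    (hC : ψ ∈ sepSpace L) :
    2 * κ * (⟪ψ, ψ - gProj L κ lam k n ψ⟫_ℂ).re ≤ (⟪ψ, hSeq L κ lam k n ⟨ψ, hψ⟩⟫_ℂ).re := by
  rw [gProj_eq hk hL hn hnN ⟨ψ, hC⟩, (implements_hSeq hk hL hn hnN).apply_eq ⟨ψ, hC⟩ hψ]
  refine bondSum_gap hκ (window_bound hk hL hn hnN) (fun x hx y hy => ?_) ⟨ψ, hC⟩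
  rw [mem_window hk hn] at hx hy
  omega

theorem gProj_EProj (hκ : 0 ≤ κ) (hk : 1 ≤ k) (hk' : k ≤ 2) (hL : L = 2 * N + k) (hN : 2 ≤ N)
    {n m : ℕ} (hn : 2 ≤ n) (hnN : n ≤ N) (hm : 1 ≤ m) (hmN : m ≤ N)
    (h : n ≤ m ∨ m + 4 ≤ n) (ψ : sepSpace L) :
    gProj L κ lam k n (EProj L κ lam k N m ψ) = EProj L κ lam k N m (gProj L κ lam k n ψ) := by
  rw [gProj_eq hk hL hn hnN]
  rcases hmN.eq_or_lt with rfl | hmN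
  · rw [EProj_last hκ hk hk' hL hN, EProj_last hκ hk hk' hL hN, gProj_eq hk hL hn hnN,
      windowProj_initialProj hκ hk hL hn hnN le_rfl (by omega)]
  · rw [EProj_eq hκ hk hk' hL hm hmN, EProj_eq hκ hk hk' hL hm hmN, gProj_eq hk hL hn hnN,
      windowProj_incrProj hκ hk hL hn hnN hmN h]

theorem norm_gProj_EProj_le (hκ : 0 ≤ κ) (hk : 1 ≤ k) (hk' : k ≤ 2) (hL : L = 2 * N + k) {n : ℕ}
    (hn : 1 ≤ n) (hnN : n < N) {F : ℝ} (hF0 : 0 ≤ F)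
    (hF : ∀ n, 4 ≤ n → overlapRatio (‖lam‖ ^ 2 / 2) n ≤ F) :
    ‖(gProj L κ lam k (n + 1) ∘L EProj L κ lam k N n) ∘L (sepSpace L).subtypeL‖ ≤ √F := by
  refine ContinuousLinearMap.opNorm_le_bound _ (Real.sqrt_nonneg F) fun ψ => ?_
  change ‖gProj L κ lam k (n + 1) (EProj L κ lam k N n ψ)‖ ≤ _
  rw [EProj_eq hκ hk hk' hL hn hnN, gProj_eq hk hL (by omega) hnN]
  exact (norm_windowProj_incrProj_le hκ hk hL hn hnN hF0 hF ψ).trans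
    (mul_le_mul_of_nonneg_left (norm_incrProj_le hκ hL hnN ψ) (Real.sqrt_nonneg F))

theorem le_spectralGap (hκ : 0 ≤ κ) (hk : 1 ≤ k) (hk' : k ≤ 2) (hL : L = 2 * N + k) (hN : 2 ≤ N)
    {F : ℝ} (hF0 : 0 ≤ F) (hF : ∀ n, 4 ≤ n → overlapRatio (‖lam‖ ^ 2 / 2) n ≤ F)
    (hF1 : F < 1 / 3) :
    ((2 * κ / 3 * (1 - √(3 * F)) ^ 2 : ℝ) : EReal) ≤ spectralGap (ham L κ lam 1 L) (sepSpace L) := by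
  refine le_iInf fun ⟨⟨ψ, hdom⟩, hC, horth, hne⟩ => EReal.coe_le_coe_iff.2 ?_
  have hI : Implements (ham L κ lam 1 L) (bondSum L lam κ (Finset.Ioo 1 L)) :=
    implements_ham le_rfl le_rfl
  rw [le_div_iff₀ (by have := norm_pos_iff.2 hne; positivity), hI.apply_eq ⟨ψ, hC⟩ hdom]
  refine gap_estimate hκ hk hk' hL hN hF0 hF hF1 (ψ := ⟨ψ, hC⟩) ?_
  have h1 : bondSum L lam κ (Finset.Ioo 1 L) (bondProj L κ lam (Finset.Ioo 1 L) ⟨ψ, hC⟩) = 0 :=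
    LinearMap.mem_ker.1 (Submodule.starProjection_apply_mem _ _)
  have h2 := re_inner_bondProj (κ := κ) (lam := lam) (Finset.Ioo 1 L) ⟨ψ, hC⟩
  have h3 : ⟪bondProj L κ lam (Finset.Ioo 1 L) ⟨ψ, hC⟩, (⟨ψ, hC⟩ : sepSpace L)⟫_ℂ = 0 :=
    horth _ ((hI.mem_kernel_iff _).2 h1)
  rw [h3, Complex.zero_re, eq_comm, sq_eq_zero_iff, norm_eq_zero] at h2
  exact h2

end Martingale

end TruncatedHaldane

end

theorem theorem3p2 :
    ∃ f : ℝ → ℝ,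
      -- `f(|λ|²/2)` is the (finite) supremum of `f_n(|λ|²/2)` over `n ≥ 4`
      (∀ lam : ℂ, IsLUB (Set.range fun n : ℕ => overlapTerm lam (n + 4)) (f (‖lam‖ ^ 2 / 2))) ∧
      (∀ (L N k : ℕ) (κ : ℝ) (lam : ℂ), 7 ≤ L → (k = 1 ∨ k = 2) → L = 2 * N + k → 0 ≤ κ →
        -- all the operators restrict to the bulk tiling space
        (RestrictsTo (ham L κ lam 1 L) (bulkSpace L) ∧
          (∀ n, 2 ≤ n → n ≤ N → RestrictsTo (hSeq L κ lam k n) (bulkSpace L) ∧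
            RestrictsTo (HSeq L κ lam k n) (bulkSpace L) ∧
            (∀ ψ ∈ bulkSpace L, gProj L κ lam k n ψ ∈ bulkSpace L) ∧
            (∀ ψ ∈ bulkSpace L, GProj L κ lam k n ψ ∈ bulkSpace L)) ∧
          (∀ n, 1 ≤ n → n ≤ N → ∀ ψ ∈ bulkSpace L, EProj L κ lam k N n ψ ∈ bulkSpace L)) ∧
        -- first criterion
        (∀ n, 2 ≤ n → n ≤ N → ∀ ψ (hψ : ψ ∈ (hSeq L κ lam k n).domain), ψ ∈ bulkSpace L →
          2 * κ * (⟪ψ, ψ - gProj L κ lam k n ψ⟫_ℂ).re ≤ (⟪ψ, hSeq L κ lam k n ⟨ψ, hψ⟩⟫_ℂ).re) ∧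
        -- second criterion
        (∀ n m, 2 ≤ n → n ≤ N → 1 ≤ m → m ≤ N →
          (∃ ψ ∈ bulkSpace L, gProj L κ lam k n (EProj L κ lam k N m ψ) ≠
            EProj L κ lam k N m (gProj L κ lam k n ψ)) →
          n ≤ m + 3 ∧ m + 1 ≤ n) ∧
        -- third criterion
        (lam ≠ 0 → ∀ n, 2 ≤ n → n ≤ N - 1 →
          ‖(gProj L κ lam k (n + 1) ∘L EProj L κ lam k N n) ∘L (bulkSpace L).subtypeL‖
            ≤ √(f (‖lam‖ ^ 2 / 2))) ∧
        -- the spectral gap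
        (lam ≠ 0 → f (‖lam‖ ^ 2 / 2) < 1 / 3 →
          ((2 * κ / 3 * (1 - √(3 * f (‖lam‖ ^ 2 / 2))) ^ 2 : ℝ) : EReal)
            ≤ spectralGap (ham L κ lam 1 L) (bulkSpace L))) ∧
      (∀ lam : ℂ, ‖lam‖ ≤ 7.4 → f (‖lam‖ ^ 2 / 2) < 1 / 3) := by
  have hterm : ∀ (lam : ℂ) (n : ℕ), overlapTerm lam n = overlapRatio (‖lam‖ ^ 2 / 2) n :=
    overlapTerm_eq
  have hr : ∀ lam : ℂ, 0 ≤ ‖lam‖ ^ 2 / 2 := fun lam => by positivity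
  refine ⟨overlapSup, fun lam => ?_, fun L N k κ lam hL7 hk hL hκ => ?_, fun lam hlam => ?_⟩
  · simp only [hterm]
    exact isLUB_ciSup (bddAbove_overlapRatio (hr lam))
  · have hk1 : 1 ≤ k := by omega
    have hk2 : k ≤ 2 := by omega
    have hN : 2 ≤ N := by omega
    have hF0 := overlapSup_nonneg (hr lam)
    have hF : ∀ n, 4 ≤ n → overlapRatio (‖lam‖ ^ 2 / 2) n ≤ overlapSup (‖lam‖ ^ 2 / 2) :=
      fun n hn => overlapRatio_le_overlapSup (hr lam) hn
    rw [bulkSpace_eq hL7]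
    refine ⟨restrictsTo_sequences hκ hk1 hk2 hL hN,
      fun n hn hnN => hSeq_gap hκ hk1 hk2 hL hn hnN, fun n m hn hnN hm hmN h => ?_,
      fun _ n hn hnN => norm_gProj_EProj_le hκ hk1 hk2 hL (by omega) (by omega) hF0 hF,
      fun _ hF1 => le_spectralGap hκ hk1 hk2 hL hN hF0 hF hF1⟩
    obtain ⟨ψ, hψ, hne⟩ := h
    by_contra hnm
    exact hne (gProj_EProj hκ hk1 hk2 hL hN hn hnN hm hmN (by omega) ⟨ψ, hψ⟩)
  · refine overlapSup_lt (hr lam) ?_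
    nlinarith [norm_nonneg lam]
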